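/- Let $\mathfrak g$ be a complex finite-dimensional simple Lie algebra with Cartan subalgebra $\mathfrak h$, simple roots $\alpha_1,\dots,\alpha_d$, half sum of positive roots $\rho$, weight lattice $X$, and Weyl group $W$ with simple reflections $s_1,\dots,s_d$, length $\ell$ and Bruhat order $<$. Put $\mathcal A=\mathbb Z[q,q^{-1}]$. The Hecke algebra $\mathcal H$ is the $\mathcal A$-algebra with generators $H_1,\dots,H_d$ and relations $(H_i-q^{-1})(H_i+q)=0$ and, for $i\ne j$, $H_iH_jH_i\cdots=H_jH_iH_j\cdots$ with $m_{ij}$ factors on both sides, $m_{ij}$ being the order of $s_is_j$. Put $H_w=H_{i_1}\cdots H_{i_l}$ for a reduced word $w=s_{i_1}\cdots s_{i_l}$, and $H_Y=\sum_{w\in Y}q^{-\ell(w)}H_w$ for $Y\subseteq W$. The bar involution of $\mathcal H$ is the ring automorphism with $\overline{H_k}=H_k^{-1}$, $\overline q=q^{-1}$. For each $w\in W$ let $C_w$ be the unique bar invariant element of $H_w+\sum_{y<w}q\mathbb Z[q]H_y$, and let $P_{y,w}$ be the Kazhdan–Lusztig polynomials, so that $C_w=\sum_{y\le w}q^{\ell(w)-\ell(y)}P_{y,w}(q^{-2})H_y$.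 Let $X_{\mathtt f}\subset X$ be a finite set of integral weights that is invariant under the dot action $w\cdot\lambda=w(\lambda+\rho)-\rho$ and contains a regular orbit, and let $\bar X_{\mathtt f}=X_{\mathtt f}+\rho$, on which $W$ acts from the right by $\mathbf i w=w^{-1}(\mathbf i)$. Write $\mathbf i\preceq\mathbf j$ if $\mathbf j-\mathbf i\in\sum_k\mathbb N\alpha_k$. The free $\mathcal A$-module $\mathbb T_{\mathtt f}$ with basis $v_{\mathbf i}$ ($\mathbf i\in\bar X_{\mathtt f}$) is a right $\mathcal H$-module by: $v_{\mathbf i}H_k=q^{-1}v_{\mathbf i}$ if $\mathbf i s_k=\mathbf i$; $v_{\mathbf i}H_k=v_{\mathbf is_k}$ if $\mathbf is_k\succ\mathbf i$; $v_{\mathbf i}H_k=v_{\mathbf is_k}+(q^{-1}-q)v_{\mathbf i}$ if $\mathbf is_k\prec\mathbf i$. The $q$-Schur algebra is $\mathcal S_q=\mathrm{End}_{\mathcal H}(\mathbb T_{\mathtt f})$. Let $\Lambda_{\mathtt f}$ be the set of $W$-orbits in $\bar X_{\mathtt f}$. Each $\gamma\in\Lambda_{\mathtt f}$ contains exactly one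 anti-dominant weight $\mathbf i_\gamma^-$ (that is, $\langle\mathbf i_\gamma^-,\alpha_k^\vee\rangle\le0$ for all $k$). Let $W_\gamma$ be the parabolic subgroup generated by $J_\gamma=\{s_k:\mathbf i_\gamma^-s_k=\mathbf i_\gamma^-\}$, $w_\circ^\gamma$ its longest element, ${}^{J_\gamma}W$ the set of minimal length representatives of the cosets $W_\gamma w$, and $x_\gamma=q^{\ell(w_\circ^\gamma)}H_{W_\gamma}=C_{w_\circ^\gamma}$. Identify $\mathbb T_{\mathtt f}=\bigoplus_{\gamma}x_\gamma\mathcal H$ by $v_{\mathbf i_\gamma^-w}\mapsto x_\gamma H_w$ for $w\in{}^{J_\gamma}W$; then an element of $\mathcal S_q$ is determined by its values on the $x_\nu$. Let $\mathcal D_{\gamma\nu}$ be the set of minimal length representatives of the double cosets in $W_\gamma\backslash W/W_\nu$ and $\Xi=\{(\gamma,g,\nu):\gamma,\nu\in\Lambda_{\mathtt f},\ g\in\mathcal D_{\gamma\nu}\}$. For $(\gamma,g,\nu)\in\Xi$ let $g^+_{\gamma\nu}$ be the longest element of $W_\gamma gW_\nu$, let $\phi^g_{\gamma\nu}\in\mathcal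 S_q$ be the element with $x_{\nu'}\mapsto\delta_{\nu\nu'}q^{\ell(w_\circ^\nu)}H_{W_\gamma gW_\nu}\in x_\gamma\mathcal H$ for all $\nu'$, and put $[\phi^g_{\gamma\nu}]=q^{\ell(g^+_{\gamma\nu})-\ell(w_\circ^\nu)}\phi^g_{\gamma\nu}$. The bar involution of $\mathcal S_q$ sends $f$ to the element $\overline f\in\mathcal S_q$ with $\overline f(x_\nu)=\overline{f(x_\nu)}$ for all $\nu$, where the bar involution of $\mathcal H$ is applied in each summand $x_\gamma\mathcal H$. Theorem. All these objects are well defined, and the elements $[\phi^g_{\gamma\nu}]$, $(\gamma,g,\nu)\in\Xi$, form an $\mathcal A$-basis of $\mathcal S_q$ (the standard basis). Moreover $\mathcal S_q$ has an $\mathcal A$-basis $\{\{\phi^g_{\gamma\nu}\}:(\gamma,g,\nu)\in\Xi\}$ (the canonical basis) such that, for every $(\gamma,g,\nu)\in\Xi$: 1. $\{\phi^g_{\gamma\nu}\}$ maps $x_\nu=C_{w_\circ^\nu}$ to $C_{g^+_{\gamma\nu}}\in x_\gamma\mathcal H$ and $x_{\nu'}$ to $0$ for $\nu'\ne\nu$;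 2. $\overline{\{\phi^g_{\gamma\nu}\}}=\{\phi^g_{\gamma\nu}\}$; 3. $\{\phi^g_{\gamma\nu}\}\in[\phi^g_{\gamma\nu}]+\sum_{y\in\mathcal D_{\gamma\nu},\,y<g}q\mathbb Z[q]\,[\phi^y_{\gamma\nu}]$; more precisely $$\{\phi^g_{\gamma\nu}\}=[\phi^g_{\gamma\nu}]+\sum_{y\in\mathcal D_{\gamma\nu},\,y<g}q^{\ell(g^+_{\gamma\nu})-\ell(y^+_{\gamma\nu})}P_{y^+_{\gamma\nu},g^+_{\gamma\nu}}(q^{-2})\,[\phi^y_{\gamma\nu}];$$ 4. $\{\phi^g_{\gamma\nu}\}$ is the only element of $\mathcal S_q$ that is bar invariant and lies in $[\phi^g_{\gamma\nu}]+\sum_{y\in\mathcal D_{\gamma\nu},\,y<g}q\mathbb Z[q]\,[\phi^y_{\gamma\nu}]$. -/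

import Mathlib

open scoped LaurentPolynomial

noncomputable section

namespace QSchur

/-- The ring `ℤ[q, q⁻¹]`; the power `q ^ n`, `n : ℤ`, is `LaurentPolynomial.T n`. -/
abbrev A : Type := ℤ[T;T⁻¹]

/-- The element `q ^ n`. -/
abbrev qpow (n : ℤ) : A := LaurentPolynomial.T n

/-- `a ∈ q ℤ[q]`. -/
def InQZq (a : A) : Prop := ∃ p : Polynomial ℤ, a = qpow 1 * Polynomial.toLaurent p

section WeylGroup

variable {ι K M N : Type*} [Field K]
  [AddCommGroup M] [Module K M] [AddCommGroup N] [Module K N] {P : RootPairing ι K M N}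

/-- The Weyl group of a finite root system is finite. -/
instance weylGroup_finite [Finite ι] [P.IsRootSystem] : Finite P.weylGroup := by
  refine Finite.of_injective (fun w : P.weylGroup => RootPairing.Equiv.indexHom P (w : P.Aut)) ?_
  intro w w' h
  have h' : ((w : P.Aut) : RootPairing.Equiv P P).indexEquiv
      = ((w' : P.Aut) : RootPairing.Equiv P P).indexEquiv := h
  apply Subtype.ext
  apply RootPairing.Equiv.ext
  · apply LinearMap.ext_on_range (v := P.root) RootPairing.IsRootSystem.span_root_eq_top
    intro i
    have h1 := RootPairing.Hom.root_weightMap_apply P P i (w : P.Aut).toHom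
    have h2 := RootPairing.Hom.root_weightMap_apply P P i (w' : P.Aut).toHom
    rw [h1, h2]
    exact congrArg P.root (congrArg (fun e : ι ≃ ι => e i) h')
  · apply LinearMap.ext_on_range (v := P.coroot) RootPairing.IsRootSystem.span_coroot_eq_top
    intro i
    have h1 := RootPairing.Hom.coroot_coweightMap_apply P P i (w : P.Aut).toHom
    have h2 := RootPairing.Hom.coroot_coweightMap_apply P P i (w' : P.Aut).toHom
    rw [h1, h2]
    exact congrArg P.coroot (congrArg (fun e : ι ≃ ι => e.symm i) h')
  · exact h'

instance weylGroupFintype [Finite ι] [P.IsRootSystem] : Fintype P.weylGroup := Fintype.ofFinite _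

variable (b : P.Base)

/-- The simple reflection attached to a simple root. -/
def simpleRefl (k : b.support) : P.weylGroup := RootPairing.weylGroup.ofIdx P k

/-- The length of `w`: the least length of a word in the simple reflections with product `w`. -/
def length (w : P.weylGroup) : ℕ :=
  sInf {n | ∃ l : List b.support, (l.map (simpleRefl b)).prod = w ∧ l.length = n}

/-- A reduced word for `w`. -/
def reducedWord (w : P.weylGroup) : List b.support :=
  Classical.epsilon fun l => (l.map (simpleRefl b)).prod = w ∧ l.length = length b w

/-- The strict Bruhat order: `u < w` when `w` is reached from `u` through a nonempty chain of
right multiplications by reflections, each of which raises the length. -/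
def bruhatLT : P.weylGroup → P.weylGroup → Prop :=
  Relation.TransGen fun u w =>
    ∃ i : ι, w = u * RootPairing.weylGroup.ofIdx P i ∧ length b u < length b w

/-- The longest element of a subset of the Weyl group (used for parabolic subgroups and
double cosets of such, where it is unique). -/
def longest (Y : Set P.weylGroup) : P.weylGroup :=
  Classical.epsilon fun w => w ∈ Y ∧ ∀ y ∈ Y, length b y ≤ length b w

/-- The standard parabolic subgroup `W_J`. -/
def parabolic (J : Set b.support) : Subgroup P.weylGroup :=
  Subgroup.closure (simpleRefl b '' J)

/-- `{}^J W`: the minimal length representatives of the cosets `W_J w`. -/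
def minRight (J : Set b.support) : Set P.weylGroup :=
  {w | ∀ u ∈ parabolic b J, length b (u * w) = length b u + length b w}

/-- The minimal length representatives of the double cosets in `W_I \ W / W_J`. -/
def minDouble (I J : Set b.support) : Set P.weylGroup :=
  {w | w ∈ minRight b I ∧ w⁻¹ ∈ minRight b J}

/-! ### The Hecke algebra -/

/-- The defining relations of the Hecke algebra: the quadratic relations
`(H_k - q⁻¹)(H_k + q) = 0` and the braid relations `H_i H_j H_i ⋯ = H_j H_i H_j ⋯`
with `m_{ij}` factors on both sides, `m_{ij}` being the order of `s_i s_j`. -/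
inductive HeckeRel : FreeAlgebra A b.support → FreeAlgebra A b.support → Prop
  | quadratic (k : b.support) :
      HeckeRel
        ((FreeAlgebra.ι A k - algebraMap A _ (qpow (-1))) *
          (FreeAlgebra.ι A k + algebraMap A _ (qpow 1))) 0
  | braid (i j : b.support) (hij : i ≠ j) :
      HeckeRel
        (((CoxeterSystem.alternatingWord i j (orderOf (simpleRefl b i * simpleRefl b j))).map
          (FreeAlgebra.ι A)).prod)
        (((CoxeterSystem.alternatingWord j i (orderOf (simpleRefl b i * simpleRefl b j))).map
          (FreeAlgebra.ι A)).prod)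

/-- The Hecke algebra of the Weyl group. -/
def Hecke : Type _ := RingQuot (HeckeRel b)

instance : Ring (Hecke b) := inferInstanceAs (Ring (RingQuot (HeckeRel b)))

instance : Algebra A (Hecke b) := inferInstanceAs (Algebra A (RingQuot (HeckeRel b)))

/-- The quotient map from the free algebra to the Hecke algebra. -/
def heckeMk : FreeAlgebra A b.support →ₐ[A] Hecke b := RingQuot.mkAlgHom A (HeckeRel b)

/-- The generator `H_k`. -/
def gen (k : b.support) : Hecke b := heckeMk b (FreeAlgebra.ι A k)

theorem gen_quadratic (k : b.support) :
    (gen b k - algebraMap A _ (qpow (-1))) * (gen b k + algebraMap A _ (qpow 1)) = 0 := by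
  have h := RingQuot.mkAlgHom_rel A (HeckeRel.quadratic (b := b) k)
  change heckeMk b _ = heckeMk b _ at h
  simp only [map_mul, map_sub, map_add, AlgHom.commutes, map_zero] at h
  exact h

theorem gen_braid (i j : b.support) (hij : i ≠ j) :
    ((CoxeterSystem.alternatingWord i j (orderOf (simpleRefl b i * simpleRefl b j))).map
      (gen b)).prod =
    ((CoxeterSystem.alternatingWord j i (orderOf (simpleRefl b i * simpleRefl b j))).map
      (gen b)).prod := by
  have h := RingQuot.mkAlgHom_rel A (HeckeRel.braid (b := b) i j hij)
  change heckeMk b _ = heckeMk b _ at h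
  simp only [map_list_prod, List.map_map] at h
  exact h

theorem gen_mul_inv (k : b.support) :
    gen b k * (gen b k + algebraMap A _ (qpow 1 - qpow (-1))) = 1 := by
  have h := gen_quadratic b k
  have h1 : algebraMap A (Hecke b) (qpow (-1)) * algebraMap A (Hecke b) (qpow 1) = 1 := by
    rw [← map_mul, ← LaurentPolynomial.T_add]; simp
  have h2 := Algebra.commutes (qpow (-1)) (gen b k)
  rw [sub_mul, mul_add, mul_add, h1, h2] at h
  rw [map_sub, mul_add, mul_sub]
  have := sub_eq_zero.mp h
  rw [← sub_eq_zero] at h ⊢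
  rw [← h]
  abel

theorem inv_mul_gen (k : b.support) :
    (gen b k + algebraMap A _ (qpow 1 - qpow (-1))) * gen b k = 1 := by
  rw [← gen_mul_inv b k, add_mul, mul_add, Algebra.commutes]

/-- `H_k` as a unit of the Hecke algebra; its inverse is `H_k + q - q⁻¹`. -/
def genUnit (k : b.support) : (Hecke b)ˣ :=
  ⟨gen b k, gen b k + algebraMap A _ (qpow 1 - qpow (-1)), gen_mul_inv b k, inv_mul_gen b k⟩

/-- `H_w`, the product of the generators along a reduced word of `w`. -/
def heckeH (w : P.weylGroup) : Hecke b := ((reducedWord b w).map (gen b)).prod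

/-- The Hecke algebra with the `A`-algebra structure twisted by `q ↦ q⁻¹`. -/
def HeckeTwist : Type _ := Hecke b

instance : Ring (HeckeTwist b) := inferInstanceAs (Ring (Hecke b))

instance : Algebra A (HeckeTwist b) :=
  RingHom.toAlgebra'
    ((algebraMap A (Hecke b)).comp (LaurentPolynomial.invert (R := ℤ)).toRingEquiv.toRingHom)
    (fun c x => Algebra.commutes (A := Hecke b) (LaurentPolynomial.invert c) x)

theorem algebraMap_twist (a : A) :
    algebraMap A (HeckeTwist b) a = algebraMap A (Hecke b) (LaurentPolynomial.invert a) := rfl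

/-- `H_k⁻¹`, as an element of the twisted algebra. -/
def genInv (k : b.support) : HeckeTwist b := (((genUnit b k)⁻¹ : (Hecke b)ˣ) : Hecke b)

theorem alternatingWord_reverse_eq {B : Type*} (i j : B) (m : ℕ) :
    (CoxeterSystem.alternatingWord i j m).reverse =
      if Even m then CoxeterSystem.alternatingWord j i m
      else CoxeterSystem.alternatingWord i j m := by
  induction m generalizing i j with
  | zero => simp [CoxeterSystem.alternatingWord]
  | succ m ih =>
    have h0 : (CoxeterSystem.alternatingWord i j (m + 1)).reverse =
        j :: (CoxeterSystem.alternatingWord j i m).reverse := by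
      rw [CoxeterSystem.alternatingWord_succ, List.concat_eq_append, List.reverse_append]; rfl
    rw [h0, ih]
    by_cases hm : Even m
    · have : ¬ Even (m + 1) := by simpa [Nat.even_add_one] using hm
      rw [if_pos hm, if_neg this, CoxeterSystem.alternatingWord_succ', if_pos hm]
    · have : Even (m + 1) := by simpa [Nat.even_add_one] using hm
      rw [if_neg hm, if_pos this, CoxeterSystem.alternatingWord_succ', if_neg hm]

theorem genInv_prod (l : List b.support) :
    (l.map (genInv b)).prod = ((((l.reverse.map (genUnit b)).prod)⁻¹ : (Hecke b)ˣ) : Hecke b) := by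
  induction l with
  | nil => simp; rfl
  | cons a l ih =>
    rw [List.map_cons, List.prod_cons, ih, List.reverse_cons, List.map_append, List.prod_append,
      mul_inv_rev, Units.val_mul]
    simp [genInv]
    rfl

theorem genUnit_prod (l : List b.support) :
    (((l.map (genUnit b)).prod : (Hecke b)ˣ) : Hecke b) = (l.map (gen b)).prod := by
  induction l with
  | nil => simp
  | cons a l ih => rw [List.map_cons, List.prod_cons, Units.val_mul, ih]; rfl

theorem genUnit_braid (i j : b.support) (hij : i ≠ j) :
    ((CoxeterSystem.alternatingWord i j (orderOf (simpleRefl b i * simpleRefl b j))).map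
      (genUnit b)).prod =
    ((CoxeterSystem.alternatingWord j i (orderOf (simpleRefl b i * simpleRefl b j))).map
      (genUnit b)).prod := by
  apply Units.ext
  rw [genUnit_prod, genUnit_prod, gen_braid b i j hij]

theorem heckeRel_inv ⦃x y : FreeAlgebra A b.support⦄ (h : HeckeRel b x y) :
    FreeAlgebra.lift A (genInv b) x = FreeAlgebra.lift A (genInv b) y := by
  cases h with
  | quadratic k =>
    simp only [map_mul, map_sub, map_add, AlgHom.commutes, map_zero, FreeAlgebra.lift_ι_apply,
      algebraMap_twist, LaurentPolynomial.invert_T]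
    have h := gen_quadratic b k
    have e : genInv b k =
      (gen b k + algebraMap A _ (qpow 1) - algebraMap A _ (qpow (-1)) : Hecke b) := by
      change gen b k + algebraMap A _ (qpow 1 - qpow (-1)) = _
      rw [map_sub]; abel
    rw [e]
    change ((gen b k + algebraMap A _ (qpow 1) - algebraMap A _ (qpow (-1))
        - algebraMap A _ (qpow (- -1)) : Hecke b)) *
      (gen b k + algebraMap A _ (qpow 1) - algebraMap A _ (qpow (-1))
        + algebraMap A _ (qpow (-1)) : Hecke b) = 0
    rw [neg_neg, sub_add_cancel, ← h]
    congr 1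
    abel
  | braid i j hij =>
    simp only [map_list_prod, List.map_map]
    have e : (⇑(FreeAlgebra.lift A (genInv b)) ∘ FreeAlgebra.ι A) = genInv b := by
      funext k; simp
    rw [e, genInv_prod, genInv_prod, alternatingWord_reverse_eq, alternatingWord_reverse_eq]
    split_ifs
    · rw [genUnit_braid b i j hij]
    · rw [genUnit_braid b i j hij]

/-- The bar involution of the Hecke algebra: the ring homomorphism with `H_k ↦ H_k⁻¹` and
`q ↦ q⁻¹`. -/
def bar : Hecke b →+* Hecke b :=
  (RingQuot.liftAlgHom A ⟨FreeAlgebra.lift A (genInv b), heckeRel_inv b⟩ :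
    RingQuot (HeckeRel b) →ₐ[A] HeckeTwist b).toRingHom

theorem bar_gen (k : b.support) : bar b (gen b k) = ((genUnit b k)⁻¹ : (Hecke b)ˣ) := by
  have h := RingQuot.liftAlgHom_mkAlgHom_apply A (FreeAlgebra.lift A (genInv b))
    (heckeRel_inv b) (FreeAlgebra.ι A k)
  rw [FreeAlgebra.lift_ι_apply] at h
  exact h

theorem bar_algebraMap (a : A) :
    bar b (algebraMap A _ a) = algebraMap A _ (LaurentPolynomial.invert a) :=
  AlgHom.commutes (RingQuot.liftAlgHom A ⟨FreeAlgebra.lift A (genInv b), heckeRel_inv b⟩ :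
    RingQuot (HeckeRel b) →ₐ[A] HeckeTwist b) a

/-! ### Sums over the Weyl group and the Kazhdan–Lusztig basis -/

variable [Finite ι] [P.IsRootSystem]

open Classical in
/-- `H_Y = ∑_{w ∈ Y} q^{-ℓ(w)} H_w`. -/
def heckeSum (Y : Set P.weylGroup) : Hecke b :=
  ∑ w : P.weylGroup with w ∈ Y, qpow (-(length b w : ℤ)) • heckeH b w

/-- The `q`-symmetrizer `x_J = ∑_{w ∈ W_J} q^{ℓ(w_∘^J) - ℓ(w)} H_w`. -/
def symmetrizer (J : Set b.support) : Hecke b :=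
  qpow (length b (longest b (parabolic b J : Set P.weylGroup))) •
    heckeSum b (parabolic b J : Set P.weylGroup)

open Classical in
/-- `c` is the Kazhdan–Lusztig basis element attached to `w`: it is bar invariant and lies in
`H_w + ∑_{y < w} q ℤ[q] H_y`. -/
def IsKLElement (w : P.weylGroup) (c : Hecke b) : Prop :=
  bar b c = c ∧ ∃ p : P.weylGroup → A, (∀ y, InQZq (p y)) ∧
    c = heckeH b w + ∑ y : P.weylGroup with bruhatLT b y w, p y • heckeH b y

/-- The Kazhdan–Lusztig basis element `C_w`. -/
def klElement (w : P.weylGroup) : Hecke b := Classical.epsilon (IsKLElement b w)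

/-- The family `p y w` consists of the Kazhdan–Lusztig polynomials `P_{y,w}` of the Weyl group, in
the normalization of Kazhdan and Lusztig, whose variable is `q⁻²` here. -/
def IsKLFamily (p : P.weylGroup → P.weylGroup → Polynomial ℤ) : Prop :=
  (∀ w, p w w = 1) ∧
  (∀ y w, y ≠ w → ¬ bruhatLT b y w → p y w = 0) ∧
  (∀ y w, bruhatLT b y w → 2 * (p y w).natDegree + length b y + 1 ≤ length b w) ∧
  ∀ w, bar b (∑ y : P.weylGroup,
      (qpow ((length b w : ℤ) - length b y) * Polynomial.aeval (qpow (-2)) (p y w)) • heckeH b y) =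
    ∑ y : P.weylGroup,
      (qpow ((length b w : ℤ) - length b y) * Polynomial.aeval (qpow (-2)) (p y w)) • heckeH b y

/-- The Kazhdan–Lusztig polynomial `P_{y,w}`. -/
def klPoly (y w : P.weylGroup) : Polynomial ℤ := Classical.epsilon (IsKLFamily b) y w

/-! ### Weights -/

variable [CharZero K]

/-- Half the sum of the positive roots. -/
def rho : M := (2 : K)⁻¹ • ∑ᶠ i ∈ {i | b.IsPos i}, P.root i

/-- The dot action `w · lam = w (lam + ρ) - ρ`. -/
def dot (w : P.weylGroup) (lam : M) : M := w • (lam + rho b) - rho b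

/-- The partial order `i ≼ j`, i.e. `j - i` is a sum of simple roots. -/
def rootLE (i j : M) : Prop :=
  j - i ∈ AddSubmonoid.closure (P.root '' (b.support : Set ι))

/-- A finite set of integral weights which is invariant under the dot action of the Weyl group and
contains a regular orbit. -/
structure WeightSet where
  /-- The weights. -/
  carrier : Set M
  finite : carrier.Finite
  integral : ∀ lam ∈ carrier, ∀ i, ∃ n : ℤ, P.toLinearMap lam (P.coroot i) = n
  dot_mem : ∀ w, ∀ lam ∈ carrier, dot b w lam ∈ carrier
  exists_regular : ∃ lam ∈ carrier, ∀ w, dot b w lam = lam → w = 1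

namespace WeightSet

variable {b} (X : WeightSet b)

/-- The shifted set of weights `X + ρ`, on which the Weyl group acts linearly. -/
abbrev Shifted : Type _ := {i : M // i - rho b ∈ X.carrier}

/-- The right action `i w = w⁻¹ (i)` of the Weyl group on the shifted weights. -/
def act (i : X.Shifted) (w : P.weylGroup) : X.Shifted :=
  ⟨w⁻¹ • (i : M), by
    have h := X.dot_mem w⁻¹ _ i.2
    simpa only [dot, sub_add_cancel] using h⟩

/-- The free `A`-module with basis `v_i`, `i` running through the shifted weights. -/
abbrev Tmod : Type _ := X.Shifted →₀ A

/-- The standard basis vector `v_i`. -/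
abbrev vec (i : X.Shifted) : X.Tmod := Finsupp.single i 1

open Classical in
/-- The right action of `H_k` on the module: `v_i H_k` is `q⁻¹ v_i` if `i s_k = i`, is `v_{i s_k}`
if `i s_k ≻ i`, and is `v_{i s_k} + (q⁻¹ - q) v_i` if `i s_k ≺ i`. -/
def genOp (k : b.support) : Module.End A X.Tmod :=
  Finsupp.linearCombination A fun i =>
    if X.act i (simpleRefl b k) = i then qpow (-1) • X.vec i
    else if rootLE b i (X.act i (simpleRefl b k) : M) then X.vec (X.act i (simpleRefl b k))
    else X.vec (X.act i (simpleRefl b k)) + (qpow (-1) - qpow 1) • X.vec i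

/-- The `q`-Schur algebra: the algebra of all `A`-linear endomorphisms of the module that commute
with the right action of the Hecke algebra, that is, with the action of its generators. -/
def Sq : Subalgebra A (Module.End A X.Tmod) := Subalgebra.centralizer A (Set.range X.genOp)

/-- The anti-dominant shifted weights. Each linkage class (Weyl group orbit) of shifted weights
contains exactly one of them, and they serve as the labels of the linkage classes. -/
abbrev Anti : Type _ :=
  {i : X.Shifted // ∀ k : b.support, ∃ n : ℕ, P.toLinearMap (i : M) (P.coroot k) = -(n : K)}

/-- The basis vector `v_{i_γ^-}` of the anti-dominant weight of the linkage class `γ`. -/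
abbrev antiVec (γ : X.Anti) : X.Tmod := X.vec γ.1

/-- `J_γ`: the simple reflections that fix the anti-dominant weight `γ`. -/
def stab (γ : X.Anti) : Set b.support := {k | X.act γ.1 (simpleRefl b k) = γ.1}

/-- `W_γ`. -/
def stabGroup (γ : X.Anti) : Subgroup P.weylGroup := parabolic b (X.stab γ)

/-- `w_∘^γ`, the longest element of `W_γ`. -/
def stabLongest (γ : X.Anti) : P.weylGroup := longest b (X.stabGroup γ : Set P.weylGroup)

/-- `x_γ`. -/
def xsym (γ : X.Anti) : Hecke b := symmetrizer b (X.stab γ)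

open Classical in
/-- The component at `γ` of the identification of the module with `⨁_γ x_γ H`. It maps
`v_{i_γ^- w}` to `x_γ H_w` for all `w ∈ {}^{J_γ} W`, and `v_i` to zero for all `i` outside the
linkage class of `γ`. -/
def omega (γ : X.Anti) : X.Tmod →ₗ[A] Hecke b :=
  Finsupp.linearCombination A fun i =>
    if h : ∃ w ∈ minRight b (X.stab γ), X.act γ.1 w = i then X.xsym γ * heckeH b h.choose else 0

/-- The index set of triples `(γ, g, ν)`, with `g` a minimal length representative of a double
coset in `W_γ \ W / W_ν`. -/
abbrev Xi : Type _ :=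
  {ξ : X.Anti × P.weylGroup × X.Anti // ξ.2.1 ∈ minDouble b (X.stab ξ.1) (X.stab ξ.2.2)}

variable {X}

/-- The class `γ` of the triple `(γ, g, ν)`. -/
abbrev Xi.left (ξ : X.Xi) : X.Anti := ξ.1.1

/-- The Weyl group element `g` of the triple `(γ, g, ν)`. -/
abbrev Xi.elt (ξ : X.Xi) : P.weylGroup := ξ.1.2.1

/-- The class `ν` of the triple `(γ, g, ν)`. -/
abbrev Xi.right (ξ : X.Xi) : X.Anti := ξ.1.2.2

/-- The double coset `W_γ g W_ν`. -/
def Xi.coset (ξ : X.Xi) : Set P.weylGroup :=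
  DoubleCoset.doubleCoset ξ.elt (X.stabGroup ξ.left) (X.stabGroup ξ.right)

/-- `g_{γν}^+`, the longest element of `W_γ g W_ν`. -/
def Xi.plus (ξ : X.Xi) : P.weylGroup := longest b ξ.coset

/-- The triples `(γ, y, ν)` with `y < g` in the Bruhat order, for a given triple `(γ, g, ν)`. -/
abbrev Xi.Below (ξ : X.Xi) : Type _ :=
  {y : P.weylGroup // y ∈ minDouble b (X.stab ξ.left) (X.stab ξ.right) ∧ bruhatLT b y ξ.elt}

instance (ξ : X.Xi) : Fintype ξ.Below := Fintype.ofFinite _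

/-- The triple `(γ, y, ν)`. -/
abbrev Xi.lower (ξ : X.Xi) (y : ξ.Below) : X.Xi := ⟨(ξ.left, y.1, ξ.right), y.2.1⟩

open Classical in
/-- `f` is the element of the `q`-Schur algebra which, after the identification of the module with
`⨁_γ x_γ H`, maps `x_{ν'}` to `δ_{ν,ν'} h`, this element being in the summand `x_γ H`. -/
def SendsTo (f : X.Sq) (γ ν : X.Anti) (h : Hecke b) : Prop :=
  ∀ γ' ν' : X.Anti,
    X.omega γ' ((f : Module.End A X.Tmod) (X.antiVec ν')) = if γ' = γ ∧ ν' = ν then h else 0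

/-- `f = φ^g_{γν}`, that is, `f` maps `x_{ν'}` to `δ_{ν,ν'} q^{ℓ(w_∘^ν)} H_{W_γ g W_ν}`. -/
def IsPhi (ξ : X.Xi) (f : X.Sq) : Prop :=
  SendsTo f ξ.left ξ.right
    (qpow (length b (X.stabLongest ξ.right)) • heckeSum b ξ.coset)

/-- The element `φ^g_{γν}` of the `q`-Schur algebra. -/
def phi (ξ : X.Xi) : X.Sq := Classical.epsilon (IsPhi ξ)

/-- The standard element `[φ^g_{γν}] = q^{ℓ(g^+_{γν}) - ℓ(w_∘^ν)} φ^g_{γν}`. -/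
def std (ξ : X.Xi) : X.Sq :=
  qpow ((length b ξ.plus : ℤ) - length b (X.stabLongest ξ.right)) • phi ξ

/-- `f'` is the image of `f` under the bar involution of the `q`-Schur algebra: `f'` maps `x_ν`
to the image of `f(x_ν)` under the bar involution, for all `ν`. -/
def IsBarOf (f f' : X.Sq) : Prop :=
  ∀ γ ν : X.Anti,
    X.omega γ ((f' : Module.End A X.Tmod) (X.antiVec ν)) =
      bar b (X.omega γ ((f : Module.End A X.Tmod) (X.antiVec ν)))

/-- The bar involution of the `q`-Schur algebra. -/
def barS (f : X.Sq) : X.Sq := Classical.epsilon (IsBarOf f)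

/-- `f` lies in `[φ^g_{γν}] + ∑_{y < g} q ℤ[q] [φ^y_{γν}]`. -/
def IsUnitriangular (ξ : X.Xi) (f : X.Sq) : Prop :=
  ∃ c : ξ.Below → A, (∀ y, InQZq (c y)) ∧ f = std ξ + ∑ y, c y • std (ξ.lower y)

end WeightSet

end WeylGroup

end QSchur

end

/-!
The argument takes place in the Weyl group of a reduced crystallographic root system with a base,
and in its Hecke algebra `ℋ`.

The key is a description of the elements of the `q`-Schur algebra by matrices over `ℋ`. The weight
module `𝕋` is the direct sum of the right ideals `x_γ ℋ` (`WeightSet.omega_genOp`,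
`WeightSet.tmod_ext`, `WeightSet.exists_omega_eq`), and `x_ν ℋ` is induced from the character `H_k
↦ q⁻¹` of a parabolic subalgebra (`WeightSet.extend_genOp`). Hence an endomorphism `f` is
determined by its values at the generators `x_ν`, and their components in `x_γ ℋ` may be arbitrary
elements of `x_γ ℋ ∩ ℋ x_ν` (`WeightSet.sq_ext`, `WeightSet.entry_mem_biInv`,
`WeightSet.exists_sendsTo`). An element `h` of `ℋ` lies in this intersection, `biInv`, if and only
if `H_k h = q⁻¹ h` for `s_k ∈ W_γ` and `h H_k = q⁻¹ h` for `s_k ∈ W_ν`, that is, if the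
coefficients of `h` at `q^{-ℓ(y)} H_y` are constant on the double cosets of `W_γ` and `W_ν`
(`mem_biInv_iff`). So the sums over double cosets form a basis of the intersection, which gives the
standard basis, and the coefficient of `[φ^g_{γν}]` in `f` is the coefficient of `H_{g^+}` in the
value of `f` (`WeightSet.stdCoord`).

The bar involution of `ℋ` preserves `biInv`, because `H_k - q⁻¹` is bar invariant; this gives the
bar involution of the `q`-Schur algebra. All uniqueness statements rest on `eq_zero_of_bar_eq`: a
bar invariant element of `ℋ` whose coefficients lie in `q ℤ[q]` is zero, since the bar involution
is unitriangular and the coefficient of its longest term would be invariant under `q ↦ q⁻¹`. By the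
same argument `C_w H_k = q⁻¹ C_w` for each right descent of `w`, and likewise on the left, so that
`C_{g^+}` lies in `biInv` and is the value of an element `{φ^g_{γν}}` of the `q`-Schur algebra. Its
coefficients in the standard basis are those of `C_{g^+}` at the elements `H_{y^+}`; these vanish
unless `y ≤ g`, because the projection from `W` to the minimal double coset representatives is
monotone for the Bruhat order (`NoDescent.le_of_le`). Unitriangularity then shows that the
`{φ^g_{γν}}` form a basis.

The required facts on the Weyl group and its Hecke algebra are derived from the action of the Weyl
group on roots: the exchange condition, Matsumoto's theorem (`prod_map_eq_of_reduced`), the lifting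
property of the Bruhat order (`bruhatLE.lower_upper`), the basis `H_w` of `ℋ` (`heckeBasis`, by
means of the left regular representation), and the existence of the Kazhdan–Lusztig elements
(`exists_kl`). On the side of weights, each orbit contains exactly one anti-dominant weight, and
the stabilizer of this weight is generated by simple reflections (`WeightSet.exists_act_eq_anti`,
`WeightSet.eq_of_act_eq`).
-/

open scoped LaurentPolynomial

noncomputable section

namespace QSchur

open RootPairing CoxeterSystem

/-! ### Lengths and the exchange condition in the Weyl group -/

section Roots

variable {ι K M N : Type*} [Field K]
  [AddCommGroup M] [Module K M] [AddCommGroup N] [Module K N] {P : RootPairing ι K M N}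

/-- The pairing of weights and coroots is invariant under the Weyl group. -/
theorem pairing_smul (w : P.weylGroup) (m : M) (i : ι) :
    P.toLinearMap (w • m) (P.coroot (P.weylGroupToPerm w i)) = P.toLinearMap m (P.coroot i) := by
  have h := LinearMap.congr_fun (Hom.weight_coweight_transpose_apply P P
    (P.coroot (P.weylGroupToPerm w i)) (w : P.Aut).toHom) m
  rw [Hom.coroot_coweightMap_apply] at h
  have e : (Hom.indexEquiv (w : P.Aut).toHom).symm (P.weylGroupToPerm w i) = i :=
    Equiv.symm_apply_apply _ _
  rw [e] at h
  exact h

theorem ofIdx_smul_eq (i : ι) (m : M) :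
    weylGroup.ofIdx P i • m = m - P.toLinearMap m (P.coroot i) • P.root i := by
  rw [weylGroup.ofIdx_smul, Equiv.reflection_smul, P.reflection_apply]
  rfl

theorem weyl_ext {w w' : P.weylGroup} (h : ∀ m : M, w • m = w' • m) : w = w' := by
  apply Subtype.ext
  apply Equiv.weightHom_injective P
  ext m
  exact h m

theorem ofIdx_conj (w : P.weylGroup) (i : ι) :
    w * weylGroup.ofIdx P i * w⁻¹ = weylGroup.ofIdx P (P.weylGroupToPerm w i) := by
  apply weyl_ext
  intro m
  have h := pairing_smul w (w⁻¹ • m) i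
  rw [smul_inv_smul] at h
  rw [mul_smul, mul_smul, ofIdx_smul_eq, ofIdx_smul_eq, smul_sub, smul_inv_smul, h,
    ← weylGroup_apply_root]
  congr 1
  exact map_smul (Equiv.weightHom P (w : P.Aut)) _ _

theorem mul_ofIdx (w : P.weylGroup) (i : ι) :
    w * weylGroup.ofIdx P i = weylGroup.ofIdx P (P.weylGroupToPerm w i) * w := by
  rw [← ofIdx_conj, inv_mul_cancel_right]

theorem ofIdx_perm (i j : ι) :
    P.weylGroupToPerm (weylGroup.ofIdx P i) j = P.reflectionPerm i j := rfl

@[simp] theorem ofIdx_mul_self (i : ι) : weylGroup.ofIdx P i * weylGroup.ofIdx P i = 1 := by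
  apply Subtype.ext
  change Equiv.reflection P i * Equiv.reflection P i = 1
  rw [mul_eq_one_iff_inv_eq, Equiv.reflection_inv]

@[simp] theorem ofIdx_inv (i : ι) : (weylGroup.ofIdx P i)⁻¹ = weylGroup.ofIdx P i :=
  inv_eq_of_mul_eq_one_left (ofIdx_mul_self i)

@[simp] theorem mul_ofIdx_mul_ofIdx (w : P.weylGroup) (i : ι) :
    w * weylGroup.ofIdx P i * weylGroup.ofIdx P i = w := by
  rw [mul_assoc, ofIdx_mul_self, mul_one]

@[simp] theorem ofIdx_mul_ofIdx_mul (w : P.weylGroup) (i : ι) :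
    weylGroup.ofIdx P i * (weylGroup.ofIdx P i * w) = w := by
  rw [← mul_assoc, ofIdx_mul_self, one_mul]

theorem ofIdx_neg (i : ι) :
    weylGroup.ofIdx P (P.reflectionPerm i i) = weylGroup.ofIdx P i := by
  rw [← ofIdx_perm, ← ofIdx_conj]; simp

/-- The index of `-w α` is that of the negative of `w α`. -/
theorem perm_neg (w : P.weylGroup) (i : ι) :
    P.weylGroupToPerm w (P.reflectionPerm i i) =
      P.reflectionPerm (P.weylGroupToPerm w i) (P.weylGroupToPerm w i) := by
  rw [← ofIdx_perm, ← ofIdx_perm, ← ofIdx_conj]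
  simp

variable (b : P.Base) [CharZero K]

theorem isPos_neg_iff (i : ι) : b.IsPos (P.reflectionPerm i i) ↔ ¬ b.IsPos i :=
  Base.IsPos.neg_iff_not b i

end Roots

section Length

variable {ι K M N : Type*} [Field K]
  [AddCommGroup M] [Module K M] [AddCommGroup N] [Module K N] {P : RootPairing ι K M N}
  (b : P.Base)

theorem simpleRefl_eq (k : b.support) : simpleRefl b k = weylGroup.ofIdx P k := rfl

@[simp] theorem simpleRefl_inv (k : b.support) : (simpleRefl b k)⁻¹ = simpleRefl b k :=
  ofIdx_inv _

@[simp] theorem mul_simpleRefl_mul_simpleRefl (w : P.weylGroup) (k : b.support) :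
    w * simpleRefl b k * simpleRefl b k = w := mul_ofIdx_mul_ofIdx _ _

@[simp] theorem simpleRefl_mul_simpleRefl_mul (w : P.weylGroup) (k : b.support) :
    simpleRefl b k * (simpleRefl b k * w) = w := ofIdx_mul_ofIdx_mul _ _

/-- The element of the Weyl group that a word in the simple reflections represents. -/
def wordProd (l : List b.support) : P.weylGroup := (l.map (simpleRefl b)).prod

@[simp] theorem wordProd_nil : wordProd b [] = 1 := rfl

@[simp] theorem wordProd_cons (k : b.support) (l : List b.support) :
    wordProd b (k :: l) = simpleRefl b k * wordProd b l := by simp [wordProd]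

@[simp] theorem wordProd_append (l l' : List b.support) :
    wordProd b (l ++ l') = wordProd b l * wordProd b l' := by simp [wordProd]

theorem wordProd_reverse (l : List b.support) : wordProd b l.reverse = (wordProd b l)⁻¹ := by
  induction l with
  | nil => simp
  | cons k l ih => simp [ih]

theorem length_wordProd_le (l : List b.support) : length b (wordProd b l) ≤ l.length :=
  Nat.sInf_le ⟨l, rfl, rfl⟩

@[simp] theorem length_one : length b (1 : P.weylGroup) = 0 := by
  simpa using length_wordProd_le b []

theorem length_simpleRefl_le (k : b.support) : length b (simpleRefl b k) ≤ 1 := by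
  simpa using length_wordProd_le b [k]

variable [Finite ι] [CharZero K] [P.IsCrystallographic] [P.IsReduced]

theorem ofIdx_eq_wordProd (i : ι) : ∃ l, wordProd b l = weylGroup.ofIdx P i := by
  refine b.induction_reflect i (p := fun i => ∃ l, wordProd b l = weylGroup.ofIdx P i) ?_ ?_ ?_
  · rintro i ⟨l, hl⟩
    exact ⟨l, by rw [hl, ofIdx_neg]⟩
  · intro i hi
    exact ⟨[⟨i, hi⟩], by simp [simpleRefl_eq]⟩
  · rintro i j ⟨l, hl⟩ hj
    refine ⟨⟨j, hj⟩ :: (l ++ [⟨j, hj⟩]), ?_⟩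
    rw [← ofIdx_perm, ← ofIdx_conj]
    simp [hl, simpleRefl_eq, mul_assoc]

theorem wordProd_surjective : Function.Surjective (wordProd b) := by
  rintro ⟨w, hw⟩
  induction hw using weylGroup.induction with
  | mem i => exact ofIdx_eq_wordProd b i
  | one => exact ⟨[], rfl⟩
  | mul x y hx hy h1 h2 =>
    obtain ⟨l1, e1⟩ := h1
    obtain ⟨l2, e2⟩ := h2
    exact ⟨l1 ++ l2, by rw [wordProd_append, e1, e2]; rfl⟩

theorem exists_reduced (w : P.weylGroup) :
    ∃ l, wordProd b l = w ∧ l.length = length b w := by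
  have : {n | ∃ l : List b.support, (l.map (simpleRefl b)).prod = w ∧ l.length = n}.Nonempty := by
    obtain ⟨l, hl⟩ := wordProd_surjective b w
    exact ⟨_, l, hl, rfl⟩
  exact Nat.sInf_mem this

theorem reducedWord_spec (w : P.weylGroup) :
    wordProd b (reducedWord b w) = w ∧ (reducedWord b w).length = length b w :=
  Classical.epsilon_spec (exists_reduced b w)

theorem length_inv_le (w : P.weylGroup) : length b w⁻¹ ≤ length b w := by
  obtain ⟨l, rfl, h⟩ := exists_reduced b w
  rw [← wordProd_reverse, ← h]
  simpa using length_wordProd_le b l.reverse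

@[simp] theorem length_inv (w : P.weylGroup) : length b w⁻¹ = length b w :=
  le_antisymm (length_inv_le b w) (by simpa using length_inv_le b w⁻¹)

theorem length_mul_le (w w' : P.weylGroup) : length b (w * w') ≤ length b w + length b w' := by
  obtain ⟨l, rfl, h⟩ := exists_reduced b w
  obtain ⟨l', rfl, h'⟩ := exists_reduced b w'
  rw [← wordProd_append, ← h, ← h']
  simpa using length_wordProd_le b (l ++ l')

theorem eq_one_of_length_eq_zero {w : P.weylGroup} (h : length b w = 0) : w = 1 := by
  obtain ⟨l, rfl, h'⟩ := exists_reduced b w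
  rw [h, List.length_eq_zero_iff] at h'
  simp [h']

variable {b} in
/-- A simple reflection makes a positive root negative only if the root is the simple one. -/
theorem eq_of_isPos_of_not_isPos {k : b.support} {i : ι} (hi : b.IsPos i)
    (h : ¬ b.IsPos (P.weylGroupToPerm (simpleRefl b k) i)) : i = k := by
  by_contra hne
  exact h (hi.reflectionPerm k.2 hne)

/-- The strong exchange condition, in terms of roots: if the word `l` makes the positive root `α`
negative, then multiplication by the reflection in `α` amounts to deleting a letter of `l`. -/
theorem exists_sublist_of_not_isPos (l : List b.support) {i : ι} (hi : b.IsPos i)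
    (h : ¬ b.IsPos (P.weylGroupToPerm (wordProd b l) i)) :
    ∃ l', l'.Sublist l ∧ l'.length + 1 = l.length ∧
      wordProd b l' = wordProd b l * weylGroup.ofIdx P i := by
  induction l with
  | nil => simp [hi] at h
  | cons k l ih =>
    by_cases hj : b.IsPos (P.weylGroupToPerm (wordProd b l) i)
    · rw [wordProd_cons, map_mul] at h
      have e := eq_of_isPos_of_not_isPos hj h
      refine ⟨l, List.sublist_cons_self _ _, rfl, ?_⟩
      rw [wordProd_cons, mul_assoc, mul_ofIdx (wordProd b l), e, ← simpleRefl_eq]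
      simp
    · obtain ⟨l', h1, h2, h3⟩ := ih hj
      exact ⟨k :: l', h1.cons_cons k, by simp [h2], by rw [wordProd_cons, h3, wordProd_cons,
        mul_assoc]⟩

theorem length_mul_ofIdx_lt {w : P.weylGroup} {i : ι} (hi : b.IsPos i)
    (h : ¬ b.IsPos (P.weylGroupToPerm w i)) :
    length b (w * weylGroup.ofIdx P i) < length b w := by
  obtain ⟨l, rfl, hl⟩ := exists_reduced b w
  obtain ⟨l', -, h2, h3⟩ := exists_sublist_of_not_isPos b l hi h
  rw [← h3, ← hl, ← h2]
  exact Nat.lt_succ_of_le (length_wordProd_le b l')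

theorem lt_length_mul_ofIdx {w : P.weylGroup} {i : ι} (hi : b.IsPos i)
    (h : b.IsPos (P.weylGroupToPerm w i)) :
    length b w < length b (w * weylGroup.ofIdx P i) := by
  have := length_mul_ofIdx_lt b (w := w * weylGroup.ofIdx P i) hi (by
    rw [map_mul, Equiv.Perm.mul_apply, ofIdx_perm, perm_neg, isPos_neg_iff]
    exact not_not.2 h)
  simpa using this

/-- Right multiplication by the reflection in a positive root `α` raises the length of `w` if and
only if `w α` is positive. -/
theorem lt_length_mul_ofIdx_iff {w : P.weylGroup} {i : ι} (hi : b.IsPos i) :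
    length b w < length b (w * weylGroup.ofIdx P i) ↔ b.IsPos (P.weylGroupToPerm w i) := by
  refine ⟨fun h => ?_, lt_length_mul_ofIdx b hi⟩
  by_contra h'
  exact absurd (length_mul_ofIdx_lt b hi h') h.not_gt

theorem lt_length_mul_simpleRefl_iff {w : P.weylGroup} {k : b.support} :
    length b w < length b (w * simpleRefl b k) ↔ b.IsPos (P.weylGroupToPerm w k) :=
  lt_length_mul_ofIdx_iff b (Base.isPos_of_mem_support k.2)

theorem length_mul_simpleRefl (w : P.weylGroup) (k : b.support) :
    length b (w * simpleRefl b k) = length b w + 1 ∨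
      length b (w * simpleRefl b k) + 1 = length b w := by
  have h1 := length_mul_le b w (simpleRefl b k)
  have h2 := length_mul_le b (w * simpleRefl b k) (simpleRefl b k)
  have h3 := length_simpleRefl_le b k
  rw [mul_simpleRefl_mul_simpleRefl] at h2
  have hk := Base.isPos_of_mem_support (b := b) k.2
  by_cases h : b.IsPos (P.weylGroupToPerm w k)
  · have := lt_length_mul_ofIdx b hk h
    rw [← simpleRefl_eq] at this
    lia
  · have := length_mul_ofIdx_lt b hk h
    rw [← simpleRefl_eq] at this
    lia

theorem length_simpleRefl_mul_eq (w : P.weylGroup) (k : b.support) :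
    length b (simpleRefl b k * w) = length b (w⁻¹ * simpleRefl b k) := by
  rw [← length_inv]; simp

theorem length_simpleRefl_mul (w : P.weylGroup) (k : b.support) :
    length b (simpleRefl b k * w) = length b w + 1 ∨
      length b (simpleRefl b k * w) + 1 = length b w := by
  rw [length_simpleRefl_mul_eq, ← length_inv b w]
  exact length_mul_simpleRefl b w⁻¹ k

theorem lt_length_simpleRefl_mul_iff {w : P.weylGroup} {k : b.support} :
    length b w < length b (simpleRefl b k * w) ↔ b.IsPos (P.weylGroupToPerm w⁻¹ k) := by
  rw [length_simpleRefl_mul_eq, ← length_inv b w, lt_length_mul_simpleRefl_iff]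

/-- If `s w > w` and `s w t < w t`, then `s w = w t`. -/
theorem simpleRefl_mul_eq_mul_simpleRefl {w : P.weylGroup} {k j : b.support}
    (h1 : length b w < length b (simpleRefl b k * w))
    (h2 : length b (simpleRefl b k * (w * simpleRefl b j)) < length b (w * simpleRefl b j)) :
    simpleRefl b k * w = w * simpleRefl b j := by
  rw [lt_length_simpleRefl_mul_iff] at h1
  have h3 : ¬ b.IsPos (P.weylGroupToPerm (simpleRefl b j) (P.weylGroupToPerm w⁻¹ k)) := by
    have := h2.not_gt
    rw [lt_length_simpleRefl_mul_iff, mul_inv_rev, simpleRefl_inv, map_mul] at this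
    exact this
  have e := eq_of_isPos_of_not_isPos h1 h3
  rw [simpleRefl_eq b j, ← e, ← ofIdx_conj]
  simp [simpleRefl_eq, mul_assoc]

end Length

/-! ### The word property of the Weyl group -/

section Matsumoto

variable {ι K M N : Type*} [Field K]
  [AddCommGroup M] [Module K M] [AddCommGroup N] [Module K N] {P : RootPairing ι K M N}
  (b : P.Base)

theorem wordProd_alternating_inv_mul (i j : b.support) (n : ℕ) :
    (wordProd b (alternatingWord j i n))⁻¹ * wordProd b (alternatingWord i j n) =
      (simpleRefl b i * simpleRefl b j) ^ n := by
  induction n generalizing i j with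
  | zero => simp [alternatingWord]
  | succ n ih =>
    rw [alternatingWord_succ, alternatingWord_succ, List.concat_eq_append, List.concat_eq_append,
      wordProd_append, wordProd_append, mul_inv_rev]
    calc _ = simpleRefl b i * ((wordProd b (alternatingWord i j n))⁻¹ *
          wordProd b (alternatingWord j i n)) * simpleRefl b j := by simp [mul_assoc]
      _ = _ := by
        rw [ih, ← mul_pow_mul, mul_assoc, ← pow_succ]

theorem wordProd_alternating_orderOf (i j : b.support) :
    wordProd b (alternatingWord i j (orderOf (simpleRefl b i * simpleRefl b j))) =
      wordProd b (alternatingWord j i (orderOf (simpleRefl b i * simpleRefl b j))) := by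
  have := wordProd_alternating_inv_mul b i j (orderOf (simpleRefl b i * simpleRefl b j))
  rw [pow_orderOf_eq_one, inv_mul_eq_one] at this
  exact this.symm

theorem orderOf_simpleRefl_comm (i j : b.support) :
    orderOf (simpleRefl b i * simpleRefl b j) = orderOf (simpleRefl b j * simpleRefl b i) := by
  rw [← orderOf_inv]; simp

variable [Finite ι] [CharZero K] [P.IsCrystallographic] [P.IsReduced]

/-- Alternating words in `s` and `t` that are shorter than the order of `s t` keep the simple root
of the letter that would extend them positive; hence they are reduced. -/
theorem isPos_perm_alternating (i j : b.support) {n : ℕ}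
    (hn : n < orderOf (simpleRefl b i * simpleRefl b j)) :
    b.IsPos (P.weylGroupToPerm (wordProd b (alternatingWord i j n)) i) := by
  induction n with
  | zero => simpa [alternatingWord] using Base.isPos_of_mem_support i.2
  | succ n ih =>
    have h1 := ih (by lia)
    by_contra h
    rw [alternatingWord_succ'] at h
    set c := if Even n then j else i with hc
    rw [wordProd_cons, map_mul] at h
    have e := eq_of_isPos_of_not_isPos h1 h
    -- the letter in front then moves through the word, so the two alternating words agree
    have e2 : wordProd b (alternatingWord j i (n + 1)) =
        wordProd b (alternatingWord i j (n + 1)) := by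
      rw [alternatingWord_succ' i j, ← hc, wordProd_cons, alternatingWord_succ,
        List.concat_eq_append, wordProd_append, simpleRefl_eq b c, ← e, ← ofIdx_conj]
      simp [simpleRefl_eq]
    have e3 := wordProd_alternating_inv_mul b i j (n + 1)
    rw [e2, inv_mul_cancel] at e3
    have := orderOf_le_of_pow_eq_one (Nat.succ_pos n) e3.symm
    lia

/-- An element with two right descents `s`, `t` has a reduced word that ends with an alternating
word in `s` and `t` of any length up to the order of `s t`. -/
theorem exists_word_append_alternating (i j : b.support) (w : P.weylGroup)
    (hi : length b (w * simpleRefl b i) < length b w)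
    (hj : length b (w * simpleRefl b j) < length b w) (n : ℕ)
    (hn : n ≤ orderOf (simpleRefl b i * simpleRefl b j)) :
    ∃ u : List b.support, u.length + n = length b w ∧
      (wordProd b (u ++ alternatingWord i j n) = w ∨
        wordProd b (u ++ alternatingWord j i n) = w) := by
  induction n with
  | zero =>
    obtain ⟨l, h1, h2⟩ := exists_reduced b w
    exact ⟨l, h2, by simpa [alternatingWord] using h1⟩
  | succ n ih =>
    have step : ∀ i j : b.support, length b (w * simpleRefl b i) < length b w →
        n < orderOf (simpleRefl b i * simpleRefl b j) → ∀ u : List b.support,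
        u.length + n = length b w → wordProd b (u ++ alternatingWord i j n) = w →
        ∃ u : List b.support, u.length + (n + 1) = length b w ∧
          wordProd b (u ++ alternatingWord j i (n + 1)) = w := by
      intro i j hi hn u hu hw
      have h1 := isPos_perm_alternating b i j hn
      have h2 : ¬ b.IsPos (P.weylGroupToPerm w i) := by
        rw [← lt_length_mul_simpleRefl_iff]; exact hi.not_gt
      rw [← hw, wordProd_append, map_mul] at h2
      obtain ⟨u', -, h3, h4⟩ := exists_sublist_of_not_isPos b u h1 h2
      refine ⟨u', by lia, ?_⟩
      rw [alternatingWord_succ, List.concat_eq_append, wordProd_append, wordProd_append, h4,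
        ← ofIdx_conj, ← hw, wordProd_append]
      simp only [simpleRefl_eq, mul_assoc, wordProd_cons, wordProd_nil, mul_one,
        inv_mul_cancel_left, ofIdx_mul_self]
    obtain ⟨u, hu, hw | hw⟩ := ih (by lia)
    · obtain ⟨u', h1, h2⟩ := step i j hi (by lia) u hu hw
      exact ⟨u', h1, Or.inr h2⟩
    · obtain ⟨u', h1, h2⟩ := step j i hj (by rw [orderOf_simpleRefl_comm]; lia) u hu hw
      exact ⟨u', h1, Or.inl h2⟩

variable [P.IsRootSystem]

/-- **Matsumoto's theorem**: a map from the simple reflections to a monoid that satisfies the braid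
relations takes the same value on any two reduced words of an element. -/
theorem prod_map_eq_of_reduced {G : Type*} [Monoid G] (f : b.support → G)
    (hf : ∀ i j : b.support, i ≠ j →
      ((alternatingWord i j (orderOf (simpleRefl b i * simpleRefl b j))).map f).prod =
      ((alternatingWord j i (orderOf (simpleRefl b i * simpleRefl b j))).map f).prod)
    (l l' : List b.support) (h : wordProd b l = wordProd b l')
    (hl : length b (wordProd b l) = l.length) (hl' : length b (wordProd b l') = l'.length) :
    (l.map f).prod = (l'.map f).prod := by
  generalize hn : l.length = n
  induction n generalizing l l' with
  | zero =>
    have h1 : l'.length = 0 := by rw [← hl', ← h, hl, hn]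
    rw [List.length_eq_zero_iff] at hn h1
    rw [hn, h1]
  | succ n ih =>
    -- reduced words with the same last letter
    have same : ∀ (l l' : List b.support) (k : b.support),
        wordProd b (l ++ [k]) = wordProd b (l' ++ [k]) →
        length b (wordProd b (l ++ [k])) = n + 1 → l.length = n → l'.length = n →
        ((l ++ [k]).map f).prod = ((l' ++ [k]).map f).prod := by
      intro l l' k h1 h2 h3 h4
      have h5 : wordProd b l = wordProd b l' := by simpa using h1
      have h6 : length b (wordProd b l) = n := by
        have := length_wordProd_le b l
        have := length_mul_le b (wordProd b l) (simpleRefl b k)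
        have := length_simpleRefl_le b k
        rw [wordProd_append, wordProd_cons, wordProd_nil, mul_one] at h2
        lia
      have := ih l l' h5 (by lia) (by rw [← h5]; lia) h3
      simp [this]
    have hn' : l'.length = n + 1 := by rw [← hl', ← h, hl, hn]
    obtain ⟨l1, i, rfl⟩ : ∃ l1 i, l = l1 ++ [i] := by
      rcases List.eq_nil_or_concat' l with rfl | h
      · simp at hn
      · exact h
    obtain ⟨l2, j, rfl⟩ : ∃ l2 j, l' = l2 ++ [j] := by
      rcases List.eq_nil_or_concat' l' with rfl | h
      · simp at hn'
      · exact h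
    by_cases hij : i = j
    · subst hij
      exact same l1 l2 i h (by lia) (by simpa using hn) (by simpa using hn')
    · have descent : ∀ (l : List b.support) (k : b.support),
          length b (wordProd b (l ++ [k])) = (l ++ [k]).length →
          length b (wordProd b (l ++ [k]) * simpleRefl b k) < length b (wordProd b (l ++ [k])) := by
        intro l k hk
        rw [hk, wordProd_append, wordProd_cons, wordProd_nil, mul_one,
          mul_simpleRefl_mul_simpleRefl]
        have := length_wordProd_le b l
        simp; lia
      have di := descent l1 i hl
      have dj := descent l2 j hl'
      rw [← h] at dj
      obtain ⟨u, hu, hw⟩ := exists_word_append_alternating b i j _ di dj _ le_rfl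
      set m := orderOf (simpleRefl b i * simpleRefl b j) with hm
      have hw1 : wordProd b (u ++ alternatingWord i j m) = wordProd b (l1 ++ [i]) := by
        rcases hw with hw | hw
        · exact hw
        · rw [← hw, wordProd_append, wordProd_append, hm, wordProd_alternating_orderOf]
      have hw2 : wordProd b (u ++ alternatingWord j i m) = wordProd b (l1 ++ [i]) := by
        rw [← hw1, wordProd_append, wordProd_append, hm, wordProd_alternating_orderOf]
      have e : ((u ++ alternatingWord i j m).map f).prod =
          ((u ++ alternatingWord j i m).map f).prod := by
        rw [List.map_append, List.map_append, List.prod_append, List.prod_append, hf i j hij]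
      have hm0 : m ≠ 0 := (orderOf_pos _).ne'
      obtain ⟨p, hp⟩ := Nat.exists_eq_succ_of_ne_zero hm0
      rw [hp, alternatingWord_succ, alternatingWord_succ, List.concat_eq_append,
        List.concat_eq_append, ← List.append_assoc, ← List.append_assoc] at e
      rw [hp, alternatingWord_succ, List.concat_eq_append, ← List.append_assoc] at hw1 hw2
      rw [same l1 (u ++ alternatingWord i j p) i hw2.symm (by lia) (by simpa using hn)
          (by simp; lia), ← e]
      exact same _ l2 j (hw1.trans h) (by rw [hw1]; lia) (by simp; lia) (by simpa using hn')

end Matsumoto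

/-! ### The Bruhat order -/

section Bruhat

variable {ι K M N : Type*} [Field K]
  [AddCommGroup M] [Module K M] [AddCommGroup N] [Module K N] {P : RootPairing ι K M N}
  (b : P.Base)

/-- The Bruhat order: the reflexive closure of its strict version. -/
def bruhatLE (u w : P.weylGroup) : Prop := u = w ∨ bruhatLT b u w

/-- A single step of the Bruhat order: right multiplication by a reflection that raises the
length. -/
def bruhatStep (u w : P.weylGroup) : Prop :=
  ∃ i : ι, w = u * RootPairing.weylGroup.ofIdx P i ∧ length b u < length b w

variable {b}

theorem bruhatStep.lt {u w : P.weylGroup} (h : bruhatStep b u w) : bruhatLT b u w :=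
  Relation.TransGen.single h

theorem bruhatLE.refl (u : P.weylGroup) : bruhatLE b u u := Or.inl rfl

theorem bruhatLT.le {u w : P.weylGroup} (h : bruhatLT b u w) : bruhatLE b u w := Or.inr h

theorem bruhatLE_iff {u w : P.weylGroup} :
    bruhatLE b u w ↔ Relation.ReflTransGen (bruhatStep b) u w := by
  rw [Relation.reflTransGen_iff_eq_or_transGen, eq_comm]; rfl

theorem bruhatLE.trans {u v w : P.weylGroup} (h : bruhatLE b u v) (h' : bruhatLE b v w) :
    bruhatLE b u w := by
  rw [bruhatLE_iff] at *
  exact h.trans h'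

theorem bruhatLT.length_lt {u w : P.weylGroup} (h : bruhatLT b u w) :
    length b u < length b w := by
  induction h with
  | single h => exact h.choose_spec.2
  | tail _ h ih => exact ih.trans h.choose_spec.2

theorem bruhatLT.trans {u v w : P.weylGroup} (h : bruhatLT b u v) (h' : bruhatLT b v w) :
    bruhatLT b u w := Relation.TransGen.trans h h'

theorem bruhatLT.ne {u w : P.weylGroup} (h : bruhatLT b u w) : u ≠ w := by
  rintro rfl
  exact lt_irrefl _ h.length_lt

theorem bruhatLE.length_le {u w : P.weylGroup} (h : bruhatLE b u w) :
    length b u ≤ length b w := by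
  rcases h with rfl | h
  · exact le_rfl
  · exact h.length_lt.le

theorem bruhatLE.eq_of_length_le {u w : P.weylGroup} (h : bruhatLE b u w)
    (h' : length b w ≤ length b u) : u = w := by
  rcases h with rfl | h
  · rfl
  · exact absurd h.length_lt h'.not_gt

theorem bruhatLE.trans_lt {u v w : P.weylGroup} (h : bruhatLE b u v) (h' : bruhatLT b v w) :
    bruhatLT b u w := by
  rcases h with rfl | h
  · exact h'
  · exact h.trans h'

theorem bruhatStep_mul_simpleRefl {w : P.weylGroup} {k : b.support}
    (h : length b w < length b (w * simpleRefl b k)) : bruhatStep b w (w * simpleRefl b k) :=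
  ⟨k, rfl, h⟩

theorem mul_simpleRefl_step {w : P.weylGroup} {k : b.support}
    (h : length b (w * simpleRefl b k) < length b w) : bruhatStep b (w * simpleRefl b k) w :=
  ⟨k, (mul_simpleRefl_mul_simpleRefl b w k).symm, h⟩

variable (b) in
open Classical in
/-- The shorter one of `x` and `x s`. -/
def lower (k : b.support) (x : P.weylGroup) : P.weylGroup :=
  if length b (x * simpleRefl b k) < length b x then x * simpleRefl b k else x

variable (b) in
open Classical in
/-- The longer one of `x` and `x s`. -/
def upper (k : b.support) (x : P.weylGroup) : P.weylGroup :=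
  if length b (x * simpleRefl b k) < length b x then x else x * simpleRefl b k

theorem lower_eq_or (k : b.support) (x : P.weylGroup) :
    lower b k x = x ∨ lower b k x = x * simpleRefl b k := by
  unfold lower; split_ifs <;> simp

theorem upper_eq_or (k : b.support) (x : P.weylGroup) :
    upper b k x = x ∨ upper b k x = x * simpleRefl b k := by
  unfold upper; split_ifs <;> simp

theorem lower_le (k : b.support) (x : P.weylGroup) : bruhatLE b (lower b k x) x := by
  unfold lower
  split_ifs with h
  · exact (mul_simpleRefl_step h).lt.le
  · exact .refl _

theorem mul_le_upper (k : b.support) (x : P.weylGroup) :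
    bruhatLE b (x * simpleRefl b k) (upper b k x) := by
  unfold upper
  split_ifs with h
  · exact (mul_simpleRefl_step h).lt.le
  · exact .refl _

variable [Finite ι] [CharZero K] [P.IsCrystallographic] [P.IsReduced]

theorem bruhatStep.inv {u w : P.weylGroup} (h : bruhatStep b u w) : bruhatStep b u⁻¹ w⁻¹ := by
  obtain ⟨i, rfl, h⟩ := h
  refine ⟨P.weylGroupToPerm u i, ?_, by rwa [length_inv, length_inv]⟩
  rw [← ofIdx_conj]
  simp [mul_assoc]

theorem bruhatLE.inv {u w : P.weylGroup} (h : bruhatLE b u w) : bruhatLE b u⁻¹ w⁻¹ := by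
  rw [bruhatLE_iff] at *
  induction h with
  | refl => exact Relation.ReflTransGen.refl
  | tail _ h ih => exact ih.tail h.inv

theorem bruhatLE_inv_iff {u w : P.weylGroup} : bruhatLE b u⁻¹ w⁻¹ ↔ bruhatLE b u w :=
  ⟨fun h => by simpa using h.inv, bruhatLE.inv⟩

/-- Right multiplication by a simple reflection preserves a step of the Bruhat order, unless the
step is given by this very simple reflection. -/
theorem bruhatStep.mul_simpleRefl {x y : P.weylGroup} (h : bruhatStep b x y) (k : b.support) :
    y = x * simpleRefl b k ∨ bruhatStep b (x * simpleRefl b k) (y * simpleRefl b k) := by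
  obtain ⟨i, hi, rfl, h⟩ : ∃ i, b.IsPos i ∧ y = x * weylGroup.ofIdx P i ∧
      length b x < length b y := by
    obtain ⟨i, rfl, h⟩ := h
    by_cases hi : b.IsPos i
    · exact ⟨i, hi, rfl, h⟩
    · exact ⟨P.reflectionPerm i i, (isPos_neg_iff b i).2 hi, by rw [ofIdx_neg], h⟩
  by_cases hik : i = k
  · left; rw [hik]; rfl
  · right
    have hj : b.IsPos (P.weylGroupToPerm (simpleRefl b k) i) := hi.reflectionPerm k.2 hik
    have e : simpleRefl b k * weylGroup.ofIdx P (P.weylGroupToPerm (simpleRefl b k) i) =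
        weylGroup.ofIdx P i * simpleRefl b k := by
      rw [← ofIdx_conj]; simp [mul_assoc]
    have e2 : x * weylGroup.ofIdx P i * simpleRefl b k = x * simpleRefl b k *
        weylGroup.ofIdx P (P.weylGroupToPerm (simpleRefl b k) i) := by
      rw [mul_assoc, mul_assoc, e]
    refine ⟨_, e2, ?_⟩
    rw [e2, lt_length_mul_ofIdx_iff b hj, ← Equiv.Perm.mul_apply, ← map_mul,
      mul_simpleRefl_mul_simpleRefl]
    exact (lt_length_mul_ofIdx_iff b hi).1 h

theorem bruhatLT.mul_simpleRefl {x y : P.weylGroup} (h : bruhatLT b x y) (k : b.support) :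
    bruhatLT b (x * simpleRefl b k) (y * simpleRefl b k) ∨
      bruhatLE b (x * simpleRefl b k) y := by
  induction h with
  | single h =>
    rcases bruhatStep.mul_simpleRefl h k with rfl | h
    · exact Or.inr (.refl _)
    · exact Or.inl h.lt
  | @tail y z _ h' ih =>
    rcases ih with ih | ih
    · rcases bruhatStep.mul_simpleRefl h' k with rfl | h
      · exact Or.inr ih.le
      · exact Or.inl (ih.trans h.lt)
    · exact Or.inr (ih.trans (bruhatStep.lt h').le)

theorem lower_le_mul (k : b.support) (x : P.weylGroup) :
    bruhatLE b (lower b k x) (x * simpleRefl b k) := by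
  unfold lower
  split_ifs with h
  · exact .refl _
  · have := length_mul_simpleRefl b x k
    exact (bruhatStep_mul_simpleRefl (by lia)).lt.le

theorem le_upper (k : b.support) (x : P.weylGroup) : bruhatLE b x (upper b k x) := by
  unfold upper
  split_ifs with h
  · exact .refl _
  · have := length_mul_simpleRefl b x k
    exact (bruhatStep_mul_simpleRefl (by lia)).lt.le

theorem lower_mul (k : b.support) (x : P.weylGroup) :
    lower b k (x * simpleRefl b k) = lower b k x := by
  have := length_mul_simpleRefl b x k
  unfold lower
  split_ifs with h1 h2 <;> simp at * <;> lia

theorem upper_mul (k : b.support) (x : P.weylGroup) :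
    upper b k (x * simpleRefl b k) = upper b k x := by
  have := length_mul_simpleRefl b x k
  unfold upper
  split_ifs with h1 h2 <;> simp at * <;> lia

/-- The lifting property of the Bruhat order, in the symmetric form that both projections to the
cosets of `{1, s}` are monotone. -/
theorem bruhatLE.lower_upper {x y : P.weylGroup} (h : bruhatLE b x y) (k : b.support) :
    bruhatLE b (lower b k x) (lower b k y) ∧ bruhatLE b (upper b k x) (upper b k y) := by
  rw [bruhatLE_iff] at h
  induction h with
  | refl => exact ⟨.refl _, .refl _⟩
  | @tail y z _ h ih =>
    rcases h.mul_simpleRefl k with rfl | h'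
    · rwa [lower_mul, upper_mul]
    · constructor
      · refine ih.1.trans ?_
        rcases lower_eq_or k z with e | e <;> rw [e]
        · exact (lower_le k y).trans h.lt.le
        · exact (lower_le_mul k y).trans h'.lt.le
      · refine ih.2.trans ?_
        rcases upper_eq_or k y with e | e <;> rw [e]
        · exact h.lt.le.trans (le_upper k z)
        · exact h'.lt.le.trans (mul_le_upper k z)

theorem bruhatLE.le_mul_simpleRefl {g z : P.weylGroup} {k : b.support} (h : bruhatLE b g z)
    (hg : length b g < length b (g * simpleRefl b k)) : bruhatLE b g (z * simpleRefl b k) := by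
  have := (h.lower_upper k).1
  rw [lower, if_neg hg.not_gt] at this
  exact this.trans (lower_le_mul k z)

theorem bruhatLE.mul_simpleRefl_le {g z : P.weylGroup} {k : b.support} (h : bruhatLE b z g)
    (hg : length b (g * simpleRefl b k) < length b g) : bruhatLE b (z * simpleRefl b k) g := by
  have := (h.lower_upper k).2
  rw [upper, upper, if_pos hg] at this
  exact (mul_le_upper k z).trans this

theorem bruhatLE.le_or_mul_le {z w : P.weylGroup} {k : b.support} (h : bruhatLE b z w)
    (hw : length b (w * simpleRefl b k) < length b w) :
    bruhatLE b z (w * simpleRefl b k) ∨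
      bruhatLE b (z * simpleRefl b k) (w * simpleRefl b k) := by
  have := (h.lower_upper k).1
  rw [lower.eq_1 b k w, if_pos hw] at this
  rcases lower_eq_or k z with e | e <;> rw [e] at this
  · exact Or.inl this
  · exact Or.inr this

theorem bruhatLE.le_simpleRefl_mul {g z : P.weylGroup} {k : b.support} (h : bruhatLE b g z)
    (hg : length b g < length b (simpleRefl b k * g)) : bruhatLE b g (simpleRefl b k * z) := by
  rw [← bruhatLE_inv_iff] at h ⊢
  rw [← length_inv, ← length_inv b (_ * _)] at hg
  simpa using h.le_mul_simpleRefl (k := k) (by simpa using hg)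

theorem bruhatLE.simpleRefl_mul_le {g z : P.weylGroup} {k : b.support} (h : bruhatLE b z g)
    (hg : length b (simpleRefl b k * g) < length b g) : bruhatLE b (simpleRefl b k * z) g := by
  rw [← bruhatLE_inv_iff] at h ⊢
  rw [← length_inv, ← length_inv b g] at hg
  simpa using h.mul_simpleRefl_le (k := k) (by simpa using hg)

theorem bruhatLE.le_or_simpleRefl_mul_le {z w : P.weylGroup} {k : b.support} (h : bruhatLE b z w)
    (hw : length b (simpleRefl b k * w) < length b w) :
    bruhatLE b z (simpleRefl b k * w) ∨
      bruhatLE b (simpleRefl b k * z) (simpleRefl b k * w) := by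
  rw [← bruhatLE_inv_iff] at h
  rw [← length_inv, ← length_inv b w] at hw
  have := h.le_or_mul_le (k := k) (by simpa using hw)
  rw [← bruhatLE_inv_iff, ← bruhatLE_inv_iff (u := _ * _)]
  simpa using this

end Bruhat

/-! ### Parabolic subgroups and their double cosets -/

section Parabolic

variable {ι K M N : Type*} [Field K]
  [AddCommGroup M] [Module K M] [AddCommGroup N] [Module K N] {P : RootPairing ι K M N}
  {b : P.Base} {I J : Set b.support}

theorem simpleRefl_mem_parabolic {k : b.support} (hk : k ∈ J) :
    simpleRefl b k ∈ parabolic b J :=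
  Subgroup.subset_closure ⟨k, hk, rfl⟩

theorem exists_word_of_mem_parabolic {u : P.weylGroup} (hu : u ∈ parabolic b J) :
    ∃ l : List b.support, (∀ k ∈ l, k ∈ J) ∧ wordProd b l = u := by
  induction hu using Subgroup.closure_induction with
  | mem x hx =>
    obtain ⟨k, hk, rfl⟩ := hx
    exact ⟨[k], by simpa using hk, by simp⟩
  | one => exact ⟨[], by simp, rfl⟩
  | mul x y _ _ hx hy =>
    obtain ⟨l, h1, rfl⟩ := hx
    obtain ⟨l', h2, rfl⟩ := hy
    refine ⟨l ++ l', fun k hk => ?_, by simp⟩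
    rcases List.mem_append.1 hk with h | h
    exacts [h1 k h, h2 k h]
  | inv x _ hx =>
    obtain ⟨l, h1, rfl⟩ := hx
    exact ⟨l.reverse, by simpa using h1, wordProd_reverse b l⟩

/-- The double coset `W_I z W_J`. -/
def dcoset (I J : Set b.support) (z : P.weylGroup) : Set P.weylGroup :=
  DoubleCoset.doubleCoset z (parabolic b I) (parabolic b J)

theorem mem_dcoset_self (z : P.weylGroup) : z ∈ dcoset I J z :=
  DoubleCoset.mem_doubleCoset_self _ _ _

theorem dcoset_eq {z z' : P.weylGroup} (h : z' ∈ dcoset I J z) : dcoset I J z' = dcoset I J z :=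
  DoubleCoset.doubleCoset_eq_of_mem h

theorem mem_dcoset_comm {z z' : P.weylGroup} (h : z' ∈ dcoset I J z) : z ∈ dcoset I J z' := by
  rw [dcoset_eq h]; exact mem_dcoset_self z

theorem mul_simpleRefl_mem_dcoset {z z' : P.weylGroup} {k : b.support} (hk : k ∈ J)
    (h : z' ∈ dcoset I J z) : z' * simpleRefl b k ∈ dcoset I J z := by
  rw [dcoset, DoubleCoset.mem_doubleCoset] at *
  obtain ⟨x, hx, y, hy, rfl⟩ := h
  exact ⟨x, hx, y * simpleRefl b k, mul_mem hy (simpleRefl_mem_parabolic hk), by simp [mul_assoc]⟩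

theorem simpleRefl_mul_mem_dcoset {z z' : P.weylGroup} {k : b.support} (hk : k ∈ I)
    (h : z' ∈ dcoset I J z) : simpleRefl b k * z' ∈ dcoset I J z := by
  rw [dcoset, DoubleCoset.mem_doubleCoset] at *
  obtain ⟨x, hx, y, hy, rfl⟩ := h
  exact ⟨simpleRefl b k * x, mul_mem (simpleRefl_mem_parabolic hk) hx, y, hy, by simp [mul_assoc]⟩

theorem dcoset_induction {z : P.weylGroup} {Q : P.weylGroup → Prop} (h0 : Q z)
    (hI : ∀ k ∈ I, ∀ w, Q w → Q (simpleRefl b k * w))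
    (hJ : ∀ k ∈ J, ∀ w, Q w → Q (w * simpleRefl b k)) {w : P.weylGroup} (hw : w ∈ dcoset I J z) :
    Q w := by
  rw [dcoset, DoubleCoset.mem_doubleCoset] at hw
  obtain ⟨x, hx, y, hy, rfl⟩ := hw
  obtain ⟨l, hl, rfl⟩ := exists_word_of_mem_parabolic hx
  obtain ⟨l', hl', rfl⟩ := exists_word_of_mem_parabolic hy
  have h1 : Q (wordProd b l * z) := by
    clear hx hy hl'
    induction l with
    | nil => simpa using h0
    | cons k l ih =>
      rw [wordProd_cons, mul_assoc]
      exact hI k (hl k (by simp)) _ (ih fun k hk => hl k (by simp [hk]))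
  clear hx hy hl
  induction l' using List.reverseRecOn with
  | nil => simpa using h1
  | append_singleton l' k ih =>
    rw [wordProd_append, wordProd_cons, wordProd_nil, mul_one, ← mul_assoc]
    exact hJ k (hl' k (by simp)) _ (ih fun k hk => hl' k (by simp [hk]))

/-- `W_J` is a double coset of itself, so that the results on double cosets apply to it. -/
theorem coe_parabolic_eq_dcoset : (parabolic b J : Set P.weylGroup) = dcoset J J 1 := by
  ext x
  rw [dcoset, DoubleCoset.mem_doubleCoset]
  constructor
  · intro hx
    exact ⟨x, hx, 1, one_mem _, by simp⟩
  · rintro ⟨x, hx, y, hy, rfl⟩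
    simpa using mul_mem hx hy

theorem one_mem_minRight (J : Set b.support) : (1 : P.weylGroup) ∈ minRight b J := by
  intro u _
  simp

theorem mem_dcoset_empty {w z : P.weylGroup} :
    z ∈ dcoset J ∅ w ↔ ∃ u ∈ parabolic b J, z = u * w := by
  rw [dcoset, DoubleCoset.mem_doubleCoset]
  constructor
  · rintro ⟨x, hx, y, hy, rfl⟩
    have : y = 1 := by simpa [parabolic] using hy
    exact ⟨x, hx, by simp [this]⟩
  · rintro ⟨x, hx, rfl⟩
    exact ⟨x, hx, 1, one_mem _, by simp⟩

theorem exists_longest [Finite ι] [P.IsRootSystem] (Y : Set P.weylGroup)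
    (hY : Y.Nonempty) :
    ∃ w, w ∈ Y ∧ ∀ y ∈ Y, length b y ≤ length b w :=
  Set.exists_max_image Y (length b) Y.toFinite hY

theorem longest_mem [Finite ι] [P.IsRootSystem] {Y : Set P.weylGroup} (hY : Y.Nonempty) :
    longest b Y ∈ Y :=
  (Classical.epsilon_spec (exists_longest Y hY)).1

theorem length_le_longest [Finite ι] [P.IsRootSystem] {Y : Set P.weylGroup}
    {y : P.weylGroup} (hy : y ∈ Y) :
    length b y ≤ length b (longest b Y) :=
  (Classical.epsilon_spec (exists_longest Y ⟨y, hy⟩)).2 y hy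

theorem longest_dcoset_mem [Finite ι] [P.IsRootSystem] (z : P.weylGroup) :
    longest b (dcoset I J z) ∈ dcoset I J z :=
  longest_mem ⟨z, mem_dcoset_self z⟩

/-- `g` has no left descent in `I` and no right descent in `J`. -/
def NoDescent (I J : Set b.support) (g : P.weylGroup) : Prop :=
  (∀ k ∈ I, length b g < length b (simpleRefl b k * g)) ∧
    ∀ k ∈ J, length b g < length b (g * simpleRefl b k)

/-- All elements of `I` are left descents of `g`, and all elements of `J` are right descents. -/
def AllDescent (I J : Set b.support) (g : P.weylGroup) : Prop :=
  (∀ k ∈ I, length b (simpleRefl b k * g) < length b g) ∧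
    ∀ k ∈ J, length b (g * simpleRefl b k) < length b g

variable [Finite ι] [CharZero K] [P.IsCrystallographic] [P.IsReduced]

theorem NoDescent.le {g z : P.weylGroup} (hg : NoDescent I J g) (hz : z ∈ dcoset I J g) :
    bruhatLE b g z :=
  dcoset_induction (.refl g) (fun k hk _ h => h.le_simpleRefl_mul (hg.1 k hk))
    (fun k hk _ h => h.le_mul_simpleRefl (hg.2 k hk)) hz

theorem AllDescent.le {g z : P.weylGroup} (hg : AllDescent I J g) (hz : z ∈ dcoset I J g) :
    bruhatLE b z g :=
  dcoset_induction (Q := fun z => bruhatLE b z g) (.refl g)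
    (fun k hk _ h => h.simpleRefl_mul_le (hg.1 k hk))
    (fun k hk _ h => h.mul_simpleRefl_le (hg.2 k hk)) hz

theorem NoDescent.unique {g g' : P.weylGroup} (hg : NoDescent I J g) (hg' : NoDescent I J g')
    (h : g' ∈ dcoset I J g) : g = g' :=
  (hg.le h).eq_of_length_le (hg'.le (mem_dcoset_comm h)).length_le

/-- An element of minimal length in a double coset has no descents. -/
theorem noDescent_of_minimal {g : P.weylGroup}
    (h : ∀ z ∈ dcoset I J g, length b g ≤ length b z) : NoDescent I J g := by
  refine ⟨fun k hk => ?_, fun k hk => ?_⟩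
  · have := h _ (simpleRefl_mul_mem_dcoset hk (mem_dcoset_self g))
    have := length_simpleRefl_mul b g k
    lia
  · have := h _ (mul_simpleRefl_mem_dcoset hk (mem_dcoset_self g))
    have := length_mul_simpleRefl b g k
    lia

theorem allDescent_of_maximal {g : P.weylGroup}
    (h : ∀ z ∈ dcoset I J g, length b z ≤ length b g) : AllDescent I J g := by
  refine ⟨fun k hk => ?_, fun k hk => ?_⟩
  · have := h _ (simpleRefl_mul_mem_dcoset hk (mem_dcoset_self g))
    have := length_simpleRefl_mul b g k
    lia
  · have := h _ (mul_simpleRefl_mem_dcoset hk (mem_dcoset_self g))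
    have := length_mul_simpleRefl b g k
    lia

theorem exists_noDescent (I J : Set b.support) (z : P.weylGroup) :
    ∃ g ∈ dcoset I J z, NoDescent I J g := by
  classical
  have hne : ∃ n, ∃ g ∈ dcoset I J z, length b g = n := ⟨_, z, mem_dcoset_self z, rfl⟩
  obtain ⟨g, hg, h⟩ := Nat.find_spec hne
  refine ⟨g, hg, noDescent_of_minimal fun y hy => ?_⟩
  rw [dcoset_eq hg] at hy
  rw [h]
  exact Nat.find_min' hne ⟨y, hy, rfl⟩

/-- The projection to the shortest elements of double cosets is monotone for the Bruhat order. -/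
theorem NoDescent.le_of_le {y g z w : P.weylGroup} (hy : NoDescent I J y) (hg : NoDescent I J g)
    (hz : z ∈ dcoset I J y) (hw : w ∈ dcoset I J g) (h : bruhatLE b z w) : bruhatLE b y g := by
  generalize hn : length b w = n
  induction n using Nat.strong_induction_on generalizing z w with
  | _ n ih =>
    by_cases hmin : NoDescent I J w
    · rw [hg.unique hmin hw]
      exact (hy.le hz).trans h
    · rw [NoDescent, not_and_or] at hmin
      push Not at hmin
      rcases hmin with ⟨k, hk, h1⟩ | ⟨k, hk, h1⟩
      · have h2 := length_simpleRefl_mul b w k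
        have h3 : length b (simpleRefl b k * w) < length b w := by lia
        rcases h.le_or_simpleRefl_mul_le h3 with h4 | h4
        · exact ih _ (by lia) hz (simpleRefl_mul_mem_dcoset hk hw) h4 rfl
        · exact ih _ (by lia) (simpleRefl_mul_mem_dcoset hk hz) (simpleRefl_mul_mem_dcoset hk hw)
            h4 rfl
      · have h2 := length_mul_simpleRefl b w k
        have h3 : length b (w * simpleRefl b k) < length b w := by lia
        rcases h.le_or_mul_le h3 with h4 | h4
        · exact ih _ (by lia) hz (mul_simpleRefl_mem_dcoset hk hw) h4 rfl
        · exact ih _ (by lia) (mul_simpleRefl_mem_dcoset hk hz) (mul_simpleRefl_mem_dcoset hk hw)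
            h4 rfl

/-- The deletion property: a word contains a reduced word for the same element. -/
theorem exists_reduced_of_word (l : List b.support) :
    ∃ l' : List b.support, l'.Sublist l ∧ wordProd b l' = wordProd b l ∧
      l'.length = length b (wordProd b l) := by
  induction l with
  | nil => exact ⟨[], by simp⟩
  | cons k l ih =>
    obtain ⟨l1, h1, h2, h3⟩ := ih
    rcases length_simpleRefl_mul b (wordProd b l) k with h | h
    · exact ⟨k :: l1, h1.cons_cons k, by simp [h2], by simp [h3, h]⟩
    · set i := P.weylGroupToPerm (wordProd b l)⁻¹ k with hi
      have hneg : ¬ b.IsPos i := by rw [hi, ← lt_length_simpleRefl_mul_iff]; lia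
      have e : P.weylGroupToPerm (wordProd b l) i = k := by
        rw [hi, ← Equiv.Perm.mul_apply, ← map_mul]; simp
      obtain ⟨l2, h4, h5, h6⟩ := exists_sublist_of_not_isPos b l1
        (i := P.reflectionPerm i i) ((isPos_neg_iff b i).2 hneg) (by
          rw [h2, perm_neg, e, isPos_neg_iff]
          exact not_not.2 (Base.isPos_of_mem_support k.2))
      refine ⟨l2, (h4.trans h1).cons k, ?_, ?_⟩
      · rw [h6, ofIdx_neg, h2, mul_ofIdx, e, wordProd_cons]; rfl
      · rw [wordProd_cons]; lia

theorem exists_reduced_of_mem_parabolic {u : P.weylGroup} (hu : u ∈ parabolic b J) :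
    ∃ l : List b.support, (∀ k ∈ l, k ∈ J) ∧ wordProd b l = u ∧ l.length = length b u := by
  obtain ⟨l, hl, rfl⟩ := exists_word_of_mem_parabolic hu
  obtain ⟨l', h1, h2, h3⟩ := exists_reduced_of_word l
  exact ⟨l', fun k hk => hl k (h1.subset hk), h2, h3⟩

/-- An element without left descents in `J` is a minimal length representative of its right
coset, in the strong sense that lengths add. -/
theorem mem_minRight_iff {w : P.weylGroup} :
    w ∈ minRight b J ↔ ∀ k ∈ J, length b w < length b (simpleRefl b k * w) := by
  constructor
  · intro h k hk
    have h1 := h _ (simpleRefl_mem_parabolic hk)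
    rcases length_simpleRefl_mul b w k with h2 | h2 <;> lia
  · intro h u hu
    have hw : NoDescent J ∅ w := ⟨h, by simp⟩
    obtain ⟨l, hl, rfl, hlen⟩ := exists_reduced_of_mem_parabolic hu
    clear hu
    induction l with
    | nil => simp
    | cons k l ih =>
      have hk : k ∈ J := hl k (by simp)
      have hl' : ∀ k ∈ l, k ∈ J := fun k hk => hl k (by simp [hk])
      have h1 := length_wordProd_le b l
      have h2 := length_simpleRefl_mul b (wordProd b l) k
      rw [wordProd_cons] at hlen ⊢
      simp only [List.length_cons] at hlen
      have h3 := ih hl' (by lia)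
      have h4 := length_simpleRefl_mul b (wordProd b l * w) k
      rw [← mul_assoc] at h4
      rcases h4 with h4 | h4
      · lia
      · -- the positive root `u⁻¹ α` of the parabolic subsystem would be an inversion of `w⁻¹`
        exfalso
        set j := P.weylGroupToPerm (wordProd b l)⁻¹ k with hj
        have hpos : b.IsPos j := by rw [hj, ← lt_length_simpleRefl_mul_iff]; lia
        have hneg : ¬ b.IsPos (P.weylGroupToPerm w⁻¹ j) := by
          rw [hj, ← Equiv.Perm.mul_apply, ← map_mul, ← mul_inv_rev,
            ← lt_length_simpleRefl_mul_iff, ← mul_assoc]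
          lia
        have h5 := length_mul_ofIdx_lt b hpos hneg
        rw [← length_inv, mul_inv_rev, inv_inv, ofIdx_inv, length_inv] at h5
        have h6 : weylGroup.ofIdx P j ∈ parabolic b J := by
          have hl2 : wordProd b l ∈ parabolic b J := by
            clear * - hl'
            induction l with
            | nil => exact one_mem _
            | cons a l ih =>
              rw [wordProd_cons]
              exact mul_mem (simpleRefl_mem_parabolic (hl' a (by simp)))
                (ih fun k hk => hl' k (by simp [hk]))
          rw [hj, ← ofIdx_conj]
          exact mul_mem (mul_mem (inv_mem hl2) (simpleRefl_mem_parabolic hk))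
            (inv_mem (inv_mem hl2))
        have h7 : weylGroup.ofIdx P j * w ∈ dcoset J ∅ w := by
          rw [dcoset, DoubleCoset.mem_doubleCoset]
          exact ⟨_, h6, 1, one_mem _, by simp⟩
        exact absurd (hw.le h7).length_le h5.not_ge

theorem mem_minRight_iff_noDescent {w : P.weylGroup} : w ∈ minRight b J ↔ NoDescent J ∅ w := by
  rw [mem_minRight_iff, NoDescent]; simp

theorem mem_minDouble_iff {w : P.weylGroup} : w ∈ minDouble b I J ↔ NoDescent I J w := by
  rw [minDouble, Set.mem_ofPred_eq, mem_minRight_iff, mem_minRight_iff, NoDescent]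
  simp only [length_inv, length_simpleRefl_mul_eq b w⁻¹, inv_inv]

/-- Every element of the Weyl group is the product of an element of `W_J` and a minimal length
representative. -/
theorem exists_parabolic_mul_minRight (J : Set b.support) (z : P.weylGroup) :
    ∃ u ∈ parabolic b J, ∃ w ∈ minRight b J, z = u * w := by
  obtain ⟨w, hw, h⟩ := exists_noDescent J ∅ z
  obtain ⟨u, hu, h1⟩ := mem_dcoset_empty.1 (mem_dcoset_comm hw)
  exact ⟨u, hu, w, mem_minRight_iff_noDescent.2 h, h1⟩

theorem minRight_unique {w w' u : P.weylGroup} (hw : w ∈ minRight b J) (hw' : w' ∈ minRight b J)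
    (hu : u ∈ parabolic b J) (h : w' = u * w) : w = w' :=
  (mem_minRight_iff_noDescent.1 hw).unique (mem_minRight_iff_noDescent.1 hw')
    (mem_dcoset_empty.2 ⟨u, hu, h⟩)

/-- If `w` is a minimal length representative, then so is `w s`, unless `w s = s' w` for some
`s'` in `J`. -/
theorem mul_simpleRefl_mem_minRight_or {w : P.weylGroup} (hw : w ∈ minRight b J) (k : b.support) :
    w * simpleRefl b k ∈ minRight b J ∨
      ∃ j ∈ J, simpleRefl b j * w = w * simpleRefl b k := by
  by_cases h : w * simpleRefl b k ∈ minRight b J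
  · exact Or.inl h
  · right
    rw [mem_minRight_iff] at h
    push Not at h
    obtain ⟨j, hj, h1⟩ := h
    have h2 := length_simpleRefl_mul b (w * simpleRefl b k) j
    exact ⟨j, hj, simpleRefl_mul_eq_mul_simpleRefl b (mem_minRight_iff.1 hw j hj) (by lia)⟩

variable [P.IsRootSystem]

theorem allDescent_longest (z : P.weylGroup) : AllDescent I J (longest b (dcoset I J z)) :=
  allDescent_of_maximal fun y hy => by
    rw [dcoset_eq (longest_dcoset_mem z)] at hy
    exact length_le_longest hy

theorem le_longest {y z : P.weylGroup} (hy : y ∈ dcoset I J z) :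
    bruhatLE b y (longest b (dcoset I J z)) :=
  (allDescent_longest z).le (by rwa [dcoset_eq (longest_dcoset_mem z)])

end Parabolic

/-! ### The standard basis of the Hecke algebra -/

theorem qpow_add (m n : ℤ) : qpow (m + n) = qpow m * qpow n := LaurentPolynomial.T_add m n

@[simp] theorem qpow_zero : qpow 0 = 1 := LaurentPolynomial.T_zero

theorem qpow_mul_neg (n : ℤ) : qpow n * qpow (-n) = 1 := by rw [← qpow_add]; simp

section HeckeBasis

variable {ι K M N : Type*} [Field K]
  [AddCommGroup M] [Module K M] [AddCommGroup N] [Module K N] {P : RootPairing ι K M N}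
  (b : P.Base)

open Classical in
/-- Left multiplication by `H_k` on the free module over the Weyl group. -/
def leftOp (k : b.support) : Module.End A (P.weylGroup →₀ A) :=
  Finsupp.linearCombination A fun w =>
    Finsupp.single (simpleRefl b k * w) 1 +
      (if length b (simpleRefl b k * w) < length b w then qpow (-1) - qpow 1 else 0) •
        Finsupp.single w 1

open Classical in
/-- Right multiplication by `H_k` on the free module over the Weyl group. -/
def rightOp (k : b.support) : Module.End A (P.weylGroup →₀ A) :=
  Finsupp.linearCombination A fun w =>
    Finsupp.single (w * simpleRefl b k) 1 +
      (if length b (w * simpleRefl b k) < length b w then qpow (-1) - qpow 1 else 0) •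
        Finsupp.single w 1

theorem leftOp_single (k : b.support) (w : P.weylGroup) :
    leftOp b k (Finsupp.single w 1) = Finsupp.single (simpleRefl b k * w) 1 +
      (if length b (simpleRefl b k * w) < length b w then qpow (-1) - qpow 1 else 0) •
        Finsupp.single w 1 := by
  classical
  simp [leftOp]

theorem rightOp_single (k : b.support) (w : P.weylGroup) :
    rightOp b k (Finsupp.single w 1) = Finsupp.single (w * simpleRefl b k) 1 +
      (if length b (w * simpleRefl b k) < length b w then qpow (-1) - qpow 1 else 0) •
        Finsupp.single w 1 := by
  classical
  simp [rightOp]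

theorem exists_heckeMk (h : Hecke b) : ∃ x, heckeMk b x = h :=
  RingQuot.mkAlgHom_surjective A (HeckeRel b) h

theorem gen_mul_gen (k : b.support) :
    gen b k * gen b k = 1 + (qpow (-1) - qpow 1) • gen b k := by
  have h := gen_mul_inv b k
  rw [mul_add, ← Algebra.commutes, ← Algebra.smul_def] at h
  rw [← h, add_assoc, ← add_smul]
  simp

/-- An `A`-submodule of the Hecke algebra that is stable under right multiplication by the
generators is a right ideal. -/
theorem mul_mem_of_forall_gen (S : Submodule A (Hecke b))
    (hS : ∀ x ∈ S, ∀ k, x * gen b k ∈ S) {x : Hecke b} (hx : x ∈ S) (h : Hecke b) :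
    x * h ∈ S := by
  obtain ⟨y, rfl⟩ := exists_heckeMk b h
  induction y using FreeAlgebra.induction generalizing x with
  | grade0 r => rw [AlgHom.commutes, ← Algebra.commutes, ← Algebra.smul_def]; exact S.smul_mem r hx
  | grade1 k => exact hS x hx k
  | mul a c ha hc => rw [map_mul, ← mul_assoc]; exact hc (ha hx)
  | add a c ha hc => rw [map_add, mul_add]; exact S.add_mem (ha hx) (hc hx)

variable [Finite ι] [CharZero K] [P.IsCrystallographic] [P.IsReduced]

/-- Left and right multiplications commute. The case distinction rests on the exchange condition: if
one of them affects the descents of the other, then `s w = w t`. -/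
theorem commute_leftOp_rightOp (k j : b.support) : Commute (leftOp b k) (rightOp b j) := by
  refine Finsupp.lhom_ext' fun w => LinearMap.ext_ring ?_
  simp only [LinearMap.comp_apply, Finsupp.lsingle_apply, Module.End.mul_apply, leftOp_single,
    rightOp_single, map_add, map_smul, smul_add, mul_assoc]
  have h1 := length_simpleRefl_mul b w k
  have h2 := length_mul_simpleRefl b w j
  have h3 := length_simpleRefl_mul b (w * simpleRefl b j) k
  have h4 := length_mul_simpleRefl b (simpleRefl b k * w) j
  by_cases e : simpleRefl b k * w = w * simpleRefl b j
  · have e1 : simpleRefl b k * (w * simpleRefl b j) = w := by rw [← e]; simp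
    rw [e1, e]
  · rw [mul_assoc] at h4
    have e1 : length b (simpleRefl b k * (w * simpleRefl b j)) < length b (w * simpleRefl b j) ↔
        length b (simpleRefl b k * w) < length b w := by
      constructor
      · intro h
        by_contra h'
        exact e (simpleRefl_mul_eq_mul_simpleRefl b (by lia) h)
      · intro h
        by_contra h'
        have := simpleRefl_mul_eq_mul_simpleRefl b (k := k) (j := j) (w := w * simpleRefl b j)
          (by lia) (by simpa using h)
        simp only [mul_simpleRefl_mul_simpleRefl] at this
        exact e (by conv_lhs => rw [← this, simpleRefl_mul_simpleRefl_mul])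
    have e2 : length b (simpleRefl b k * (w * simpleRefl b j)) < length b (simpleRefl b k * w) ↔
        length b (w * simpleRefl b j) < length b w := by
      lia
    simp only [e1, e2]
    split_ifs <;> module

theorem leftOp_prod_single (l : List b.support) (h : length b (wordProd b l) = l.length) :
    (l.map (leftOp b)).prod (Finsupp.single 1 1) = Finsupp.single (wordProd b l) 1 := by
  induction l with
  | nil => simp
  | cons k l ih =>
    have h1 := length_wordProd_le b l
    have h2 := length_simpleRefl_mul b (wordProd b l) k
    rw [wordProd_cons, List.length_cons] at h
    rw [List.map_cons, List.prod_cons, Module.End.mul_apply, ih (by lia), leftOp_single,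
      if_neg (by lia), wordProd_cons]
    simp

theorem exists_rightOp_prod (w : P.weylGroup) : ∃ l : List b.support,
    (l.map (rightOp b)).prod (Finsupp.single 1 1) = Finsupp.single w 1 := by
  obtain ⟨l, rfl, h⟩ := exists_reduced b w
  induction l using List.reverseRecOn with
  | nil => exact ⟨[], by simp⟩
  | append_singleton l k ih =>
    have h1 := length_wordProd_le b l
    have h2 := length_mul_simpleRefl b (wordProd b l) k
    simp only [wordProd_append, wordProd_cons, wordProd_nil, mul_one, List.length_append,
      List.length_cons, List.length_nil] at h ⊢
    obtain ⟨l', hl'⟩ := ih (by lia)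
    refine ⟨k :: l', ?_⟩
    rw [List.map_cons, List.prod_cons, Module.End.mul_apply, hl', rightOp_single,
      if_neg (by lia)]
    simp

/-- An operator that commutes with all right multiplications is determined by its value at the
basis vector of the identity. -/
theorem eq_of_commute_rightOp {D D' : Module.End A (P.weylGroup →₀ A)}
    (h : ∀ k, Commute D (rightOp b k)) (h' : ∀ k, Commute D' (rightOp b k))
    (h1 : D (Finsupp.single 1 1) = D' (Finsupp.single 1 1)) : D = D' := by
  refine Finsupp.lhom_ext' fun w => LinearMap.ext_ring ?_
  obtain ⟨l, hl⟩ := exists_rightOp_prod b w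
  have key : ∀ D : Module.End A (P.weylGroup →₀ A), (∀ k, Commute D (rightOp b k)) →
      Commute D (l.map (rightOp b)).prod := fun D hD =>
    Commute.list_prod_right _ _ fun x hx => by
      obtain ⟨k, -, rfl⟩ := List.mem_map.1 hx
      exact hD k
  simp only [LinearMap.comp_apply, Finsupp.lsingle_apply, ← hl]
  rw [← Module.End.mul_apply, ← Module.End.mul_apply, (key D h).eq, (key D' h').eq,
    Module.End.mul_apply, Module.End.mul_apply, h1]

theorem length_alternating (i j : b.support) {n : ℕ}
    (hn : n ≤ orderOf (simpleRefl b i * simpleRefl b j)) :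
    length b (wordProd b (alternatingWord i j n)) = n := by
  induction n generalizing i j with
  | zero => simp [alternatingWord]
  | succ n ih =>
    have h1 := isPos_perm_alternating b j i (n := n) (by rw [orderOf_simpleRefl_comm]; lia)
    rw [← lt_length_mul_simpleRefl_iff] at h1
    have h2 := length_mul_simpleRefl b (wordProd b (alternatingWord j i n)) j
    have h3 := ih j i (by rw [orderOf_simpleRefl_comm]; lia)
    rw [alternatingWord_succ, List.concat_eq_append, wordProd_append]
    simp only [wordProd_cons, wordProd_nil, mul_one]
    lia

/-- The left multiplications satisfy the defining relations of the Hecke algebra. Both sides of a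
braid relation commute with the right multiplications, so they need to be compared only on the basis
vector of the identity. -/
theorem heckeRel_leftOp ⦃x y : FreeAlgebra A b.support⦄ (h : HeckeRel b x y) :
    FreeAlgebra.lift A (leftOp b) x = FreeAlgebra.lift A (leftOp b) y := by
  cases h with
  | quadratic k =>
    simp only [map_mul, map_sub, map_add, AlgHom.commutes, map_zero, FreeAlgebra.lift_ι_apply]
    refine Finsupp.lhom_ext' fun w => LinearMap.ext_ring ?_
    simp only [LinearMap.comp_apply, Finsupp.lsingle_apply, Module.End.mul_apply,
      LinearMap.add_apply, LinearMap.sub_apply, Module.algebraMap_end_apply, leftOp_single,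
      map_add, map_smul, simpleRefl_mul_simpleRefl_mul, LinearMap.zero_apply]
    have h1 := length_simpleRefl_mul b w k
    have h2 : qpow 1 * qpow (-1) = 1 := qpow_mul_neg 1
    rcases h1 with h1 | h1
    · have n1 : ¬ length b (simpleRefl b k * w) < length b w := by lia
      have n2 : length b w < length b (simpleRefl b k * w) := by lia
      simp only [n1, n2, if_true, if_false]
      match_scalars <;> first | linear_combination (-h2) | linear_combination h2 | ring
    · have n1 : length b (simpleRefl b k * w) < length b w := by lia
      have n2 : ¬ length b w < length b (simpleRefl b k * w) := by lia
      simp only [n1, n2, if_true, if_false]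
      match_scalars <;> first | linear_combination (-h2) | linear_combination h2 | ring
  | braid i j hij =>
    simp only [map_list_prod, List.map_map]
    have e : (⇑(FreeAlgebra.lift A (leftOp b)) ∘ FreeAlgebra.ι A) = leftOp b := by
      funext k; simp
    rw [e]
    have hc : ∀ l : List b.support, ∀ k, Commute (l.map (leftOp b)).prod (rightOp b k) :=
      fun l k => Commute.list_prod_left _ _ fun x hx => by
        obtain ⟨j, -, rfl⟩ := List.mem_map.1 hx
        exact commute_leftOp_rightOp b j k
    refine eq_of_commute_rightOp b (hc _) (hc _) ?_
    rw [leftOp_prod_single, leftOp_prod_single, wordProd_alternating_orderOf]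
    · rw [length_alternating, length_alternatingWord]
      rw [orderOf_simpleRefl_comm]
    · rw [length_alternating b i j le_rfl, length_alternatingWord]

/-- The left regular representation of the Hecke algebra, on the free module over the Weyl
group. -/
def regRep : Hecke b →ₐ[A] Module.End A (P.weylGroup →₀ A) :=
  RingQuot.liftAlgHom A ⟨FreeAlgebra.lift A (leftOp b), heckeRel_leftOp b⟩

theorem regRep_gen (k : b.support) : regRep b (gen b k) = leftOp b k := by
  have h := RingQuot.liftAlgHom_mkAlgHom_apply A (FreeAlgebra.lift A (leftOp b))
    (heckeRel_leftOp b) (FreeAlgebra.ι A k)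
  rw [FreeAlgebra.lift_ι_apply] at h
  exact h

theorem regRep_heckeH (w : P.weylGroup) :
    regRep b (heckeH b w) (Finsupp.single 1 1) = Finsupp.single w 1 := by
  obtain ⟨h1, h2⟩ := reducedWord_spec b w
  have e : ⇑(regRep b) ∘ gen b = leftOp b := funext (regRep_gen b)
  rw [heckeH, map_list_prod, List.map_map, e, leftOp_prod_single b _ (by rw [h1, h2]), h1]

/-- The elements `H_w` are linearly independent, as the left regular representation maps them to
operators with different basis vectors as values at the identity. -/
theorem linearIndependent_heckeH : LinearIndependent A (heckeH b) := by
  have h : LinearIndependent A (fun w : P.weylGroup => (Finsupp.single w 1 : P.weylGroup →₀ A)) :=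
    Finsupp.basisSingleOne.linearIndependent
  refine LinearIndependent.of_comp
    ((LinearMap.applyₗ (Finsupp.single 1 1)).comp (regRep b).toLinearMap) ?_
  convert h using 1
  funext w
  exact regRep_heckeH b w

variable [P.IsRootSystem]

theorem heckeH_wordProd (l : List b.support) (hl : length b (wordProd b l) = l.length) :
    heckeH b (wordProd b l) = (l.map (gen b)).prod := by
  obtain ⟨h1, h2⟩ := reducedWord_spec b (wordProd b l)
  exact prod_map_eq_of_reduced b (gen b) (gen_braid b) _ _ h1 (by rw [h1, h2]) hl

@[simp] theorem heckeH_one : heckeH b 1 = 1 := by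
  simpa using heckeH_wordProd b [] (by simp)

theorem heckeH_mul_gen_of_lt {w : P.weylGroup} {k : b.support}
    (h : length b w < length b (w * simpleRefl b k)) :
    heckeH b w * gen b k = heckeH b (w * simpleRefl b k) := by
  obtain ⟨l, rfl, hl⟩ := exists_reduced b w
  have h2 := length_mul_simpleRefl b (wordProd b l) k
  have e : wordProd b l * simpleRefl b k = wordProd b (l ++ [k]) := by simp
  rw [heckeH_wordProd b l hl.symm, e, heckeH_wordProd]
  · simp
  · rw [← e]; simp; lia

theorem gen_mul_heckeH_of_lt {w : P.weylGroup} {k : b.support}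
    (h : length b w < length b (simpleRefl b k * w)) :
    gen b k * heckeH b w = heckeH b (simpleRefl b k * w) := by
  obtain ⟨l, rfl, hl⟩ := exists_reduced b w
  have h2 := length_simpleRefl_mul b (wordProd b l) k
  have e : simpleRefl b k * wordProd b l = wordProd b (k :: l) := by simp
  rw [heckeH_wordProd b l hl.symm, e, heckeH_wordProd]
  · simp
  · rw [← e]; simp; lia

theorem heckeH_mul_gen (w : P.weylGroup) (k : b.support) :
    heckeH b w * gen b k = heckeH b (w * simpleRefl b k) +
      (if length b (w * simpleRefl b k) < length b w then qpow (-1) - qpow 1 else 0) •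
        heckeH b w := by
  split_ifs with h
  · have h1 := heckeH_mul_gen_of_lt b (w := w * simpleRefl b k) (k := k) (by simpa using h)
    rw [mul_simpleRefl_mul_simpleRefl] at h1
    conv_lhs => rw [← h1]
    rw [mul_assoc, gen_mul_gen, mul_add, mul_one, mul_smul_comm, h1]
  · have := length_mul_simpleRefl b w k
    rw [heckeH_mul_gen_of_lt b (by lia), zero_smul, add_zero]

theorem gen_mul_heckeH (w : P.weylGroup) (k : b.support) :
    gen b k * heckeH b w = heckeH b (simpleRefl b k * w) +
      (if length b (simpleRefl b k * w) < length b w then qpow (-1) - qpow 1 else 0) •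
        heckeH b w := by
  split_ifs with h
  · have h1 := gen_mul_heckeH_of_lt b (w := simpleRefl b k * w) (k := k) (by simpa using h)
    rw [simpleRefl_mul_simpleRefl_mul] at h1
    conv_lhs => rw [← h1]
    rw [← mul_assoc, gen_mul_gen, add_mul, one_mul, smul_mul_assoc, h1]
  · have := length_simpleRefl_mul b w k
    rw [gen_mul_heckeH_of_lt b (by lia), zero_smul, add_zero]

/-- If lengths add, then `H_u H_w = H_{uw}`. -/
theorem heckeH_mul_heckeH {u w : P.weylGroup}
    (h : length b (u * w) = length b u + length b w) :
    heckeH b u * heckeH b w = heckeH b (u * w) := by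
  obtain ⟨l, rfl, hl⟩ := exists_reduced b u
  obtain ⟨l', rfl, hl'⟩ := exists_reduced b w
  rw [heckeH_wordProd b l hl.symm, heckeH_wordProd b l' hl'.symm, ← wordProd_append,
    heckeH_wordProd b (l ++ l')]
  · simp
  · rw [wordProd_append, h, ← hl, ← hl']; simp

theorem span_heckeH : ⊤ ≤ Submodule.span A (Set.range (heckeH b)) := by
  intro h _
  rw [← one_mul h]
  refine mul_mem_of_forall_gen b _ (fun x hx k => ?_)
    (by rw [← heckeH_one b]; exact Submodule.subset_span (Set.mem_range_self _)) h
  induction hx using Submodule.span_induction with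
  | mem x hx =>
    obtain ⟨w, rfl⟩ := hx
    rw [heckeH_mul_gen]
    exact Submodule.add_mem _ (Submodule.subset_span ⟨_, rfl⟩)
      (Submodule.smul_mem _ _ (Submodule.subset_span ⟨_, rfl⟩))
  | zero => simp
  | add x y _ _ hx hy => rw [add_mul]; exact Submodule.add_mem _ hx hy
  | smul a x _ hx => rw [smul_mul_assoc]; exact Submodule.smul_mem _ _ hx

/-- The standard basis `H_w` of the Hecke algebra. -/
def heckeBasis : Module.Basis P.weylGroup A (Hecke b) :=
  Module.Basis.mk (linearIndependent_heckeH b) (span_heckeH b)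

@[simp] theorem heckeBasis_apply (w : P.weylGroup) : heckeBasis b w = heckeH b w := by
  simp [heckeBasis]

/-- The coefficient of `H_w`. -/
def coord (w : P.weylGroup) : Hecke b →ₗ[A] A := (heckeBasis b).coord w

open Classical in
@[simp] theorem coord_heckeH (w y : P.weylGroup) :
    coord b y (heckeH b w) = if y = w then 1 else 0 := by
  rw [coord, Module.Basis.coord_apply, ← heckeBasis_apply, Module.Basis.repr_self,
    Finsupp.single_apply]
  simp only [eq_comm]

variable {b}

theorem hecke_ext {h h' : Hecke b} (e : ∀ w, coord b w h = coord b w h') : h = h' :=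
  (heckeBasis b).ext_elem e

theorem hecke_sum (h : Hecke b) : h = ∑ w, coord b w h • heckeH b w := by
  conv_lhs => rw [← (heckeBasis b).sum_repr h]
  simp [coord]

open Classical in
theorem coord_sum_smul (f : P.weylGroup → A) (y : P.weylGroup) :
    coord b y (∑ w, f w • heckeH b w) = f y := by
  simp

theorem coord_mul_gen (h : Hecke b) (k : b.support) (y : P.weylGroup) :
    coord b y (h * gen b k) = coord b (y * simpleRefl b k) h +
      (if length b (y * simpleRefl b k) < length b y then qpow (-1) - qpow 1 else 0) *
        coord b y h := by
  classical
  have key : coord b y ∘ₗ LinearMap.mulRight A (gen b k) = coord b (y * simpleRefl b k) +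
      (if length b (y * simpleRefl b k) < length b y then qpow (-1) - qpow 1 else 0) •
        coord b y := by
    refine (heckeBasis b).ext fun w => ?_
    have e : y = w * simpleRefl b k ↔ y * simpleRefl b k = w := by
      constructor <;> rintro rfl <;> simp
    simp only [heckeBasis_apply, LinearMap.comp_apply, LinearMap.mulRight_apply,
      LinearMap.add_apply, LinearMap.smul_apply, heckeH_mul_gen, map_add, map_smul, coord_heckeH,
      smul_eq_mul, e]
    by_cases h1 : y = w <;> simp [h1]
  exact LinearMap.congr_fun key h

theorem coord_gen_mul (h : Hecke b) (k : b.support) (y : P.weylGroup) :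
    coord b y (gen b k * h) = coord b (simpleRefl b k * y) h +
      (if length b (simpleRefl b k * y) < length b y then qpow (-1) - qpow 1 else 0) *
        coord b y h := by
  classical
  have key : coord b y ∘ₗ LinearMap.mulLeft A (gen b k) = coord b (simpleRefl b k * y) +
      (if length b (simpleRefl b k * y) < length b y then qpow (-1) - qpow 1 else 0) •
        coord b y := by
    refine (heckeBasis b).ext fun w => ?_
    have e : y = simpleRefl b k * w ↔ simpleRefl b k * y = w := by
      constructor <;> rintro rfl <;> simp
    simp only [heckeBasis_apply, LinearMap.comp_apply, LinearMap.mulLeft_apply,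
      LinearMap.add_apply, LinearMap.smul_apply, gen_mul_heckeH, map_add, map_smul, coord_heckeH,
      smul_eq_mul, e]
    by_cases h1 : y = w <;> simp [h1]
  exact LinearMap.congr_fun key h

end HeckeBasis

/-! ### Coefficients of Laurent polynomials -/

section Laurent

theorem coeff_qpow_mul (a : A) (d n : ℤ) : (qpow d * a).coeff n = a.coeff (n - d) := by
  rw [qpow, LaurentPolynomial.T, AddMonoidAlgebra.coeff_single_mul_apply, one_mul,
    neg_add_eq_sub]

theorem laurent_eq_sum (a : A) :
    a = ∑ n ∈ a.coeff.support, a.coeff n • qpow n := by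
  conv_lhs => rw [← AddMonoidAlgebra.sum_coeff_single a]
  rw [Finsupp.sum]
  refine Finset.sum_congr rfl fun n _ => ?_
  rw [LaurentPolynomial.single_eq_C_mul_T, LaurentPolynomial.smul_eq_C_mul]

theorem InQZq.zero : InQZq 0 := ⟨0, by simp⟩

theorem InQZq.add {a c : A} (ha : InQZq a) (hc : InQZq c) : InQZq (a + c) := by
  obtain ⟨p, rfl⟩ := ha
  obtain ⟨r, rfl⟩ := hc
  exact ⟨p + r, by rw [map_add, mul_add]⟩

theorem InQZq.neg {a : A} (ha : InQZq a) : InQZq (-a) := by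
  obtain ⟨p, rfl⟩ := ha
  exact ⟨-p, by rw [map_neg, mul_neg]⟩

theorem InQZq.sub {a c : A} (ha : InQZq a) (hc : InQZq c) : InQZq (a - c) := by
  rw [sub_eq_add_neg]; exact ha.add hc.neg

theorem InQZq.mul {a c : A} (ha : InQZq a) (hc : InQZq c) : InQZq (a * c) := by
  obtain ⟨p, rfl⟩ := ha
  obtain ⟨r, rfl⟩ := hc
  exact ⟨p * (Polynomial.X * r), by simp; ring⟩

theorem inQZq_qpow_one : InQZq (qpow 1) := ⟨1, by simp⟩

theorem InQZq.sum {α : Type*} (s : Finset α) (f : α → A) (h : ∀ i ∈ s, InQZq (f i)) :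
    InQZq (∑ i ∈ s, f i) := by
  classical
  induction s using Finset.induction_on with
  | empty => simpa using InQZq.zero
  | insert i s hi ih =>
    rw [Finset.sum_insert hi]
    exact (h i (by simp)).add (ih fun j hj => h j (by simp [hj]))

theorem inQZq_iff {a : A} : InQZq a ↔ ∀ n ≤ 0, a.coeff n = 0 := by
  constructor
  · rintro ⟨p, rfl⟩ n hn
    rw [coeff_qpow_mul]
    by_contra h
    have h1 := Finsupp.mem_support_iff.2 h
    rw [LaurentPolynomial.support_coeff_toLaurent, Finset.mem_map] at h1
    obtain ⟨m, -, h2⟩ := h1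
    simp only [Nat.castEmbedding_apply] at h2
    lia
  · intro h
    rw [laurent_eq_sum a]
    refine InQZq.sum _ _ fun n hn => ?_
    have hpos : 0 < n := by
      by_contra h'
      exact (Finsupp.mem_support_iff.1 hn) (h n (by lia))
    refine ⟨Polynomial.C (a.coeff n) * Polynomial.X ^ (n.toNat - 1), ?_⟩
    rw [Polynomial.toLaurent_C_mul_X_pow, LaurentPolynomial.smul_eq_C_mul, mul_left_comm,
      ← qpow_add]
    congr 2
    lia

/-- An element of `q ℤ[q]` that is invariant under `q ↦ q⁻¹` is zero. -/
theorem InQZq.eq_zero_of_invert {a : A} (h : InQZq a) (h' : LaurentPolynomial.invert a = a) :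
    a = 0 := by
  rw [inQZq_iff] at h
  ext n
  rcases le_total n 0 with hn | hn
  · simp [h n hn]
  · rw [← h', LaurentPolynomial.invert_apply, h (-n) (by lia)]
    simp

theorem coeff_aeval (p : Polynomial ℤ) (d : ℤ) (m : ℕ) :
    (qpow d * Polynomial.aeval (qpow (-2)) p).coeff (d - 2 * m) = p.coeff m := by
  rw [coeff_qpow_mul]
  induction p using Polynomial.induction_on' with
  | add p r hp hr => rw [map_add, AddMonoidAlgebra.coeff_add, Finsupp.add_apply, hp, hr]; simp
  | monomial n a =>
    rw [Polynomial.aeval_monomial, ← Algebra.smul_def, LaurentPolynomial.T_pow,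
      AddMonoidAlgebra.coeff_smul, Finsupp.smul_apply, LaurentPolynomial.T_apply,
      Polynomial.coeff_monomial]
    by_cases h : n = m
    · subst h; simp; lia
    · rw [if_neg (by lia), if_neg h]; simp

theorem exists_of_coeff_aeval_ne_zero {p : Polynomial ℤ} {d n : ℤ}
    (h : (qpow d * Polynomial.aeval (qpow (-2)) p).coeff n ≠ 0) : ∃ m : ℕ, n = d - 2 * m := by
  rw [coeff_qpow_mul] at h
  induction p using Polynomial.induction_on' with
  | add p r hp hr =>
    rw [map_add, AddMonoidAlgebra.coeff_add, Finsupp.add_apply] at h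
    by_cases h1 : ((Polynomial.aeval (qpow (-2)) p : A)).coeff (n - d) = 0
    · exact hr (by simpa [h1] using h)
    · exact hp h1
  | monomial k a =>
    refine ⟨k, ?_⟩
    by_contra h1
    rw [Polynomial.aeval_monomial, ← Algebra.smul_def, LaurentPolynomial.T_pow,
      AddMonoidAlgebra.coeff_smul, Finsupp.smul_apply, LaurentPolynomial.T_apply,
      if_neg (by lia)] at h
    simp at h

theorem aeval_inj {p r : Polynomial ℤ} {d : ℤ}
    (h : qpow d * Polynomial.aeval (qpow (-2)) p = qpow d * Polynomial.aeval (qpow (-2)) r) :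
    p = r := by
  ext m
  rw [← coeff_aeval p d m, h, coeff_aeval]

/-- `a ∈ q ^ d ℤ[q⁻²]`: the shape of the coefficients of Kazhdan–Lusztig elements. -/
def InEven (d : ℤ) (a : A) : Prop :=
  ∃ p : Polynomial ℤ, a = qpow d * Polynomial.aeval (qpow (-2)) p

theorem InEven.zero (d : ℤ) : InEven d 0 := ⟨0, by simp⟩

theorem InEven.add {d : ℤ} {a c : A} (ha : InEven d a) (hc : InEven d c) : InEven d (a + c) := by
  obtain ⟨p, rfl⟩ := ha
  obtain ⟨r, rfl⟩ := hc
  exact ⟨p + r, by rw [map_add, mul_add]⟩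

theorem InEven.neg {d : ℤ} {a : A} (ha : InEven d a) : InEven d (-a) := by
  obtain ⟨p, rfl⟩ := ha
  exact ⟨-p, by rw [map_neg, mul_neg]⟩

theorem InEven.sub {d : ℤ} {a c : A} (ha : InEven d a) (hc : InEven d c) : InEven d (a - c) := by
  rw [sub_eq_add_neg]; exact ha.add hc.neg

theorem InEven.mul {d e : ℤ} {a c : A} (ha : InEven d a) (hc : InEven e c) :
    InEven (d + e) (a * c) := by
  obtain ⟨p, rfl⟩ := ha
  obtain ⟨r, rfl⟩ := hc
  exact ⟨p * r, by rw [map_mul, qpow_add]; ring⟩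

theorem InEven.add_two {d : ℤ} {a : A} (ha : InEven d a) : InEven (d + 2) a := by
  obtain ⟨p, rfl⟩ := ha
  refine ⟨Polynomial.X * p, ?_⟩
  rw [map_mul, Polynomial.aeval_X, qpow_add, mul_assoc, ← mul_assoc (qpow 2), ← qpow_add]
  simp

theorem InEven.sum {α : Type*} {d : ℤ} (s : Finset α) (f : α → A)
    (h : ∀ i ∈ s, InEven d (f i)) : InEven d (∑ i ∈ s, f i) := by
  classical
  induction s using Finset.induction_on with
  | empty => simpa using InEven.zero d
  | insert i s hi ih =>
    rw [Finset.sum_insert hi]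
    exact (h i (by simp)).add (ih fun j hj => h j (by simp [hj]))

theorem inEven_one : InEven 0 1 := ⟨1, by simp⟩

theorem inEven_qpow (d : ℤ) : InEven d (qpow d) := ⟨1, by simp⟩

theorem inEven_qpow_neg_one : InEven 1 (qpow (-1)) :=
  ⟨Polynomial.X, by rw [Polynomial.aeval_X, ← qpow_add]; rfl⟩

theorem inEven_iff {d : ℤ} {a : A} :
    InEven d a ↔ ∀ n, a.coeff n ≠ 0 → ∃ m : ℕ, n = d - 2 * m := by
  constructor
  · rintro ⟨p, rfl⟩ n hn
    exact exists_of_coeff_aeval_ne_zero hn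
  · intro h
    rw [laurent_eq_sum a]
    refine InEven.sum _ _ fun n hn => ?_
    obtain ⟨m, rfl⟩ := h n (Finsupp.mem_support_iff.1 hn)
    refine ⟨Polynomial.monomial m (a.coeff (d - 2 * m)), ?_⟩
    rw [Polynomial.aeval_monomial, ← Algebra.smul_def, LaurentPolynomial.T_pow, mul_smul_comm,
      ← qpow_add]
    congr 2
    lia

/-- The part of positive degree of a Laurent polynomial. -/
def posPart (a : A) : A := AddMonoidAlgebra.ofCoeff (a.coeff.filter (0 < ·))

theorem coeff_posPart (a : A) (n : ℤ) :
    (posPart a).coeff n = if 0 < n then a.coeff n else 0 := by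
  rw [posPart, AddMonoidAlgebra.coeff_ofCoeff, Finsupp.filter_apply]

theorem inQZq_posPart (a : A) : InQZq (posPart a) := by
  rw [inQZq_iff]
  intro n hn
  rw [coeff_posPart, if_neg (by lia)]

theorem InEven.posPart {d : ℤ} {a : A} (h : InEven d a) : InEven d (posPart a) := by
  rw [inEven_iff] at h ⊢
  intro n hn
  rw [coeff_posPart] at hn
  exact h n fun h' => hn (by simp [h'])

@[simp] theorem posPart_zero : posPart 0 = 0 := by
  ext n; rw [coeff_posPart]; simp

/-- A Laurent polynomial that changes sign under `q ↦ q⁻¹` is determined by its part of positive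
degree. -/
theorem posPart_sub_invert_posPart {a : A} (h : LaurentPolynomial.invert a = -a) :
    posPart a - LaurentPolynomial.invert (posPart a) = a := by
  ext n
  have h1 : a.coeff (-n) = - a.coeff n := by
    rw [← LaurentPolynomial.invert_apply, h]; simp
  rw [AddMonoidAlgebra.coeff_sub, Finsupp.sub_apply, LaurentPolynomial.invert_apply,
    coeff_posPart, coeff_posPart]
  rcases lt_trichotomy n 0 with hn | rfl | hn
  · rw [if_neg (by lia), if_pos (by lia), h1]; simp
  · simp at h1 ⊢; lia
  · rw [if_pos hn, if_neg (by lia)]; simp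

end Laurent

/-! ### The bar involution and the Kazhdan–Lusztig basis -/

section KL

variable {ι K M N : Type*} [Field K]
  [AddCommGroup M] [Module K M] [AddCommGroup N] [Module K N] {P : RootPairing ι K M N}
  (b : P.Base)

theorem bar_gen_eq (k : b.support) :
    bar b (gen b k) = gen b k + algebraMap A _ (qpow 1 - qpow (-1)) := bar_gen b k

theorem bar_smul (a : A) (h : Hecke b) :
    bar b (a • h) = LaurentPolynomial.invert a • bar b h := by
  rw [Algebra.smul_def, map_mul, bar_algebraMap, ← Algebra.smul_def]

theorem bar_bar (h : Hecke b) : bar b (bar b h) = h := by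
  obtain ⟨x, rfl⟩ := exists_heckeMk b h
  induction x using FreeAlgebra.induction with
  | grade0 r =>
    rw [AlgHom.commutes, bar_algebraMap, bar_algebraMap, LaurentPolynomial.involutive_invert]
  | grade1 k =>
    change bar b (bar b (gen b k)) = gen b k
    rw [bar_gen_eq, map_add, bar_gen_eq, bar_algebraMap]
    simp only [map_sub, LaurentPolynomial.invert_T, neg_neg]
    abel
  | mul x y hx hy => rw [map_mul, map_mul, map_mul, hx, hy]
  | add x y hx hy => rw [map_add, map_add, map_add, hx, hy]

/-- The element `H_k - q⁻¹` is invariant under the bar involution. -/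
theorem bar_gen_sub (k : b.support) :
    bar b (gen b k - algebraMap A _ (qpow (-1))) = gen b k - algebraMap A _ (qpow (-1)) := by
  rw [map_sub, bar_gen_eq, bar_algebraMap, LaurentPolynomial.invert_T, neg_neg, map_sub]
  abel

variable [Finite ι] [CharZero K] [P.IsCrystallographic] [P.IsReduced] [P.IsRootSystem]

/-- `h` lies in `H_w + ∑_{y < w} A H_y`, and its coefficients have the degrees and the parity of
those of a Kazhdan–Lusztig element. -/
structure Tri (w : P.weylGroup) (h : Hecke b) : Prop where
  coord_self : coord b w h = 1
  lt : ∀ y, y ≠ w → coord b y h ≠ 0 → bruhatLT b y w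
  even : ∀ y, InEven ((length b w : ℤ) - length b y) (coord b y h)

variable {b}

theorem tri_one : Tri b 1 (1 : Hecke b) := by
  classical
  rw [← heckeH_one b]
  refine ⟨by rw [coord_heckeH, if_pos rfl],
    fun y hy h => absurd (by rw [coord_heckeH, if_neg hy]) h, fun y => ?_⟩
  rw [coord_heckeH]
  split_ifs with h
  · rw [h, sub_self]; exact inEven_one
  · exact InEven.zero _

/-- Triangularity is preserved by right multiplication with `H_k + c` when it raises the length. -/
theorem Tri.mul_gen_add {w : P.weylGroup} {h : Hecke b} (H : Tri b w h) {k : b.support}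
    (hk : length b w < length b (w * simpleRefl b k)) {c : A} (hc : InEven 1 c) :
    Tri b (w * simpleRefl b k) (h * (gen b k + algebraMap A _ c)) := by
  have hw := length_mul_simpleRefl b w k
  have key : ∀ y, coord b y (h * (gen b k + algebraMap A _ c)) =
      coord b (y * simpleRefl b k) h +
        ((if length b (y * simpleRefl b k) < length b y then qpow (-1) - qpow 1 else 0) + c) *
        coord b y h := by
    intro y
    rw [mul_add, map_add, coord_mul_gen, ← Algebra.commutes, ← Algebra.smul_def, map_smul,
      smul_eq_mul]
    ring
  have hle : bruhatLT b w (w * simpleRefl b k) := (bruhatStep_mul_simpleRefl hk).lt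
  have hs : coord b (w * simpleRefl b k) h = 0 := by
    by_contra h1
    have := (H.lt _ (fun e => by rw [e] at hk; exact lt_irrefl _ hk) h1).length_lt
    lia
  refine ⟨?_, fun y hy h1 => ?_, fun y => ?_⟩
  · rw [key, mul_simpleRefl_mul_simpleRefl, H.coord_self, hs]; simp
  · rw [key] at h1
    by_cases h2 : coord b y h = 0
    · rw [h2, mul_zero, add_zero] at h1
      have hne : y * simpleRefl b k ≠ w := by
        rintro rfl; simp at hy
      rcases (H.lt _ hne h1).mul_simpleRefl k with h3 | h3
      · simpa using h3
      · rw [mul_simpleRefl_mul_simpleRefl] at h3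
        exact h3.trans_lt hle
    · by_cases h3 : y = w
      · rw [h3]; exact hle
      · exact (H.lt y h3 h2).trans hle
  · rw [key]
    refine InEven.add ?_ ?_
    · have h1 := H.even (y * simpleRefl b k)
      rcases length_mul_simpleRefl b y k with h2 | h2
      · convert h1.add_two using 1; lia
      · convert h1 using 1; lia
    · have h1 := H.even y
      have h2 : InEven 1
          ((if length b (y * simpleRefl b k) < length b y then qpow (-1) - qpow 1 else 0) + c) := by
        refine InEven.add ?_ hc
        split_ifs
        · exact inEven_qpow_neg_one.sub (inEven_qpow 1)
        · exact InEven.zero _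
      convert h2.mul h1 using 1; lia

variable (b) in
/-- The bar involution is unitriangular with respect to the standard basis. -/
theorem tri_bar_heckeH (w : P.weylGroup) : Tri b w (bar b (heckeH b w)) := by
  obtain ⟨l, rfl, hl⟩ := exists_reduced b w
  induction l using List.reverseRecOn with
  | nil => simpa using tri_one
  | append_singleton l k ih =>
    have h1 := length_wordProd_le b l
    have h2 := length_mul_simpleRefl b (wordProd b l) k
    have e : wordProd b (l ++ [k]) = wordProd b l * simpleRefl b k := by simp
    rw [e, List.length_append, List.length_singleton] at hl
    have h3 : length b (wordProd b l) < length b (wordProd b l * simpleRefl b k) := by lia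
    rw [e, ← heckeH_mul_gen_of_lt b h3, map_mul, bar_gen_eq]
    exact (ih (by lia)).mul_gen_add h3 ((inEven_qpow 1).sub inEven_qpow_neg_one)

theorem bar_eq_sum (h : Hecke b) :
    bar b h = ∑ w, LaurentPolynomial.invert (coord b w h) • bar b (heckeH b w) := by
  conv_lhs => rw [hecke_sum h, map_sum]
  simp only [bar_smul]

/-- A bar invariant element vanishes as soon as each of its nonzero coefficients lies in `q ℤ[q]`
or belongs to an element that is not the longest one with a nonzero coefficient. -/
theorem eq_zero_of_bar_eq {x : Hecke b} (hx : bar b x = x)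
    (h : ∀ y, coord b y x ≠ 0 →
      InQZq (coord b y x) ∨ ∃ z, length b y < length b z ∧ coord b z x ≠ 0) : x = 0 := by
  classical
  by_contra hne
  have hex : ∃ y, coord b y x ≠ 0 := by
    by_contra hall
    push Not at hall
    exact hne (hecke_ext fun w => by rw [hall w, map_zero])
  obtain ⟨y, hy, hmax⟩ := Set.exists_max_image {y | coord b y x ≠ 0} (length b)
    (Set.toFinite _) hex
  have hq : InQZq (coord b y x) := by
    rcases h y hy with h1 | ⟨z, h1, h2⟩
    · exact h1
    · exact absurd (hmax z h2) h1.not_ge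
  apply hy
  refine hq.eq_zero_of_invert ?_
  conv_rhs => rw [← hx, bar_eq_sum, map_sum]
  rw [Finset.sum_eq_single y]
  · rw [map_smul, (tri_bar_heckeH b y).coord_self, smul_eq_mul, mul_one]
  · intro z _ hz
    by_cases h1 : coord b z x = 0
    · simp [h1]
    · by_cases h2 : coord b y (bar b (heckeH b z)) = 0
      · simp [h2]
      · exact absurd ((tri_bar_heckeH b z).lt y hz.symm h2).length_lt (hmax z h1).not_gt
  · simp

theorem coord_sum_smul' (r : P.weylGroup → A) (C : P.weylGroup → Hecke b) (z : P.weylGroup) :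
    coord b z (∑ y, r y • C y) = ∑ y, r y * coord b z (C y) := by
  simp

/-- Expansion with respect to a unitriangular family, by induction on the length of the longest
element with a nonzero coefficient. -/
theorem exists_expansion {C : P.weylGroup → Hecke b} {w : P.weylGroup}
    (hC : ∀ y, bruhatLT b y w → Tri b y (C y)) (h : Hecke b)
    (h1 : ∀ y, coord b y h ≠ 0 → bruhatLT b y w)
    (h2 : ∀ y, InEven ((length b w : ℤ) - length b y) (coord b y h)) :
    ∃ r : P.weylGroup → A, h = ∑ y, r y • C y ∧ (∀ y, r y ≠ 0 → bruhatLT b y w) ∧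
      ∀ y, InEven ((length b w : ℤ) - length b y) (r y) := by
  classical
  suffices H : ∀ m : ℕ, ∀ h : Hecke b, (∀ y, coord b y h ≠ 0 → bruhatLT b y w ∧ length b y < m) →
      (∀ y, InEven ((length b w : ℤ) - length b y) (coord b y h)) →
      ∃ r : P.weylGroup → A, h = ∑ y, r y • C y ∧ (∀ y, r y ≠ 0 → bruhatLT b y w) ∧
        ∀ y, InEven ((length b w : ℤ) - length b y) (r y) from
    H (length b w) h (fun y hy => ⟨h1 y hy, (h1 y hy).length_lt⟩) h2
  intro m
  induction m with
  | zero =>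
    intro h h1 _
    refine ⟨0, hecke_ext fun y => ?_, by simp, fun y => InEven.zero _⟩
    by_contra h3
    exact absurd (h1 y (by simpa using h3)).2 (by lia)
  | succ m ih =>
    intro h h1 h2
    set t : P.weylGroup → A := fun y => if length b y = m then coord b y h else 0 with ht
    have ht1 : ∀ y, t y ≠ 0 → length b y = m ∧ bruhatLT b y w := by
      intro y hy
      simp only [ht, ne_eq, ite_eq_right_iff, Classical.not_imp] at hy
      exact ⟨hy.1, (h1 y hy.2).1⟩
    have ht2 : ∀ y, InEven ((length b w : ℤ) - length b y) (t y) := by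
      intro y
      simp only [ht]
      split_ifs
      · exact h2 y
      · exact InEven.zero _
    have hz0 : ∀ z y, z ≠ y → t y * coord b z (C y) ≠ 0 → bruhatLT b z y ∧ length b y = m ∧
        bruhatLT b y w := by
      intro z y hzy hne
      obtain ⟨h3, h4⟩ := ht1 y (left_ne_zero_of_mul hne)
      exact ⟨(hC y h4).lt z hzy (right_ne_zero_of_mul hne), h3, h4⟩
    have hA : ∀ z, coord b z (h - ∑ y, t y • C y) ≠ 0 → bruhatLT b z w ∧ length b z < m := by
      intro z hz
      rw [map_sub, coord_sum_smul'] at hz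
      by_cases hzm : m ≤ length b z
      · exfalso
        apply hz
        rw [Finset.sum_eq_single z]
        · by_cases h3 : length b z = m
          · by_cases h4 : coord b z h = 0
            · simp [ht, h3, h4]
            · rw [(hC z (h1 z h4).1).coord_self]
              simp [ht, h3]
          · have h4 : coord b z h = 0 := by
              by_contra h4
              have := (h1 z h4).2
              lia
            simp [ht, h3, h4]
        · intro y _ hy
          by_contra h3
          have h4 := hz0 z y hy.symm h3
          have := h4.1.length_lt
          lia
        · simp
      · refine ⟨?_, by lia⟩
        by_cases h3 : coord b z h = 0
        · rw [h3, zero_sub, neg_ne_zero] at hz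
          obtain ⟨y, -, hy⟩ := Finset.exists_ne_zero_of_sum_ne_zero hz
          by_cases h4 : z = y
          · rw [h4]; exact (ht1 y (left_ne_zero_of_mul hy)).2
          · have h5 := hz0 z y h4 hy
            exact h5.1.trans h5.2.2
        · exact (h1 z h3).1
    have hB : ∀ z, InEven ((length b w : ℤ) - length b z) (coord b z (h - ∑ y, t y • C y)) := by
      intro z
      rw [map_sub, coord_sum_smul']
      refine (h2 z).sub (InEven.sum _ _ fun y _ => ?_)
      by_cases h3 : t y = 0
      · rw [h3, zero_mul]; exact InEven.zero _
      · have h4 := (ht2 y).mul ((hC y (ht1 y h3).2).even z)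
        convert h4 using 1; lia
    obtain ⟨r, hr1, hr2, hr3⟩ := ih (h - ∑ y, t y • C y) hA hB
    refine ⟨fun y => r y + t y, ?_, fun y hy => ?_, fun y => (hr3 y).add (ht2 y)⟩
    · simp only [add_smul, Finset.sum_add_distrib]
      rw [← hr1]; abel
    · by_cases h3 : t y = 0
      · exact hr2 y (by simpa [h3] using hy)
      · exact (ht1 y h3).2

/-- Linear independence of a unitriangular family. -/
theorem eq_zero_of_sum_eq_zero {C : P.weylGroup → Hecke b} {r : P.weylGroup → A}
    (hC : ∀ y, r y ≠ 0 → Tri b y (C y)) (h : ∑ y, r y • C y = 0) : r = 0 := by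
  classical
  by_contra hne
  have hex : ∃ y, r y ≠ 0 := by
    by_contra hall
    push Not at hall
    exact hne (funext hall)
  obtain ⟨y, hy, hmax⟩ := Set.exists_max_image {y | r y ≠ 0} (length b) (Set.toFinite _) hex
  apply hy
  have h1 := congrArg (coord b y) h
  rw [coord_sum_smul', map_zero, Finset.sum_eq_single y] at h1
  · rwa [(hC y hy).coord_self, mul_one] at h1
  · intro z _ hz
    by_contra h2
    have h3 := left_ne_zero_of_mul h2
    exact absurd ((hC z h3).lt y hz.symm (right_ne_zero_of_mul h2)).length_lt (hmax z h3).not_gt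
  · simp

/-- Existence of the Kazhdan–Lusztig element. In `\overline{H_w} - H_w = ∑ r_y C_y` the coefficients
change sign under `q ↦ q⁻¹`, and adding the parts of positive degree of the `r_y` to `H_w` makes it
bar invariant. -/
theorem exists_kl (w : P.weylGroup) :
    ∃ c, bar b c = c ∧ Tri b w c ∧ ∀ y, y ≠ w → InQZq (coord b y c) := by
  classical
  generalize hn : length b w = n
  induction n using Nat.strong_induction_on generalizing w with
  | _ n ih =>
    choose! C hC1 hC2 hC3 using fun y : P.weylGroup => fun hy : length b y < n => ih _ hy y rfl
    have hT : ∀ y, bruhatLT b y w → length b y < n := fun y hy => hn ▸ hy.length_lt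
    have hw := tri_bar_heckeH b w
    -- the antisymmetric part of the bar involution, in terms of the shorter elements
    obtain ⟨r, hr1, hr2, hr3⟩ := exists_expansion (fun y hy => hC2 y (hT y hy))
      (bar b (heckeH b w) - heckeH b w) (fun y hy => by
        by_cases h : y = w
        · subst h; simp [hw.coord_self] at hy
        · refine hw.lt y h ?_
          simpa [h] using hy) (fun y => by
        rw [map_sub, coord_heckeH]
        refine (hw.even y).sub ?_
        split_ifs with h
        · rw [h, sub_self]; exact inEven_one
        · exact InEven.zero _)
    have hanti : ∀ y, LaurentPolynomial.invert (r y) = - r y := by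
      have h1 : ∑ y, (LaurentPolynomial.invert (r y) + r y) • C y = 0 := by
        have h2 : bar b (∑ y, r y • C y) = ∑ y, LaurentPolynomial.invert (r y) • C y := by
          rw [map_sum]
          refine Finset.sum_congr rfl fun y _ => ?_
          rw [bar_smul]
          by_cases h : r y = 0
          · simp [h]
          · rw [hC1 y (hT y (hr2 y h))]
        simp only [add_smul, Finset.sum_add_distrib]
        rw [← h2, ← hr1, map_sub, bar_bar]
        abel
      have h2 := eq_zero_of_sum_eq_zero (fun y hy => hC2 y (hT y (hr2 y fun h => hy (by simp [h]))))
        h1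
      intro y
      exact eq_neg_of_add_eq_zero_left (congrFun h2 y)
    have hf : ∀ y, posPart (r y) ≠ 0 → bruhatLT b y w := fun y hy =>
      hr2 y fun h => hy (by simp [h])
    have hcoord : ∀ z, coord b z (heckeH b w + ∑ y, posPart (r y) • C y) =
        (if z = w then 1 else 0) + ∑ y, posPart (r y) * coord b z (C y) := by
      intro z
      rw [map_add, coord_sum_smul', coord_heckeH]
    have hterm : ∀ z y, posPart (r y) * coord b z (C y) ≠ 0 → bruhatLT b z w := by
      intro z y h
      have h1 := hf y (left_ne_zero_of_mul h)
      by_cases h2 : z = y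
      · rwa [h2]
      · exact ((hC2 y (hT y h1)).lt z h2 (right_ne_zero_of_mul h)).trans h1
    refine ⟨heckeH b w + ∑ y, posPart (r y) • C y, ?_, ⟨?_, ?_, ?_⟩, ?_⟩
    · have h1 : bar b (∑ y, posPart (r y) • C y) =
          ∑ y, posPart (r y) • C y - ∑ y, r y • C y := by
        rw [map_sum, ← Finset.sum_sub_distrib]
        refine Finset.sum_congr rfl fun y _ => ?_
        rw [bar_smul, ← sub_smul]
        by_cases h : r y = 0
        · simp [h]
        · rw [hC1 y (hT y (hr2 y h))]
          congr 1
          rw [eq_sub_iff_add_eq, add_comm, ← eq_sub_iff_add_eq]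
          exact (posPart_sub_invert_posPart (hanti y)).symm
      rw [map_add, h1, ← hr1]
      abel
    · rw [hcoord, if_pos rfl, Finset.sum_eq_zero, add_zero]
      intro y _
      by_contra h
      exact (hterm w y h).ne rfl
    · intro z hz h
      rw [hcoord, if_neg hz, zero_add] at h
      obtain ⟨y, -, hy⟩ := Finset.exists_ne_zero_of_sum_ne_zero h
      exact hterm z y hy
    · intro z
      rw [hcoord]
      refine InEven.add ?_ (InEven.sum _ _ fun y _ => ?_)
      · split_ifs with h
        · rw [h, sub_self]; exact inEven_one
        · exact InEven.zero _
      · by_cases h3 : r y = 0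
        · rw [h3, posPart_zero, zero_mul]; exact InEven.zero _
        · have h4 := (hr3 y).posPart.mul ((hC2 y (hT y (hr2 y h3))).even z)
          convert h4 using 1; lia
    · intro z hz
      rw [hcoord, if_neg hz, zero_add]
      refine InQZq.sum _ _ fun y _ => ?_
      by_cases h3 : r y = 0
      · rw [h3, posPart_zero, zero_mul]; exact InQZq.zero
      · have hy := hT y (hr2 y h3)
        by_cases h4 : z = y
        · rw [h4, (hC2 y hy).coord_self, mul_one]; exact inQZq_posPart _
        · exact (inQZq_posPart _).mul (hC3 y hy z h4)

end KL

section KL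

variable {ι K M N : Type*} [Field K]
  [AddCommGroup M] [Module K M] [AddCommGroup N] [Module K N] {P : RootPairing ι K M N}
  {b : P.Base}

/-! ### Eigenvectors of the generators -/

/-- The eigenvector equation for a generator, in terms of coefficients; `σ` is the left or right
multiplication by a simple reflection. -/
theorem forall_coord_iff (a : P.weylGroup → A) (σ : P.weylGroup → P.weylGroup)
    (hσ : ∀ y, σ (σ y) = y)
    (hl : ∀ y, length b (σ y) = length b y + 1 ∨ length b (σ y) + 1 = length b y) :
    (∀ y, a (σ y) + (if length b (σ y) < length b y then qpow (-1) - qpow 1 else 0) * a y =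
      qpow (-1) * a y) ↔
    ∀ y, qpow (length b (σ y)) * a (σ y) = qpow (length b y) * a y := by
  have hq : qpow 1 * qpow (-1) = 1 := qpow_mul_neg 1
  have hunit : ∀ n : ℤ, ∀ x y : A, qpow n * x = qpow n * y → x = y := by
    intro n x y h
    have := congrArg (qpow (-n) * ·) h
    simpa only [← mul_assoc, ← qpow_add, neg_add_cancel, qpow_zero, one_mul] using this
  constructor
  · intro h y
    have key : ∀ y, length b (σ y) + 1 = length b y →
        qpow (length b (σ y)) * a (σ y) = qpow (length b y) * a y := by
      intro y hy
      have h1 := h y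
      rw [if_pos (by lia)] at h1
      rw [← hy, Nat.cast_add, qpow_add, Nat.cast_one]
      linear_combination qpow (length b (σ y)) * h1
    rcases hl y with h1 | h1
    · have := key (σ y) (by rw [hσ]; lia)
      rw [hσ] at this
      exact this.symm
    · exact key y h1
  · intro h y
    have h1 := h y
    rcases hl y with h2 | h2
    · rw [if_neg (by lia), zero_mul, add_zero]
      rw [h2, Nat.cast_add, qpow_add, Nat.cast_one, mul_assoc] at h1
      have h3 := hunit _ _ _ h1
      linear_combination qpow (-1) * h3 - a (σ y) * hq
    · rw [if_pos (by lia)]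
      rw [← h2, Nat.cast_add, qpow_add, Nat.cast_one, mul_assoc] at h1
      have h3 := hunit _ _ _ h1
      linear_combination h3

/-- The elements `h` with `H_k h = q⁻¹ h` for `k ∈ I` and `h H_k = q⁻¹ h` for `k ∈ J`, i.e. the
elements of `x_I ℋ ∩ ℋ x_J`. -/
def biInv (I J : Set b.support) : Submodule A (Hecke b) where
  carrier := {h | (∀ k ∈ I, gen b k * h = qpow (-1) • h) ∧ ∀ k ∈ J, h * gen b k = qpow (-1) • h}
  zero_mem' := by simp
  add_mem' := by
    rintro x y ⟨h1, h2⟩ ⟨h3, h4⟩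
    exact ⟨fun k hk => by rw [mul_add, h1 k hk, h3 k hk, smul_add],
      fun k hk => by rw [add_mul, h2 k hk, h4 k hk, smul_add]⟩
  smul_mem' := by
    rintro a x ⟨h1, h2⟩
    exact ⟨fun k hk => by rw [mul_smul_comm, h1 k hk, smul_comm],
      fun k hk => by rw [smul_mul_assoc, h2 k hk, smul_comm]⟩

theorem mem_biInv {I J : Set b.support} {h : Hecke b} :
    h ∈ biInv I J ↔ (∀ k ∈ I, gen b k * h = qpow (-1) • h) ∧
      ∀ k ∈ J, h * gen b k = qpow (-1) • h := Iff.rfl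

theorem bar_mem_biInv {I J : Set b.support} {h : Hecke b} (hh : h ∈ biInv I J) :
    bar b h ∈ biInv I J := by
  rw [mem_biInv] at hh ⊢
  constructor
  · intro k hk
    have h1 := hh.1 k hk
    rw [Algebra.smul_def, ← sub_eq_zero, ← sub_mul] at h1
    have h2 := congrArg (bar b) h1
    rw [map_mul, bar_gen_sub, map_zero, sub_mul, sub_eq_zero] at h2
    rw [h2, Algebra.smul_def]
  · intro k hk
    have h1 := hh.2 k hk
    rw [Algebra.smul_def, Algebra.commutes, ← sub_eq_zero, ← mul_sub] at h1
    have h2 := congrArg (bar b) h1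
    rw [map_mul, bar_gen_sub, map_zero, mul_sub, sub_eq_zero] at h2
    rw [h2, Algebra.smul_def, Algebra.commutes]

/-! ### Kazhdan–Lusztig elements and polynomials -/

variable [Finite ι] [CharZero K] [P.IsCrystallographic] [P.IsReduced] [P.IsRootSystem]

theorem isKLElement_iff {w : P.weylGroup} {c : Hecke b} :
    IsKLElement b w c ↔ bar b c = c ∧ coord b w c = 1 ∧
      ∀ y, y ≠ w → InQZq (coord b y c) ∧ (coord b y c ≠ 0 → bruhatLT b y w) := by
  classical
  constructor
  · rintro ⟨h1, p, hp, hc⟩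
    have key : ∀ z, coord b z c = (if z = w then 1 else 0) +
        if bruhatLT b z w then p z else 0 := by
      intro z
      have : ∑ y : P.weylGroup with bruhatLT b y w, p y • heckeH b y =
          ∑ y, (if bruhatLT b y w then p y else 0) • heckeH b y := by
        rw [Finset.sum_filter]
        exact Finset.sum_congr rfl fun y _ => by split_ifs <;> simp
      rw [hc, map_add, coord_heckeH]
      congr 1
      rw [← coord_sum_smul (b := b) (fun y => if bruhatLT b y w then p y else 0) z, ← this]
    refine ⟨h1, ?_, fun y hy => ⟨?_, fun h => ?_⟩⟩
    · rw [key, if_pos rfl, if_neg (fun h => h.ne rfl), add_zero]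
    · rw [key, if_neg hy, zero_add]
      split_ifs
      · exact hp y
      · exact InQZq.zero
    · by_contra h2
      exact h (by rw [key, if_neg hy, if_neg h2, add_zero])
  · rintro ⟨h1, h2, h3⟩
    refine ⟨h1, fun y => if y = w then 0 else coord b y c, fun y => ?_, ?_⟩
    · dsimp only
      split_ifs with h
      · exact InQZq.zero
      · exact (h3 y h).1
    · refine hecke_ext fun z => ?_
      rw [map_add, coord_heckeH, map_sum]
      simp only [map_smul, coord_heckeH, smul_eq_mul, mul_ite, mul_one, mul_zero]
      rw [Finset.sum_ite_eq]
      simp only [Finset.mem_filter, Finset.mem_univ, true_and]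
      by_cases h : z = w
      · subst h; simp [h2]
      · by_cases h4 : bruhatLT b z w
        · simp [h, h4]
        · have h5 : coord b z c = 0 := by
            by_contra h5
            exact h4 ((h3 z h).2 h5)
          simp [h, h4, h5]

/-- Uniqueness of the Kazhdan–Lusztig element. -/
theorem IsKLElement.unique {w : P.weylGroup} {c c' : Hecke b} (h : IsKLElement b w c)
    (h' : IsKLElement b w c') : c = c' := by
  rw [isKLElement_iff] at h h'
  rw [← sub_eq_zero]
  refine eq_zero_of_bar_eq (by rw [map_sub, h.1, h'.1]) fun y hy => Or.inl ?_
  rw [map_sub]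
  by_cases hyw : y = w
  · rw [hyw, h.2.1, h'.2.1, sub_self]; exact InQZq.zero
  · exact (h.2.2 y hyw).1.sub (h'.2.2 y hyw).1

theorem exists_isKLElement (w : P.weylGroup) : ∃ c, IsKLElement b w c ∧ Tri b w c := by
  obtain ⟨c, h1, h2, h3⟩ := exists_kl (b := b) w
  exact ⟨c, isKLElement_iff.2 ⟨h1, h2.coord_self, fun y hy => ⟨h3 y hy, h2.lt y hy⟩⟩, h2⟩

theorem isKLElement_klElement (w : P.weylGroup) : IsKLElement b w (klElement b w) :=
  Classical.epsilon_spec ((exists_isKLElement w).imp fun _ h => h.1)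

/-- The construction of `C_w` gives more than its definition: the parity of the degrees. -/
theorem tri_klElement (w : P.weylGroup) : Tri b w (klElement b w) := by
  obtain ⟨c, h1, h2⟩ := exists_isKLElement (b := b) w
  rwa [(isKLElement_klElement w).unique h1]

theorem klElement_eq {w : P.weylGroup} {c : Hecke b} (h : IsKLElement b w c) :
    klElement b w = c := (isKLElement_klElement w).unique h

theorem bar_klElement (w : P.weylGroup) : bar b (klElement b w) = klElement b w :=
  (isKLElement_klElement w).1

theorem inQZq_coord_klElement {y w : P.weylGroup} (h : y ≠ w) :
    InQZq (coord b y (klElement b w)) :=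
  ((isKLElement_iff.1 (isKLElement_klElement w)).2.2 y h).1

theorem coord_klElement_self (w : P.weylGroup) : coord b w (klElement b w) = 1 :=
  (tri_klElement w).coord_self

/-- A family of polynomials is the family of Kazhdan–Lusztig polynomials if and only if it gives
the coefficients of the Kazhdan–Lusztig elements. -/
theorem isKLFamily_iff {p : P.weylGroup → P.weylGroup → Polynomial ℤ} :
    IsKLFamily b p ↔ ∀ y w, coord b y (klElement b w) =
      qpow ((length b w : ℤ) - length b y) * Polynomial.aeval (qpow (-2)) (p y w) := by
  classical
  constructor
  · rintro ⟨h1, h2, h3, h4⟩ y w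
    rw [klElement_eq (isKLElement_iff.2 ⟨h4 w, ?_, fun z hz => ?_⟩), coord_sum_smul]
    · rw [coord_sum_smul, h1]; simp
    · rw [coord_sum_smul]
      by_cases hlt : bruhatLT b z w
      · refine ⟨inQZq_iff.2 fun n hn => ?_, fun _ => hlt⟩
        by_contra h5
        obtain ⟨m, rfl⟩ := exists_of_coeff_aeval_ne_zero h5
        rw [coeff_aeval] at h5
        have := Polynomial.le_natDegree_of_ne_zero h5
        have := h3 z w hlt
        lia
      · rw [h2 z w hz hlt, map_zero, mul_zero]
        exact ⟨InQZq.zero, fun h => absurd rfl h⟩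
  · intro h
    refine ⟨fun w => ?_, fun y w hy hlt => ?_, fun y w hlt => ?_, fun w => ?_⟩
    · refine aeval_inj (d := (length b w : ℤ) - length b w) ?_
      rw [← h w w, coord_klElement_self]; simp
    · refine aeval_inj (d := (length b w : ℤ) - length b y) ?_
      rw [← h y w, map_zero, mul_zero]
      by_contra h1
      exact hlt ((tri_klElement w).lt y hy h1)
    · by_cases h0 : p y w = 0
      · have := hlt.length_lt
        rw [h0, Polynomial.natDegree_zero]; lia
      · have h1 := inQZq_iff.1 (inQZq_coord_klElement (b := b) hlt.ne)
        have h2 : (p y w).coeff (p y w).natDegree ≠ 0 := by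
          simpa using h0
        rw [← coeff_aeval _ ((length b w : ℤ) - length b y), ← h y w] at h2
        by_contra h3
        exact h2 (h1 _ (by lia))
    · have : klElement b w = ∑ y, (qpow ((length b w : ℤ) - length b y) *
          Polynomial.aeval (qpow (-2)) (p y w)) • heckeH b y := by
        conv_lhs => rw [hecke_sum (klElement b w)]
        exact Finset.sum_congr rfl fun y _ => by rw [h y w]
      rw [← this, bar_klElement]

theorem existsUnique_isKLFamily : ∃! p, IsKLFamily b p := by
  choose p hp using fun y w => (tri_klElement (b := b) w).even y
  refine ⟨p, isKLFamily_iff.2 hp, fun p' hp' => ?_⟩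
  funext y w
  exact aeval_inj ((isKLFamily_iff.1 hp' y w).symm.trans (hp y w))

theorem coord_klElement (y w : P.weylGroup) : coord b y (klElement b w) =
    qpow ((length b w : ℤ) - length b y) * Polynomial.aeval (qpow (-2)) (klPoly b y w) :=
  isKLFamily_iff.1 (Classical.epsilon_spec existsUnique_isKLFamily.exists) y w

/-- An element `D` whose coefficients are those of `C_w (H_k - q⁻¹)` or of `(H_k - q⁻¹) C_w`, where
`σ` is the right or left multiplication by `s_k`, vanishes if it is bar invariant and `k` is a
descent of `w`. -/
theorem eq_zero_of_descent {w : P.weylGroup} {D : Hecke b} (hD : bar b D = D)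
    (σ : P.weylGroup → P.weylGroup) (hσ : ∀ y, σ (σ y) = y)
    (hl : ∀ y, length b (σ y) = length b y + 1 ∨ length b (σ y) + 1 = length b y)
    (hw : length b (σ w) < length b w)
    (h : ∀ y, coord b y D = coord b (σ y) (klElement b w) +
      (if length b (σ y) < length b y then qpow (-1) - qpow 1 else 0) *
        coord b y (klElement b w) - qpow (-1) * coord b y (klElement b w)) : D = 0 := by
  have hq : qpow 1 * qpow (-1) = 1 := qpow_mul_neg 1
  refine eq_zero_of_bar_eq hD fun y hy => ?_
  by_cases hlt : length b (σ y) < length b y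
  · left
    have hne : σ y ≠ w := by
      rintro rfl
      rw [hσ] at hw
      exact absurd hw hlt.not_gt
    have e : coord b y D = coord b (σ y) (klElement b w) - qpow 1 * coord b y (klElement b w) := by
      rw [h, if_pos hlt]; ring
    rw [e]
    refine (inQZq_coord_klElement hne).sub ?_
    by_cases hyw : y = w
    · rw [hyw, coord_klElement_self, mul_one]; exact inQZq_qpow_one
    · exact inQZq_qpow_one.mul (inQZq_coord_klElement hyw)
  · right
    have hlt' : length b y < length b (σ y) := by have := hl y; lia
    refine ⟨σ y, hlt', fun h0 => hy ?_⟩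
    rw [h, hσ, if_pos hlt'] at h0
    rw [h, if_neg hlt]
    linear_combination (-qpow (-1)) * h0 - coord b (σ y) (klElement b w) * hq

/-- A right descent of `w` makes `C_w` an eigenvector of the generator. -/
theorem klElement_mul_gen {w : P.weylGroup} {k : b.support}
    (hw : length b (w * simpleRefl b k) < length b w) :
    klElement b w * gen b k = qpow (-1) • klElement b w := by
  have : klElement b w * (gen b k - algebraMap A _ (qpow (-1))) = 0 := by
    refine eq_zero_of_descent (w := w) ?_ (· * simpleRefl b k) (by simp)
      (fun y => length_mul_simpleRefl b y k) hw fun y => ?_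
    · rw [map_mul, bar_klElement, bar_gen_sub]
    · rw [mul_sub, map_sub, coord_mul_gen, ← Algebra.commutes, ← Algebra.smul_def, map_smul,
        smul_eq_mul]
  rwa [mul_sub, ← Algebra.commutes, ← Algebra.smul_def, sub_eq_zero] at this

theorem gen_mul_klElement {w : P.weylGroup} {k : b.support}
    (hw : length b (simpleRefl b k * w) < length b w) :
    gen b k * klElement b w = qpow (-1) • klElement b w := by
  have : (gen b k - algebraMap A _ (qpow (-1))) * klElement b w = 0 := by
    refine eq_zero_of_descent (w := w) ?_ (simpleRefl b k * ·) (by simp)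
      (fun y => length_simpleRefl_mul b y k) hw fun y => ?_
    · rw [map_mul, bar_klElement, bar_gen_sub]
    · rw [sub_mul, map_sub, coord_gen_mul, ← Algebra.smul_def, map_smul, smul_eq_mul]
  rwa [sub_mul, ← Algebra.smul_def, sub_eq_zero] at this

/-! ### Constant coefficients on double cosets -/

/-- The coefficient of `h` at `q^{-ℓ(y)} H_y`. -/
def normCoord (y : P.weylGroup) (h : Hecke b) : A := qpow (length b y) * coord b y h

theorem coord_eq_normCoord (y : P.weylGroup) (h : Hecke b) :
    coord b y h = qpow (-(length b y : ℤ)) * normCoord y h := by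
  rw [normCoord, ← mul_assoc, ← qpow_add]; simp

theorem hecke_ext_normCoord {h h' : Hecke b} (e : ∀ y, normCoord y h = normCoord y h') :
    h = h' := hecke_ext fun y => by rw [coord_eq_normCoord, e, ← coord_eq_normCoord]

theorem klElement_mem_biInv {I J : Set b.support} {w : P.weylGroup} (hw : AllDescent I J w) :
    klElement b w ∈ biInv I J :=
  ⟨fun k hk => gen_mul_klElement (hw.1 k hk), fun k hk => klElement_mul_gen (hw.2 k hk)⟩

/-- The elements of `x_I ℋ ∩ ℋ x_J` are those with constant normalized coefficients on the double
cosets of `W_I` and `W_J`. -/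
theorem mem_biInv_iff {I J : Set b.support} {h : Hecke b} :
    h ∈ biInv I J ↔ ∀ z, ∀ y ∈ dcoset I J z, normCoord y h = normCoord z h := by
  have h1 : ∀ k, gen b k * h = qpow (-1) • h ↔
      ∀ y, normCoord (simpleRefl b k * y) h = normCoord y h := by
    intro k
    refine Iff.trans ?_ (forall_coord_iff (coord b · h) (simpleRefl b k * ·) (by simp)
      (fun y => length_simpleRefl_mul b y k))
    constructor
    · intro e y
      rw [← coord_gen_mul, e, map_smul, smul_eq_mul]
    · intro e
      refine hecke_ext fun y => ?_
      rw [coord_gen_mul, e, map_smul, smul_eq_mul]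
  have h2 : ∀ k, h * gen b k = qpow (-1) • h ↔
      ∀ y, normCoord (y * simpleRefl b k) h = normCoord y h := by
    intro k
    refine Iff.trans ?_ (forall_coord_iff (coord b · h) (· * simpleRefl b k) (by simp)
      (fun y => length_mul_simpleRefl b y k))
    constructor
    · intro e y
      rw [← coord_mul_gen, e, map_smul, smul_eq_mul]
    · intro e
      refine hecke_ext fun y => ?_
      rw [coord_mul_gen, e, map_smul, smul_eq_mul]
  rw [mem_biInv]
  simp only [h1, h2]
  constructor
  · rintro ⟨h3, h4⟩ z y hy
    exact dcoset_induction (Q := fun y => normCoord y h = normCoord z h) rfl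
      (fun k hk w hw => by rw [h3 k hk, hw]) (fun k hk w hw => by rw [h4 k hk, hw]) hy
  · intro h3
    exact ⟨fun k hk y => h3 y _ (simpleRefl_mul_mem_dcoset hk (mem_dcoset_self y)),
      fun k hk y => h3 y _ (mul_simpleRefl_mem_dcoset hk (mem_dcoset_self y))⟩

open Classical in
theorem normCoord_heckeSum (Y : Set P.weylGroup) (y : P.weylGroup) :
    normCoord y (heckeSum b Y) = if y ∈ Y then 1 else 0 := by
  rw [normCoord, heckeSum, Finset.sum_filter]
  have : ∑ w, (if w ∈ Y then qpow (-(length b w : ℤ)) • heckeH b w else 0) =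
      ∑ w, (if w ∈ Y then qpow (-(length b w : ℤ)) else 0) • heckeH b w :=
    Finset.sum_congr rfl fun w _ => by split_ifs <;> simp
  rw [this, coord_sum_smul, mul_ite, mul_zero, qpow_mul_neg]

theorem normCoord_smul (a : A) (y : P.weylGroup) (h : Hecke b) :
    normCoord y (a • h) = a * normCoord y h := by
  rw [normCoord, normCoord, map_smul, smul_eq_mul]; ring

theorem heckeSum_dcoset_mem_biInv (I J : Set b.support) (z : P.weylGroup) :
    heckeSum b (dcoset I J z) ∈ biInv I J := by
  classical
  rw [mem_biInv_iff]
  intro w y hy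
  rw [normCoord_heckeSum, normCoord_heckeSum]
  have : y ∈ dcoset I J z ↔ w ∈ dcoset I J z := by
    constructor <;> intro h
    · rw [← dcoset_eq h]; exact mem_dcoset_comm hy
    · rw [← dcoset_eq h]; exact hy
  simp only [this]

/-- The normalized coefficients of the Kazhdan–Lusztig element of the longest element of a double
coset are constant on all double cosets. -/
theorem normCoord_klElement_of_mem {I J : Set b.support} {w y z : P.weylGroup}
    (hw : AllDescent I J w) (hy : y ∈ dcoset I J z) :
    normCoord y (klElement b w) = normCoord z (klElement b w) :=
  mem_biInv_iff.1 (klElement_mem_biInv hw) z y hy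

/-- The `q`-symmetrizer of `W_J` is the Kazhdan–Lusztig element of the longest element of `W_J`: the
latter has constant normalized coefficients on `W_J`, and none outside, since everything below `W_J`
in the Bruhat order belongs to `W_J`. -/
theorem symmetrizer_eq_klElement (J : Set b.support) :
    symmetrizer b J = klElement b (longest b (parabolic b J : Set P.weylGroup)) := by
  classical
  have hw : AllDescent J J (longest b (parabolic b J : Set P.weylGroup)) := by
    rw [coe_parabolic_eq_dcoset]; exact allDescent_longest 1
  have hmem : longest b (parabolic b J : Set P.weylGroup) ∈ dcoset J J 1 := by
    rw [coe_parabolic_eq_dcoset]; exact longest_dcoset_mem 1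
  set w := longest b (parabolic b J : Set P.weylGroup) with hw'
  refine hecke_ext_normCoord fun y => ?_
  rw [symmetrizer, normCoord_smul, normCoord_heckeSum, coe_parabolic_eq_dcoset]
  by_cases hy : y ∈ dcoset J J 1
  · rw [if_pos hy, mul_one, normCoord_klElement_of_mem hw hy,
      ← normCoord_klElement_of_mem hw hmem, normCoord, coord_klElement_self, mul_one,
      ← coe_parabolic_eq_dcoset]
  · rw [if_neg hy, mul_zero]
    by_contra h
    have hne : coord b y (klElement b w) ≠ 0 := fun h0 => h (by rw [normCoord, h0, mul_zero])
    have hlt := (tri_klElement w).lt y (fun e => hy (e ▸ hmem)) hne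
    obtain ⟨g, hg1, hg2⟩ := exists_noDescent J J y
    have h1 : NoDescent J J (1 : P.weylGroup) := by
      constructor <;> intro k _
      · have := length_simpleRefl_mul b (1 : P.weylGroup) k
        rw [length_one] at *; lia
      · have := length_mul_simpleRefl b (1 : P.weylGroup) k
        rw [length_one] at *; lia
    have h2 := (hg2.le_of_le h1 (mem_dcoset_comm hg1) hmem hlt.le).length_le
    rw [length_one, Nat.le_zero] at h2
    rw [eq_one_of_length_eq_zero b h2] at hg1
    exact hy (mem_dcoset_comm hg1)

end KL

/-! ### Positive coroots and half the sum of the positive roots -/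

section Positive

variable {ι K M N : Type*} [Field K]
  [AddCommGroup M] [Module K M] [AddCommGroup N] [Module K N] {P : RootPairing ι K M N}
  (b : P.Base) [Finite ι] [CharZero K] [P.IsCrystallographic] [P.IsReduced]

/-- A positive coroot is a sum of simple coroots, by induction on the height of the root. -/
theorem coroot_mem_closure {i : ι} (hi : b.IsPos i) :
    P.coroot i ∈ AddSubmonoid.closure (P.coroot '' (b.support : Set ι)) := by
  generalize hn : (b.height i).toNat = n
  induction n using Nat.strong_induction_on generalizing i with
  | _ n ih =>
    obtain ⟨j, hj, hji⟩ := hi.exists_mem_support_pos_pairingIn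
    have hj' : P.coroot j ∈ AddSubmonoid.closure (P.coroot '' (b.support : Set ι)) :=
      AddSubmonoid.subset_closure ⟨j, hj, rfl⟩
    by_cases hij : i = j
    · rwa [hij]
    · have hpos := hi.reflectionPerm hj hij
      have hroot : P.root (P.reflectionPerm j i) =
          P.root i + (-P.pairingIn ℤ i j) • P.root j := by
        rw [P.root_reflectionPerm, neg_smul, P.reflection_apply_root' ℤ, sub_eq_add_neg]
      have hcoroot : P.coroot i = P.coroot (P.reflectionPerm j i) +
          (P.pairingIn ℤ j i).toNat • P.coroot j := by
        rw [P.coroot_reflectionPerm, P.coreflection_apply_coroot,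
          ← P.algebraMap_pairingIn ℤ j i, ← natCast_zsmul, Int.toNat_of_nonneg hji.le,
          eq_intCast, Int.cast_smul_eq_zsmul, sub_add_cancel]
      have hlt : (b.height (P.reflectionPerm j i)).toNat < n := by
        have h1 := b.height_add_zsmul hroot
        rw [Base.height_one_of_mem_support hj] at h1
        have h2 : 0 < P.pairingIn ℤ i j := by
          rwa [P.zero_lt_pairingIn_iff']
        have h3 := Base.isPos_iff (b := b).1 hi
        simp only [smul_eq_mul, mul_one] at h1
        lia
      rw [hcoroot]
      exact add_mem (ih _ hlt hpos rfl) (nsmul_mem hj' _)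

/-- A simple reflection permutes the positive roots other than its own root. -/
theorem sum_isPos_reflectionPerm {V : Type*} [AddCommGroup V] [Fintype ι] [DecidablePred b.IsPos]
    (f : ι → V) (k : b.support) :
    ∑ i with b.IsPos i, f (P.reflectionPerm k i) + f k =
      ∑ i with b.IsPos i, f i + f (P.reflectionPerm k k) := by
  classical
  have hk : (k : ι) ∈ Finset.univ.filter b.IsPos := by
    simpa using Base.isPos_of_mem_support k.2
  rw [← Finset.add_sum_erase _ _ hk, ← Finset.add_sum_erase _ (fun i => f i) hk]
  have : ∑ i ∈ (Finset.univ.filter b.IsPos).erase k, f (P.reflectionPerm k i) =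
      ∑ i ∈ (Finset.univ.filter b.IsPos).erase k, f i := by
    have hmem : ∀ i ∈ (Finset.univ.filter b.IsPos).erase (k : ι),
        P.reflectionPerm k i ∈ (Finset.univ.filter b.IsPos).erase (k : ι) := by
      intro i hi
      simp only [Finset.mem_erase, Finset.mem_filter, Finset.mem_univ, true_and] at hi ⊢
      refine ⟨fun h => ?_, hi.2.reflectionPerm k.2 hi.1⟩
      have h1 : i = P.reflectionPerm k k := by
        simpa using congrArg (P.reflectionPerm k) h
      rw [h1, isPos_neg_iff] at hi
      exact hi.2 (Base.isPos_of_mem_support k.2)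
    exact Finset.sum_nbij' (P.reflectionPerm k) (P.reflectionPerm k) hmem hmem
      (fun i _ => by simp) (fun i _ => by simp) (fun i _ => rfl)
  rw [this]
  abel

theorem pairing_rho (k : b.support) : P.toLinearMap (rho b) (P.coroot k) = 1 := by
  classical
  have := Fintype.ofFinite ι
  have hrho : rho b = (2 : K)⁻¹ • ∑ i with b.IsPos i, P.root i := by
    rw [rho]
    congr 1
    rw [finsum_mem_eq_finite_toFinset_sum _ (Set.toFinite _)]
    congr 1
    ext i; simp
  set S := ∑ i with b.IsPos i, P.root i with hS
  have h1 : P.reflection k S = S - (2 : K) • P.root k := by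
    have h2 := sum_isPos_reflectionPerm b P.root k
    rw [← hS] at h2
    have h3 : ∑ i with b.IsPos i, P.root (P.reflectionPerm k i) = P.reflection k S := by
      rw [hS, map_sum]
      exact Finset.sum_congr rfl fun i _ => P.root_reflectionPerm k i
    rw [h3, P.root_reflectionPerm, P.reflection_apply_self] at h2
    rw [eq_sub_of_add_eq h2, two_smul]
    abel
  rw [P.reflection_apply, sub_right_inj] at h1
  have h2 : P.toLinearMap S (P.coroot k) = 2 := smul_left_injective K (P.ne_zero k) h1
  rw [hrho, map_smul, LinearMap.smul_apply, h2]
  simp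

end Positive

/-! ### Orbits of weights -/

section Orbits

theorem eq_zero_of_natCast_eq_neg {K : Type*} [Field K] [CharZero K] {x : K} {n m : ℕ}
    (h : x = n) (h' : x = -(m : K)) : x = 0 := by
  have : ((n + m : ℕ) : K) = 0 := by
    push_cast
    rw [← h, h']; ring
  rw [Nat.cast_eq_zero] at this
  rw [h, Nat.cast_eq_zero]
  lia

variable {ι K M N : Type*} [Field K]
  [AddCommGroup M] [Module K M] [AddCommGroup N] [Module K N] {P : RootPairing ι K M N}
  {b : P.Base} [CharZero K]

namespace WeightSet

variable (X : WeightSet b)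

theorem act_act (i : X.Shifted) (w w' : P.weylGroup) :
    X.act (X.act i w) w' = X.act i (w * w') := by
  apply Subtype.ext
  change w'⁻¹ • w⁻¹ • (i : M) = (w * w')⁻¹ • (i : M)
  rw [mul_inv_rev, mul_smul]

@[simp] theorem act_one (i : X.Shifted) : X.act i 1 = i := by
  apply Subtype.ext
  change (1 : P.weylGroup)⁻¹ • (i : M) = i
  rw [inv_one, one_smul]

theorem pairing_act (i : X.Shifted) (w : P.weylGroup) (j : ι) :
    P.toLinearMap (X.act i w : M) (P.coroot j) =
      P.toLinearMap (i : M) (P.coroot (P.weylGroupToPerm w j)) := by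
  have h := pairing_smul w (w⁻¹ • (i : M)) j
  rw [smul_inv_smul] at h
  exact h.symm

theorem coe_act_simpleRefl (i : X.Shifted) (k : b.support) :
    (X.act i (simpleRefl b k) : M) = i - P.toLinearMap (i : M) (P.coroot k) • P.root k := by
  change (simpleRefl b k)⁻¹ • (i : M) = _
  rw [simpleRefl_inv, simpleRefl_eq, ofIdx_smul_eq]

theorem act_simpleRefl_eq_iff (i : X.Shifted) (k : b.support) :
    X.act i (simpleRefl b k) = i ↔ P.toLinearMap (i : M) (P.coroot k) = 0 := by
  rw [Subtype.ext_iff, coe_act_simpleRefl, sub_eq_self, smul_eq_zero_iff_left (P.ne_zero k)]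

theorem mem_stab_iff {γ : X.Anti} {k : b.support} :
    k ∈ X.stab γ ↔ P.toLinearMap (γ.1 : M) (P.coroot k) = 0 :=
  X.act_simpleRefl_eq_iff γ.1 k

theorem act_of_mem_stabGroup {γ : X.Anti} {u : P.weylGroup} (hu : u ∈ X.stabGroup γ) :
    X.act γ.1 u = γ.1 := by
  induction hu using Subgroup.closure_induction with
  | mem x hx =>
    obtain ⟨k, hk, rfl⟩ := hx
    exact hk
  | one => simp
  | mul x y _ _ hx hy => rw [← act_act, hx, hy]
  | inv x _ hx =>
    conv_lhs => rw [← hx]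
    rw [act_act, mul_inv_cancel, act_one]

/-- In the root order, `i s_k` lies above `i` if and only if `⟨i, α_k^∨⟩` is not positive. -/
theorem rootLE_act_simpleRefl_iff [P.IsRootSystem] [Finite ι] (i : X.Shifted) (k : b.support) :
    rootLE b (i : M) (X.act i (simpleRefl b k) : M) ↔
      ∃ n : ℕ, P.toLinearMap (i : M) (P.coroot k) = -(n : K) := by
  rw [rootLE, coe_act_simpleRefl]
  constructor
  · intro h
    have key : ∀ m ∈ AddSubmonoid.closure (P.root '' (b.support : Set ι)),
        ∃ n : ℕ, b.toWeightBasis.coord k m = n := by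
      intro m hm
      induction hm using AddSubmonoid.closure_induction with
      | mem x hx =>
        obtain ⟨j, hj, rfl⟩ := hx
        classical
        have := b.toWeightBasis_repr_root ⟨j, hj⟩
        rw [Module.Basis.coord_apply, this, Finsupp.single_apply]
        split_ifs
        exacts [⟨1, by simp⟩, ⟨0, by simp⟩]
      | zero => exact ⟨0, by simp⟩
      | add x y _ _ hx hy =>
        obtain ⟨n, hn⟩ := hx
        obtain ⟨m, hm⟩ := hy
        exact ⟨n + m, by rw [map_add, hn, hm]; push_cast; rfl⟩
    obtain ⟨n, hn⟩ := key _ h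
    refine ⟨n, ?_⟩
    rw [sub_sub_cancel_left, map_neg, map_smul, Module.Basis.coord_apply,
      b.toWeightBasis_repr_root] at hn
    rw [← hn]
    simp
  · rintro ⟨n, hn⟩
    rw [hn, sub_sub_cancel_left, neg_smul, neg_neg, Nat.cast_smul_eq_nsmul]
    exact nsmul_mem (AddSubmonoid.subset_closure (Set.mem_image_of_mem P.root k.2)) n

variable [Finite ι] [P.IsCrystallographic] [P.IsReduced]

theorem exists_int_pairing (i : X.Shifted) (j : ι) :
    ∃ n : ℤ, P.toLinearMap (i : M) (P.coroot j) = n := by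
  have hrho : ∃ n : ℤ, P.toLinearMap (rho b) (P.coroot j) = n := by
    have := b.coroot_mem_span_int j
    generalize P.coroot j = x at this ⊢
    induction this using Submodule.span_induction with
    | mem x hx =>
      obtain ⟨k, hk, rfl⟩ := hx
      have h1 := pairing_rho b (⟨k, hk⟩ : b.support)
      exact ⟨1, h1.trans (by simp)⟩
    | zero => exact ⟨0, by simp⟩
    | add x y _ _ hx hy =>
      obtain ⟨n, hn⟩ := hx
      obtain ⟨m, hm⟩ := hy
      exact ⟨n + m, by rw [map_add, hn, hm]; push_cast; rfl⟩
    | smul a x _ hx =>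
      obtain ⟨n, hn⟩ := hx
      exact ⟨a * n, by rw [map_zsmul, hn]; simp⟩
  obtain ⟨n, hn⟩ := X.integral _ i.2 j
  obtain ⟨m, hm⟩ := hrho
  refine ⟨n + m, ?_⟩
  rw [map_sub, LinearMap.sub_apply, sub_eq_iff_eq_add] at hn
  rw [hn, hm]; push_cast; rfl

/-- An anti-dominant weight pairs non-positively with all positive coroots. -/
theorem pairing_anti_of_isPos (γ : X.Anti) {i : ι} (hi : b.IsPos i) :
    ∃ n : ℕ, P.toLinearMap (γ.1 : M) (P.coroot i) = -(n : K) := by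
  have := coroot_mem_closure b hi
  generalize P.coroot i = x at this ⊢
  induction this using AddSubmonoid.closure_induction with
  | mem x hx =>
    obtain ⟨k, hk, rfl⟩ := hx
    exact γ.2 ⟨k, hk⟩
  | zero => exact ⟨0, by simp⟩
  | add x y _ _ hx hy =>
    obtain ⟨n, hn⟩ := hx
    obtain ⟨m, hm⟩ := hy
    exact ⟨n + m, by rw [map_add, hn, hm]; push_cast; ring⟩

theorem pairing_anti_of_not_isPos (γ : X.Anti) {i : ι} (hi : ¬ b.IsPos i) :
    ∃ n : ℕ, P.toLinearMap (γ.1 : M) (P.coroot i) = n := by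
  rw [← isPos_neg_iff] at hi
  obtain ⟨n, hn⟩ := X.pairing_anti_of_isPos γ hi
  rw [P.coroot_reflectionPerm, P.coreflection_apply_self, map_neg, neg_inj] at hn
  exact ⟨n, hn⟩

/-- Two anti-dominant weights in the same orbit coincide, and their stabilizer is generated by
simple reflections. If `γ w = γ'` and `s` is a left descent of `w`, then comparing signs of pairings
shows that `s` fixes `γ`, so that `s` can be removed from `w`. -/
theorem eq_of_act_eq {γ γ' : X.Anti} {w : P.weylGroup} (h : X.act γ.1 w = γ'.1) :
    γ = γ' ∧ w ∈ X.stabGroup γ := by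
  generalize hn : length b w = n
  induction n using Nat.strong_induction_on generalizing w with
  | _ n ih =>
    obtain ⟨l, rfl, hl⟩ := exists_reduced b w
    cases l with
    | nil => exact ⟨Subtype.ext (by simpa using h), one_mem _⟩
    | cons k l =>
      rw [wordProd_cons] at h hl hn ⊢
      set v := wordProd b l with hv
      have h0 : length b v ≤ l.length := length_wordProd_le b l
      rw [List.length_cons] at hl
      have h1 : ¬ length b (simpleRefl b k * v) <
          length b (simpleRefl b k * (simpleRefl b k * v)) := by
        rw [simpleRefl_mul_simpleRefl_mul]; lia
      rw [lt_length_simpleRefl_mul_iff] at h1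
      obtain ⟨n', hn'⟩ := X.pairing_anti_of_not_isPos γ' h1
      obtain ⟨m, hm⟩ := γ.2 k
      have e : P.toLinearMap (γ.1 : M) (P.coroot k) = P.toLinearMap (γ'.1 : M)
          (P.coroot (P.weylGroupToPerm (simpleRefl b k * v)⁻¹ k)) := by
        rw [← h, pairing_act, ← Equiv.Perm.mul_apply, ← map_mul, mul_inv_cancel, map_one]
        rfl
      have hk : k ∈ X.stab γ := X.mem_stab_iff.2 (eq_zero_of_natCast_eq_neg (e.trans hn') hm)
      have hk' : X.act γ.1 (simpleRefl b k) = γ.1 := hk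
      rw [← act_act, hk'] at h
      obtain ⟨h2, h3⟩ := ih (length b v) (by lia) h rfl
      exact ⟨h2, mul_mem (Subgroup.subset_closure ⟨k, hk, rfl⟩) h3⟩

/-- The label `(γ, w)` of a shifted weight is unique. -/
theorem minRight_act_inj {γ γ' : X.Anti} {w w' : P.weylGroup} (hw : w ∈ minRight b (X.stab γ))
    (hw' : w' ∈ minRight b (X.stab γ')) (h : X.act γ.1 w = X.act γ'.1 w') : γ = γ' ∧ w = w' := by
  have h1 : X.act γ.1 (w * w'⁻¹) = γ'.1 := by
    rw [← act_act, h, act_act, mul_inv_cancel, act_one]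
  obtain ⟨rfl, h2⟩ := X.eq_of_act_eq h1
  exact ⟨rfl, (minRight_unique hw' hw h2 (by simp)).symm⟩

variable [P.IsRootSystem]

/-- Each orbit contains an anti-dominant weight: an element of the orbit whose pairing with the sum
of the positive coroots is minimal. -/
theorem exists_act_eq_anti (i : X.Shifted) : ∃ w, ∃ γ : X.Anti, X.act i w = γ.1 := by
  classical
  have := Fintype.ofFinite ι
  choose n hn using X.exists_int_pairing
  obtain ⟨w, hw⟩ := Finite.exists_min fun w => ∑ j with b.IsPos j, n (X.act i w) j
  refine ⟨w, ⟨X.act i w, fun k => ?_⟩, rfl⟩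
  have h1 : ∀ j, n (X.act i (w * simpleRefl b k)) j = n (X.act i w) (P.reflectionPerm k j) := by
    intro j
    have : (n (X.act i (w * simpleRefl b k)) j : K) = n (X.act i w) (P.reflectionPerm k j) := by
      rw [← hn, ← hn, ← act_act, pairing_act]; rfl
    exact_mod_cast this
  have h2 := hw (w * simpleRefl b k)
  simp only [h1] at h2
  have h3 := sum_isPos_reflectionPerm b (n (X.act i w)) k
  have h4 : n (X.act i w) (P.reflectionPerm k k) = - n (X.act i w) k := by
    have : (n (X.act i w) (P.reflectionPerm k k) : K) = - n (X.act i w) k := by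
      rw [← hn, ← hn, P.coroot_reflectionPerm, P.coreflection_apply_self, map_neg]
    exact_mod_cast this
  rw [h4] at h3
  refine ⟨(-n (X.act i w) k).toNat, ?_⟩
  rw [hn, ← Int.cast_natCast, Int.toNat_of_nonneg (by lia)]
  simp

theorem existsUnique_anti (i : X.Shifted) : ∃! γ : X.Anti, ∃ w, X.act γ.1 w = i := by
  obtain ⟨w, γ, h⟩ := X.exists_act_eq_anti i
  have h' : X.act γ.1 w⁻¹ = i := by rw [← h, act_act, mul_inv_cancel, act_one]
  refine ⟨γ, ⟨_, h'⟩, ?_⟩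
  rintro γ' ⟨w', h2⟩
  refine (X.eq_of_act_eq (w := w' * w) ?_).1
  rw [← act_act, h2, h]

/-- Every shifted weight has the form `i_γ^- w` with `w` in `{}^{J_γ} W`. -/
theorem exists_minRight (i : X.Shifted) :
    ∃ γ : X.Anti, ∃ w ∈ minRight b (X.stab γ), X.act γ.1 w = i := by
  obtain ⟨γ, ⟨z, hz⟩, -⟩ := X.existsUnique_anti i
  obtain ⟨u, hu, w, hw, rfl⟩ := exists_parabolic_mul_minRight (X.stab γ) z
  refine ⟨γ, w, hw, ?_⟩
  rw [← hz, ← act_act, X.act_of_mem_stabGroup hu]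

end WeightSet

end Orbits

/-! ### The weight module over the Hecke algebra -/

section WeightModule

variable {ι K M N : Type*} [Field K]
  [AddCommGroup M] [Module K M] [AddCommGroup N] [Module K N] {P : RootPairing ι K M N}
  {b : P.Base} [CharZero K] [Finite ι] [P.IsCrystallographic] [P.IsReduced] [P.IsRootSystem]

namespace WeightSet

variable (X : WeightSet b)

/-- The action of a generator on the basis vector attached to `w` in `{}^{J_γ} W`. -/
theorem genOp_vec {γ : X.Anti} {w : P.weylGroup} (hw : w ∈ minRight b (X.stab γ))
    (k : b.support) :
    (w * simpleRefl b k ∈ minRight b (X.stab γ) ∧ X.genOp k (X.vec (X.act γ.1 w)) =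
      X.vec (X.act γ.1 (w * simpleRefl b k)) +
        (if length b (w * simpleRefl b k) < length b w then qpow (-1) - qpow 1 else 0) •
          X.vec (X.act γ.1 w)) ∨
    ∃ j ∈ X.stab γ, simpleRefl b j * w = w * simpleRefl b k ∧
      length b w < length b (w * simpleRefl b k) ∧
      X.genOp k (X.vec (X.act γ.1 w)) = qpow (-1) • X.vec (X.act γ.1 w) := by
  have hlen := length_mul_simpleRefl b w k
  rw [genOp, Finsupp.linearCombination_single, one_smul, act_act]
  rcases mul_simpleRefl_mem_minRight_or hw k with h | ⟨j, hj, h⟩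
  · left
    refine ⟨h, ?_⟩
    have hne : X.act γ.1 (w * simpleRefl b k) ≠ X.act γ.1 w := by
      intro h1
      have h2 := congrArg (length b) (X.minRight_act_inj h hw h1).2
      lia
    have hpair := X.pairing_act γ.1 w k
    have hle := X.rootLE_act_simpleRefl_iff (X.act γ.1 w) k
    rw [act_act] at hle
    rw [if_neg hne, hle, hpair]
    by_cases h1 : length b w < length b (w * simpleRefl b k)
    · rw [if_pos (X.pairing_anti_of_isPos γ (lt_length_mul_simpleRefl_iff b |>.1 h1)),
        if_neg h1.not_gt, zero_smul, add_zero]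
    · rw [if_neg, if_pos (by lia)]
      rintro ⟨m, hm⟩
      obtain ⟨n, hn⟩ := X.pairing_anti_of_not_isPos γ
        (fun h2 => h1 (lt_length_mul_simpleRefl_iff b |>.2 h2))
      have h3 := (X.act_simpleRefl_eq_iff (X.act γ.1 w) k).2
        (by rw [hpair]; exact eq_zero_of_natCast_eq_neg hn hm)
      rw [act_act] at h3
      exact hne h3
  · right
    have h1 := mem_minRight_iff.1 hw j hj
    have hj' : X.act γ.1 (simpleRefl b j) = γ.1 := hj
    refine ⟨j, hj, h, by rwa [← h], if_pos ?_⟩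
    rw [← h, ← act_act, hj']

section Extension

variable {V : Type*} [AddCommGroup V] [Module A V]

open Classical in
/-- The linear map from the weight module, with basis `v_i`, to a right module over the Hecke
algebra that maps `v_{i_γ^- w}` to `n H_w` for `w` in `{}^{J_γ} W`, and vanishes on the other
orbits. -/
def extend (γ : X.Anti) (r : (Hecke b)ᵐᵒᵖ →ₐ[A] Module.End A V) (n : V) : X.Tmod →ₗ[A] V :=
  Finsupp.linearCombination A fun i =>
    if h : ∃ w ∈ minRight b (X.stab γ), X.act γ.1 w = i then
      r (MulOpposite.op (heckeH b h.choose)) n else 0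

variable (r : (Hecke b)ᵐᵒᵖ →ₐ[A] Module.End A V) (n : V)

theorem extend_vec {γ : X.Anti} {w : P.weylGroup} (hw : w ∈ minRight b (X.stab γ)) :
    X.extend γ r n (X.vec (X.act γ.1 w)) = r (MulOpposite.op (heckeH b w)) n := by
  have h : ∃ w' ∈ minRight b (X.stab γ), X.act γ.1 w' = X.act γ.1 w := ⟨w, hw, rfl⟩
  rw [extend, Finsupp.linearCombination_single, one_smul, dif_pos h,
    (X.minRight_act_inj h.choose_spec.1 hw h.choose_spec.2).2]

theorem extend_vec_of_ne {γ γ' : X.Anti} (hne : γ' ≠ γ) {w : P.weylGroup}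
    (hw : w ∈ minRight b (X.stab γ')) : X.extend γ r n (X.vec (X.act γ'.1 w)) = 0 := by
  rw [extend, Finsupp.linearCombination_single, one_smul, dif_neg]
  rintro ⟨w', hw', h⟩
  exact hne (X.minRight_act_inj hw hw' h.symm).1

/-- Two linear maps on the weight module agree if they agree on the vectors `v_{i_γ^- w}`. -/
theorem hom_ext {f g : X.Tmod →ₗ[A] V} (h : ∀ (γ : X.Anti), ∀ w ∈ minRight b (X.stab γ),
    f (X.vec (X.act γ.1 w)) = g (X.vec (X.act γ.1 w))) : f = g := by
  refine Finsupp.lhom_ext' fun i => LinearMap.ext_ring ?_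
  obtain ⟨γ, w, hw, rfl⟩ := X.exists_minRight i
  exact h γ w hw

/-- Frobenius reciprocity: the summand `x_γ ℋ` is induced from the character `H_k ↦ q⁻¹` of the
parabolic subalgebra, so that vectors of this weight define homomorphisms of right modules. -/
theorem extend_genOp {γ : X.Anti}
    (hn : ∀ k ∈ X.stab γ, r (MulOpposite.op (gen b k)) n = qpow (-1) • n) (k : b.support)
    (t : X.Tmod) :
    X.extend γ r n (X.genOp k t) = r (MulOpposite.op (gen b k)) (X.extend γ r n t) := by
  have hmul : ∀ x y : Hecke b, r (MulOpposite.op x) (r (MulOpposite.op y) n) =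
      r (MulOpposite.op (y * x)) n := fun x y => by
    rw [MulOpposite.op_mul, map_mul]; rfl
  suffices X.extend γ r n ∘ₗ X.genOp k = r (MulOpposite.op (gen b k)) ∘ₗ X.extend γ r n from
    LinearMap.congr_fun this t
  refine X.hom_ext fun γ' w hw => ?_
  rw [LinearMap.comp_apply, LinearMap.comp_apply]
  by_cases hγ : γ' = γ
  · subst hγ
    rw [X.extend_vec r n hw, hmul]
    rcases X.genOp_vec hw k with ⟨h1, h2⟩ | ⟨j, hj, h1, h2, h3⟩
    · rw [h2, map_add, map_smul, X.extend_vec r n hw, X.extend_vec r n h1, heckeH_mul_gen,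
        MulOpposite.op_add, MulOpposite.op_smul, map_add, map_smul]
      rfl
    · rw [h3, map_smul, X.extend_vec r n hw, heckeH_mul_gen_of_lt b h2, ← h1,
        ← gen_mul_heckeH_of_lt b (by rwa [h1]), ← hmul, hn j hj, map_smul]
  · rw [X.extend_vec_of_ne r n hγ hw, map_zero]
    rcases X.genOp_vec hw k with ⟨h1, h2⟩ | ⟨j, hj, h1, h2, h3⟩
    · rw [h2, map_add, map_smul, X.extend_vec_of_ne r n hγ hw, X.extend_vec_of_ne r n hγ h1]
      simp
    · rw [h3, map_smul, X.extend_vec_of_ne r n hγ hw, smul_zero]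

end Extension

variable (b) in
/-- The right regular representation of the Hecke algebra. -/
def rightReg : (Hecke b)ᵐᵒᵖ →ₐ[A] Module.End A (Hecke b) := Algebra.lsmul A A (Hecke b)

theorem omega_vec {γ : X.Anti} {w : P.weylGroup} (hw : w ∈ minRight b (X.stab γ)) :
    X.omega γ (X.vec (X.act γ.1 w)) = X.xsym γ * heckeH b w :=
  X.extend_vec (rightReg b) _ hw

theorem omega_vec_of_ne {γ γ' : X.Anti} (hne : γ' ≠ γ) {w : P.weylGroup}
    (hw : w ∈ minRight b (X.stab γ')) : X.omega γ (X.vec (X.act γ'.1 w)) = 0 :=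
  X.extend_vec_of_ne (rightReg b) _ hne hw

theorem omega_antiVec (γ : X.Anti) : X.omega γ (X.antiVec γ) = X.xsym γ := by
  have := X.omega_vec (one_mem_minRight (X.stab γ))
  rwa [act_one, heckeH_one, mul_one] at this

theorem omega_antiVec_of_ne {γ γ' : X.Anti} (h : γ' ≠ γ) : X.omega γ' (X.antiVec γ) = 0 := by
  have := X.omega_vec_of_ne h.symm (one_mem_minRight (X.stab γ))
  rwa [act_one] at this

theorem xsym_eq_klElement (γ : X.Anti) : X.xsym γ = klElement b (X.stabLongest γ) :=
  symmetrizer_eq_klElement (X.stab γ)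

theorem xsym_mem_biInv (γ : X.Anti) : X.xsym γ ∈ biInv (X.stab γ) (X.stab γ) := by
  rw [xsym_eq_klElement, stabLongest, stabGroup, coe_parabolic_eq_dcoset]
  exact klElement_mem_biInv (allDescent_longest 1)

theorem omega_genOp (γ : X.Anti) (k : b.support) (t : X.Tmod) :
    X.omega γ (X.genOp k t) = X.omega γ t * gen b k :=
  X.extend_genOp (rightReg b) (X.xsym γ) (fun k hk => (X.xsym_mem_biInv γ).2 k hk) k t

/-- The image of the weight module in the summand `x_γ ℋ` consists of left invariants. -/
theorem omega_mem_biInv (γ : X.Anti) (t : X.Tmod) : X.omega γ t ∈ biInv (X.stab γ) ∅ := by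
  induction t using Finsupp.induction_linear with
  | zero => rw [map_zero]; exact zero_mem _
  | add t t' h h' => rw [map_add]; exact add_mem h h'
  | single i a =>
    rw [← mul_one a, ← smul_eq_mul, ← Finsupp.smul_single, map_smul]
    refine Submodule.smul_mem _ _ ?_
    obtain ⟨γ', w, hw, rfl⟩ := X.exists_minRight i
    by_cases h : γ' = γ
    · subst h
      change X.omega γ' (X.vec _) ∈ _
      rw [X.omega_vec hw]
      refine ⟨fun k hk => ?_, by simp⟩
      rw [← mul_assoc, (X.xsym_mem_biInv γ').1 k hk, smul_mul_assoc]
    · change X.omega γ (X.vec _) ∈ _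
      rw [X.omega_vec_of_ne h hw]
      exact zero_mem _

/-- In `x_γ H_w = ∑ q^{ℓ(w_∘) - ℓ(u)} H_{uw}` the only minimal length representative is `w`. -/
theorem coord_xsym_mul_heckeH {γ : X.Anti} {w y : P.weylGroup}
    (hw : w ∈ minRight b (X.stab γ)) (hy : y ∈ minRight b (X.stab γ)) [Decidable (y = w)] :
    coord b y (X.xsym γ * heckeH b w) =
      if y = w then qpow (length b (X.stabLongest γ)) else 0 := by
  classical
  have h1 : ∀ u ∈ X.stabGroup γ, coord b y (heckeH b u * heckeH b w) =
      if u = 1 ∧ y = w then 1 else 0 := by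
    intro u hu
    rw [heckeH_mul_heckeH b (hw u hu), coord_heckeH]
    refine if_congr ⟨fun h => ?_, fun h => by rw [h.1, h.2, one_mul]⟩ rfl rfl
    have h2 := minRight_unique hw hy hu h
    rw [h2, right_eq_mul] at h
    exact ⟨h, h2.symm⟩
  rw [xsym, symmetrizer, smul_mul_assoc, map_smul, heckeSum, Finset.sum_mul, map_sum,
    Finset.sum_eq_single 1, smul_mul_assoc, map_smul, h1 1 (one_mem _)]
  · simp [stabLongest, stabGroup]
  · intro u hu hu1
    rw [Finset.mem_filter] at hu
    rw [smul_mul_assoc, map_smul, h1 u hu.2, if_neg (fun h => hu1 h.1), smul_zero]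
  · intro h
    exact absurd (Finset.mem_filter.2 ⟨Finset.mem_univ _, one_mem (parabolic b (X.stab γ))⟩) h

/-- The coordinates of a vector of the weight module are, up to a power of `q`, coefficients of its
images in the summands `x_γ ℋ`. -/
theorem coord_omega {γ : X.Anti} {y : P.weylGroup} (hy : y ∈ minRight b (X.stab γ))
    (t : X.Tmod) :
    coord b y (X.omega γ t) = qpow (length b (X.stabLongest γ)) * t (X.act γ.1 y) := by
  classical
  suffices coord b y ∘ₗ X.omega γ =
      qpow (length b (X.stabLongest γ)) • Finsupp.lapply (X.act γ.1 y) from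
    LinearMap.congr_fun this t
  refine X.hom_ext fun γ' w hw => ?_
  rw [LinearMap.comp_apply, LinearMap.smul_apply, Finsupp.lapply_apply, Finsupp.single_apply]
  by_cases h : γ' = γ
  · subst h
    rw [X.omega_vec hw, X.coord_xsym_mul_heckeH hw hy]
    by_cases h1 : y = w
    · rw [if_pos h1, if_pos (by rw [h1]), smul_eq_mul, mul_one]
    · rw [if_neg h1, if_neg (fun h2 => h1 (X.minRight_act_inj hw hy h2).2.symm), smul_zero]
  · rw [X.omega_vec_of_ne h hw, map_zero, if_neg (fun h2 => h (X.minRight_act_inj hw hy h2).1),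
      smul_zero]

/-- The maps to the summands `x_γ ℋ` are jointly injective. -/
theorem tmod_ext {t t' : X.Tmod} (h : ∀ γ, X.omega γ t = X.omega γ t') : t = t' := by
  refine Finsupp.ext fun i => ?_
  obtain ⟨γ, w, hw, rfl⟩ := X.exists_minRight i
  have h1 := congrArg (fun x => qpow (-(length b (X.stabLongest γ) : ℤ)) * coord b w x) (h γ)
  simpa only [X.coord_omega hw, ← mul_assoc, ← qpow_add, neg_add_cancel, qpow_zero, one_mul]
    using h1

/-- The summand `x_γ ℋ` is the module of all left invariants. -/
theorem exists_omega_eq {γ : X.Anti} {h : Hecke b} (hh : h ∈ biInv (X.stab γ) ∅) :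
    ∃ t, X.omega γ t = h ∧ ∀ γ' ≠ γ, X.omega γ' t = 0 := by
  classical
  set c : P.weylGroup → A := fun w => if w ∈ minRight b (X.stab γ) then
    qpow (-(length b (X.stabLongest γ) : ℤ)) * coord b w h else 0 with hc
  refine ⟨∑ w, c w • X.vec (X.act γ.1 w), ?_, fun γ' hne => ?_⟩
  · have key : ∀ y ∈ minRight b (X.stab γ),
        coord b y (X.omega γ (∑ w, c w • X.vec (X.act γ.1 w))) = coord b y h := by
      intro y hy
      rw [map_sum, map_sum, Finset.sum_eq_single y]
      · rw [map_smul, map_smul, X.omega_vec hy, X.coord_xsym_mul_heckeH hy hy, if_pos rfl, hc]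
        dsimp only
        rw [if_pos hy, smul_eq_mul, mul_right_comm, ← qpow_add, neg_add_cancel, qpow_zero, one_mul]
      · intro w _ hne
        by_cases hw : w ∈ minRight b (X.stab γ)
        · rw [map_smul, map_smul, X.omega_vec hw, X.coord_xsym_mul_heckeH hw hy, if_neg hne.symm,
            smul_zero]
        · rw [hc]
          dsimp only
          rw [if_neg hw, zero_smul, map_zero, map_zero]
      · simp
    refine hecke_ext_normCoord fun z => ?_
    obtain ⟨y, hy, hn⟩ := exists_noDescent (X.stab γ) ∅ z
    rw [← mem_biInv_iff.1 hh z y hy, ← mem_biInv_iff.1 (X.omega_mem_biInv γ _) z y hy, normCoord,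
      normCoord, key y (mem_minRight_iff_noDescent.2 hn)]
  · rw [map_sum]
    refine Finset.sum_eq_zero fun w _ => ?_
    by_cases hw : w ∈ minRight b (X.stab γ)
    · rw [map_smul, X.omega_vec_of_ne hne.symm hw, smul_zero]
    · rw [hc]
      dsimp only
      rw [if_neg hw, zero_smul, map_zero]

/-! ### The action of the whole Hecke algebra -/

/-- The free algebra acts on the weight module compatibly with its quotient, the Hecke algebra. As
the maps to the summands `x_γ ℋ` are jointly injective, its action factors through this quotient. -/
theorem omega_lift_genOp (γ : X.Anti) (x : FreeAlgebra A b.support) (t : X.Tmod) :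
    X.omega γ (((FreeAlgebra.lift A fun k => MulOpposite.op (X.genOp k)) x).unop t) =
      X.omega γ t * heckeMk b x := by
  induction x using FreeAlgebra.induction generalizing t with
  | grade0 a =>
    rw [AlgHom.commutes, AlgHom.commutes, ← Algebra.commutes, ← Algebra.smul_def, ← map_smul]
    rfl
  | grade1 k =>
    rw [FreeAlgebra.lift_ι_apply]
    exact X.omega_genOp γ k t
  | mul x y hx hy =>
    rw [map_mul, map_mul, ← mul_assoc, ← hx, ← hy]
    rfl
  | add x y hx hy =>
    rw [map_add (heckeMk b), mul_add, ← hx, ← hy, map_add, MulOpposite.unop_add,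
      LinearMap.add_apply, map_add]

/-- The right action of the Hecke algebra on the weight module. -/
def rep : (Hecke b)ᵐᵒᵖ →ₐ[A] Module.End A X.Tmod :=
  AlgHom.opComm (RingQuot.liftAlgHom A
    ⟨FreeAlgebra.lift A fun k => MulOpposite.op (X.genOp k), fun x y h => by
      apply MulOpposite.unop_injective
      refine LinearMap.ext fun t => X.tmod_ext fun γ => ?_
      rw [omega_lift_genOp, omega_lift_genOp]
      congr 1
      exact RingQuot.mkAlgHom_rel A h⟩ : Hecke b →ₐ[A] (Module.End A X.Tmod)ᵐᵒᵖ)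

theorem rep_heckeMk (x : FreeAlgebra A b.support) : X.rep (MulOpposite.op (heckeMk b x)) =
    ((FreeAlgebra.lift A fun k => MulOpposite.op (X.genOp k)) x).unop :=
  congrArg MulOpposite.unop (RingQuot.liftAlgHom_mkAlgHom_apply A _ _ x)

theorem rep_gen (k : b.support) : X.rep (MulOpposite.op (gen b k)) = X.genOp k := by
  rw [gen, rep_heckeMk, FreeAlgebra.lift_ι_apply, MulOpposite.unop_op]

theorem omega_rep (γ : X.Anti) (h : Hecke b) (t : X.Tmod) :
    X.omega γ (X.rep (MulOpposite.op h) t) = X.omega γ t * h := by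
  obtain ⟨x, rfl⟩ := exists_heckeMk b h
  rw [rep_heckeMk, omega_lift_genOp]

theorem mem_Sq_iff {f : Module.End A X.Tmod} : f ∈ X.Sq ↔ ∀ h, f * X.rep h = X.rep h * f := by
  rw [Sq, Subalgebra.mem_centralizer_iff]
  constructor
  · intro hf h
    obtain ⟨x, hx⟩ := exists_heckeMk b h.unop
    rw [← MulOpposite.op_unop h, ← hx]
    clear hx
    induction x using FreeAlgebra.induction with
    | grade0 a =>
      rw [AlgHom.commutes, ← MulOpposite.algebraMap_apply, AlgHom.commutes, Algebra.commutes]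
    | grade1 k =>
      have := hf _ ⟨k, rfl⟩
      rw [← rep_gen] at this
      exact this.symm
    | mul x y hx hy =>
      rw [map_mul, MulOpposite.op_mul, map_mul, ← mul_assoc, hy, mul_assoc, hx, mul_assoc]
    | add x y hx hy => rw [map_add, MulOpposite.op_add, map_add, mul_add, add_mul, hx, hy]
  · rintro hf _ ⟨k, rfl⟩
    rw [← rep_gen, hf]

/-- The vector `v_{i_γ^-}` generates the summand `x_γ ℋ`. -/
theorem vec_eq_rep {γ : X.Anti} {w : P.weylGroup} (hw : w ∈ minRight b (X.stab γ)) :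
    X.vec (X.act γ.1 w) = X.rep (MulOpposite.op (heckeH b w)) (X.antiVec γ) := by
  refine X.tmod_ext fun γ' => ?_
  rw [omega_rep]
  by_cases h : γ = γ'
  · subst h
    rw [X.omega_vec hw, omega_antiVec]
  · rw [X.omega_vec_of_ne h hw, X.omega_antiVec_of_ne (Ne.symm h), zero_mul]

end WeightSet

end WeightModule

/-! ### The `q`-Schur algebra -/

section Schur

variable {ι K M N : Type*} [Field K]
  [AddCommGroup M] [Module K M] [AddCommGroup N] [Module K N] {P : RootPairing ι K M N}
  {b : P.Base} [CharZero K]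

namespace WeightSet

variable {X : WeightSet b}

theorem Xi.lower_ne (ξ : X.Xi) (y : ξ.Below) : ξ ≠ ξ.lower y :=
  fun h => y.2.2.ne (congrArg Xi.elt h).symm

theorem Xi.lower_injective (ξ : X.Xi) : Function.Injective ξ.lower :=
  fun _ _ h => Subtype.ext (congrArg Xi.elt h)

theorem Xi.plus_mem [Finite ι] [P.IsRootSystem] (ξ : X.Xi) :
    ξ.plus ∈ dcoset (X.stab ξ.left) (X.stab ξ.right) ξ.elt := longest_dcoset_mem ξ.elt

variable [Finite ι] [P.IsCrystallographic] [P.IsReduced]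

theorem Xi.noDescent (ξ : X.Xi) : NoDescent (X.stab ξ.left) (X.stab ξ.right) ξ.elt :=
  mem_minDouble_iff.1 ξ.2

/-- Each element of the Weyl group lies in exactly one double coset of given type; here is its
label. -/
theorem exists_xi (γ ν : X.Anti) (z : P.weylGroup) :
    ∃ ξ : X.Xi, ξ.left = γ ∧ ξ.right = ν ∧ z ∈ dcoset (X.stab γ) (X.stab ν) ξ.elt := by
  obtain ⟨g, hg, h⟩ := exists_noDescent (X.stab γ) (X.stab ν) z
  exact ⟨⟨(γ, g, ν), mem_minDouble_iff.2 h⟩, rfl, rfl, mem_dcoset_comm hg⟩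

variable (X) [P.IsRootSystem]

/-- The component in `x_γ ℋ` of the value at `x_ν` of an element of the `q`-Schur algebra. -/
def entry (γ ν : X.Anti) : X.Sq →ₗ[A] Hecke b :=
  X.omega γ ∘ₗ LinearMap.applyₗ (X.antiVec ν) ∘ₗ X.Sq.val.toLinearMap

instance : Finite X.Shifted :=
  (X.finite.preimage (f := fun i : M => i - rho b) (sub_left_injective.injOn)).to_subtype

variable {X}

/-- An element of the `q`-Schur algebra is determined by its values on the generators `x_ν`. -/
theorem sq_ext {f f' : X.Sq} (h : ∀ γ ν, X.entry γ ν f = X.entry γ ν f') : f = f' := by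
  refine Subtype.ext (X.hom_ext fun ν w hw => ?_)
  have h1 : (f : Module.End A X.Tmod) (X.antiVec ν) = (f' : Module.End A X.Tmod) (X.antiVec ν) :=
    X.tmod_ext fun γ => h γ ν
  rw [X.vec_eq_rep hw, ← Module.End.mul_apply, ← Module.End.mul_apply, X.mem_Sq_iff.1 f.2,
    X.mem_Sq_iff.1 f'.2, Module.End.mul_apply, Module.End.mul_apply, h1]

/-- The values at `x_ν` inherit the right invariance of `x_ν`. -/
theorem entry_mem_biInv (γ ν : X.Anti) (f : X.Sq) :
    X.entry γ ν f ∈ biInv (X.stab γ) (X.stab ν) := by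
  refine ⟨(X.omega_mem_biInv γ _).1, fun k hk => ?_⟩
  have hk' : X.act ν.1 (simpleRefl b k) = ν.1 := hk
  have h1 : X.genOp k (X.antiVec ν) = qpow (-1) • X.antiVec ν := by
    rw [genOp, Finsupp.linearCombination_single, one_smul, if_pos hk']
  have h2 := LinearMap.congr_fun (X.mem_Sq_iff.1 f.2 (MulOpposite.op (gen b k))) (X.antiVec ν)
  rw [Module.End.mul_apply, Module.End.mul_apply, rep_gen, h1, map_smul] at h2
  exact (X.omega_genOp γ k _).symm.trans ((congrArg (X.omega γ) h2).symm.trans (map_smul _ _ _))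

/-- Every element of `x_γ ℋ ∩ ℋ x_ν` is the value at `x_ν` of some element of the `q`-Schur
algebra. -/
theorem exists_sendsTo {γ ν : X.Anti} {h : Hecke b} (hh : h ∈ biInv (X.stab γ) (X.stab ν)) :
    ∃ f, SendsTo (X := X) f γ ν h := by
  obtain ⟨n, hn, hn'⟩ := X.exists_omega_eq (γ := γ) (h := h) ⟨hh.1, by simp⟩
  have hinv : ∀ k ∈ X.stab ν, X.rep (MulOpposite.op (gen b k)) n = qpow (-1) • n := by
    intro k hk
    refine X.tmod_ext fun γ' => ?_
    rw [omega_rep, map_smul]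
    by_cases h1 : γ' = γ
    · rw [h1, hn, hh.2 k hk]
    · rw [hn' γ' h1, zero_mul, smul_zero]
  refine ⟨⟨X.extend ν X.rep n, ?_⟩, fun γ' ν' => ?_⟩
  · rw [Sq, Subalgebra.mem_centralizer_iff]
    rintro _ ⟨k, rfl⟩
    refine LinearMap.ext fun t => ?_
    have := X.extend_genOp X.rep n hinv k t
    rw [rep_gen] at this
    exact this.symm
  · change X.omega γ' (X.extend ν X.rep n (X.antiVec ν')) = _
    have h1 := one_mem_minRight (X.stab ν')
    by_cases h2 : ν' = ν
    · subst h2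
      have h3 := X.extend_vec X.rep n h1
      rw [act_one, heckeH_one, MulOpposite.op_one, map_one, Module.End.one_apply] at h3
      rw [h3]
      by_cases h4 : γ' = γ
      · rw [if_pos ⟨h4, rfl⟩, h4, hn]
      · rw [if_neg (fun h => h4 h.1), hn' γ' h4]
    · have h3 := X.extend_vec_of_ne X.rep n h2 h1
      rw [act_one] at h3
      rw [h3, map_zero, if_neg (fun h => h2 h.2)]

theorem SendsTo.unique {γ ν : X.Anti} {h : Hecke b} {f f' : X.Sq} (hf : SendsTo f γ ν h)
    (hf' : SendsTo f' γ ν h) : f = f' :=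
  sq_ext fun γ' ν' => (hf γ' ν').trans (hf' γ' ν').symm

theorem existsUnique_isBarOf (f : X.Sq) : ∃! f', IsBarOf f f' := by
  classical
  have := Fintype.ofFinite X.Anti
  choose F hF using fun γ ν => exists_sendsTo (bar_mem_biInv (entry_mem_biInv γ ν f))
  have hF' : ∀ γ ν γ' ν', X.entry γ' ν' (F γ ν) =
      if γ' = γ ∧ ν' = ν then bar b (X.entry γ ν f) else 0 := hF
  have h : IsBarOf f (∑ γ, ∑ ν, F γ ν) := by
    intro γ ν
    change X.entry γ ν _ = bar b (X.entry γ ν f)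
    rw [map_sum, Finset.sum_eq_single γ, map_sum, Finset.sum_eq_single ν, hF', if_pos ⟨rfl, rfl⟩]
    · exact fun ν' _ hne => by rw [hF', if_neg fun h => hne h.2.symm]
    · simp
    · intro γ' _ hne
      rw [map_sum]
      exact Finset.sum_eq_zero fun ν' _ => by rw [hF', if_neg fun h => hne h.1.symm]
    · simp
  exact ⟨_, h, fun f' hf' => sq_ext fun γ ν => (hf' γ ν).trans (h γ ν).symm⟩

theorem entry_barS (f : X.Sq) (γ ν : X.Anti) :
    X.entry γ ν (barS f) = bar b (X.entry γ ν f) :=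
  Classical.epsilon_spec (existsUnique_isBarOf f).exists γ ν

/-! ### The standard basis -/

theorem Xi.allDescent_plus (ξ : X.Xi) :
    AllDescent (X.stab ξ.left) (X.stab ξ.right) ξ.plus := allDescent_longest ξ.elt

/-- Triples of the same type with meeting double cosets are equal. -/
theorem Xi.ext_of_mem {ξ η : X.Xi} (hl : η.left = ξ.left) (hr : η.right = ξ.right)
    (h : η.plus ∈ ξ.coset) : η = ξ := by
  have h1 := η.plus_mem
  have h2 := η.noDescent
  rw [hl, hr] at h1 h2
  have h3 : η.elt ∈ dcoset (X.stab ξ.left) (X.stab ξ.right) ξ.elt := by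
    rw [← dcoset_eq h, dcoset_eq h1]
    exact mem_dcoset_self _
  exact Subtype.ext (Prod.ext hl (Prod.ext (ξ.noDescent.unique h2 h3).symm hr))

theorem existsUnique_isPhi (ξ : X.Xi) : ∃! f, IsPhi ξ f := by
  obtain ⟨f, hf⟩ := exists_sendsTo (Submodule.smul_mem _
    (qpow (length b (X.stabLongest ξ.right))) (heckeSum_dcoset_mem_biInv (X.stab ξ.left)
      (X.stab ξ.right) ξ.elt))
  exact ⟨f, hf, fun f' hf' => SendsTo.unique hf' hf⟩

open Classical in
theorem entry_std (ξ : X.Xi) (γ ν : X.Anti) : X.entry γ ν (std ξ) =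
    if γ = ξ.left ∧ ν = ξ.right then qpow (length b ξ.plus) • heckeSum b ξ.coset else 0 := by
  have h : X.entry γ ν (phi ξ) = _ := Classical.epsilon_spec (existsUnique_isPhi ξ).exists γ ν
  rw [std, map_smul, h]
  split_ifs
  · rw [smul_smul, ← qpow_add, sub_add_cancel]
  · rw [smul_zero]

/-- The coefficient of `[φ^g_{γν}]`, which is the coefficient of `H_{g^+}` in the value at
`x_ν`. -/
def stdCoord (ξ : X.Xi) : X.Sq →ₗ[A] A := coord b ξ.plus ∘ₗ X.entry ξ.left ξ.right

theorem stdCoord_apply (ξ : X.Xi) (f : X.Sq) :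
    stdCoord ξ f = coord b ξ.plus (X.entry ξ.left ξ.right f) := rfl

/-- All coefficients of the value at `x_ν` on a double coset are determined by that of its longest
element. -/
theorem coord_entry (ξ : X.Xi) (f : X.Sq) {z : P.weylGroup}
    (hz : z ∈ dcoset (X.stab ξ.left) (X.stab ξ.right) ξ.elt) :
    coord b z (X.entry ξ.left ξ.right f) =
      qpow ((length b ξ.plus : ℤ) - length b z) * stdCoord ξ f := by
  have h := mem_biInv_iff.1 (entry_mem_biInv ξ.left ξ.right f) ξ.plus z
    (by rwa [dcoset_eq ξ.plus_mem])
  rw [coord_eq_normCoord, h, normCoord, ← mul_assoc, ← qpow_add, stdCoord_apply, neg_add_eq_sub]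

theorem sq_ext_stdCoord {f f' : X.Sq} (h : ∀ ξ, stdCoord ξ f = stdCoord ξ f') : f = f' := by
  refine sq_ext fun γ ν => hecke_ext fun z => ?_
  obtain ⟨ξ, rfl, rfl, hz⟩ := exists_xi γ ν z
  rw [coord_entry ξ f hz, coord_entry ξ f' hz, h]

open Classical in
theorem stdCoord_std (η ξ : X.Xi) : stdCoord η (std ξ) = if η = ξ then 1 else 0 := by
  rw [stdCoord_apply, entry_std]
  by_cases h : η.left = ξ.left ∧ η.right = ξ.right
  · rw [if_pos h, map_smul, coord_eq_normCoord, normCoord_heckeSum]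
    by_cases h1 : η = ξ
    · subst h1
      have hmem : η.plus ∈ η.coset := η.plus_mem
      rw [if_pos rfl, if_pos hmem, mul_one, smul_eq_mul, ← qpow_add, add_neg_cancel,
        qpow_zero]
    · rw [if_neg h1, if_neg fun h2 => h1 (Xi.ext_of_mem h.1 h.2 h2), mul_zero, smul_zero]
  · rw [if_neg h, map_zero, if_neg]
    rintro rfl
    exact h ⟨rfl, rfl⟩

variable (X) in
/-- The standard basis of the `q`-Schur algebra. -/
def stdBasis : Module.Basis X.Xi A X.Sq :=
  Module.Basis.ofEquivFun (LinearEquiv.ofBijective (LinearMap.pi fun ξ : X.Xi => stdCoord ξ)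
    ⟨fun _ _ h => sq_ext_stdCoord (congrFun h), fun c => by
      classical
      have := Fintype.ofFinite X.Xi
      refine ⟨∑ ξ, c ξ • std ξ, funext fun η => ?_⟩
      simp [stdCoord_std]⟩)

theorem stdBasis_apply (ξ : X.Xi) : stdBasis X ξ = std ξ := by
  classical
  rw [stdBasis, Module.Basis.coe_ofEquivFun, LinearEquiv.symm_apply_eq]
  funext η
  rw [Pi.single_apply]
  exact (stdCoord_std η ξ).symm

/-! ### The canonical basis -/

theorem exists_canonical (ξ : X.Xi) :
    ∃ f, SendsTo (X := X) f ξ.left ξ.right (klElement b ξ.plus) :=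
  exists_sendsTo (klElement_mem_biInv ξ.allDescent_plus)

/-- The element of the canonical basis with label `ξ`; it is chosen as the one that maps `x_ν` to
`C_{g^+}`. -/
def canonical (ξ : X.Xi) : X.Sq := (exists_canonical ξ).choose

open Classical in
theorem entry_canonical (ξ : X.Xi) (γ ν : X.Anti) : X.entry γ ν (canonical ξ) =
    if γ = ξ.left ∧ ν = ξ.right then klElement b ξ.plus else 0 :=
  (exists_canonical ξ).choose_spec γ ν

theorem barS_canonical (ξ : X.Xi) : barS (canonical ξ) = canonical ξ := by
  classical
  refine sq_ext fun γ ν => ?_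
  rw [entry_barS, entry_canonical]
  split_ifs
  · exact bar_klElement _
  · exact map_zero _

open Classical in
theorem stdCoord_unitriangular (ξ : X.Xi) (c : ξ.Below → A) (η : X.Xi) :
    stdCoord η (std ξ + ∑ y, c y • std (ξ.lower y)) =
      (if η = ξ then 1 else 0) + ∑ y, if η = ξ.lower y then c y else 0 := by
  simp [stdCoord_std]

/-- The coefficients of the canonical basis elements in the standard basis are coefficients of
Kazhdan–Lusztig elements; they vanish outside the lower order ideal of `g`, since the projection
to minimal double coset representatives is monotone. -/
theorem canonical_eq (ξ : X.Xi) : canonical ξ = std ξ + ∑ y : ξ.Below,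
    coord b (ξ.lower y).plus (klElement b ξ.plus) • std (ξ.lower y) := by
  classical
  refine sq_ext_stdCoord fun η => ?_
  rw [stdCoord_unitriangular, stdCoord_apply, entry_canonical]
  by_cases h1 : η = ξ
  · subst h1
    rw [if_pos ⟨rfl, rfl⟩, if_pos rfl, coord_klElement_self, Finset.sum_eq_zero, add_zero]
    exact fun y _ => if_neg (η.lower_ne y)
  rw [if_neg h1, zero_add]
  by_cases h2 : ∃ y, η = ξ.lower y
  · obtain ⟨y, rfl⟩ := h2
    rw [if_pos ⟨rfl, rfl⟩, Finset.sum_eq_single y, if_pos rfl]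
    · exact fun y' _ hne => if_neg fun h => hne (ξ.lower_injective h).symm
    · simp
  · push Not at h2
    rw [Finset.sum_eq_zero fun y _ => if_neg (h2 y)]
    split_ifs with h
    · by_contra h3
      have h4 : η.plus ∈ dcoset (X.stab ξ.left) (X.stab ξ.right) η.elt := by
        have := η.plus_mem
        rwa [h.1, h.2] at this
      have h5 : NoDescent (X.stab ξ.left) (X.stab ξ.right) η.elt := by
        have := η.noDescent
        rwa [h.1, h.2] at this
      by_cases h6 : η.plus = ξ.plus
      · exact h1 (Xi.ext_of_mem h.1 h.2 (h6 ▸ ξ.plus_mem))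
      have h7 := ((isKLElement_iff.1 (isKLElement_klElement ξ.plus)).2.2 _ h6).2 h3
      rcases h5.le_of_le ξ.noDescent h4 ξ.plus_mem (Or.inr h7) with h8 | h8
      · exact h1 (Subtype.ext (Prod.ext h.1 (Prod.ext h8 h.2)))
      · exact h2 ⟨η.elt, mem_minDouble_iff.2 h5, h8⟩
          (Subtype.ext (Prod.ext h.1 (Prod.ext rfl h.2)))
    · exact map_zero _

theorem Xi.lower_plus_ne (ξ : X.Xi) (y : ξ.Below) : (ξ.lower y).plus ≠ ξ.plus := fun h =>
  ξ.lower_ne y (Xi.ext_of_mem (ξ := ξ) (η := ξ.lower y) rfl rfl (h ▸ ξ.plus_mem)).symm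

theorem isUnitriangular_canonical (ξ : X.Xi) : IsUnitriangular ξ (canonical ξ) :=
  ⟨_, fun y => inQZq_coord_klElement (ξ.lower_plus_ne y), canonical_eq ξ⟩

/-- Two bar invariant elements agree if the coefficients of their difference in the standard basis
lie in `q ℤ[q]`: this reduces to the same fact in the Hecke algebra, because the coefficient of
`H_z` in the value at `x_ν` is a power of `q` times that of the longest element in the double coset
of `z`. -/
theorem eq_of_barS_eq {f f' : X.Sq} (hf : barS f = f) (hf' : barS f' = f')
    (h : ∀ ξ, InQZq (stdCoord ξ f - stdCoord ξ f')) : f = f' := by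
  refine sq_ext fun γ ν => sub_eq_zero.1 ?_
  refine eq_zero_of_bar_eq (by rw [map_sub, ← entry_barS, ← entry_barS, hf, hf']) fun z hz => ?_
  obtain ⟨ξ, rfl, rfl, hmem⟩ := exists_xi γ ν z
  have hξ : stdCoord ξ f - stdCoord ξ f' =
      coord b ξ.plus (X.entry ξ.left ξ.right f - X.entry ξ.left ξ.right f') := by
    rw [map_sub]; rfl
  rcases le_longest hmem with h1 | h1
  · left
    rw [h1]
    exact hξ ▸ h ξ
  · right
    refine ⟨ξ.plus, h1.length_lt, fun h2 => hz ?_⟩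
    rw [map_sub, coord_entry ξ f hmem, coord_entry ξ f' hmem, ← mul_sub, hξ, h2, mul_zero]

theorem IsUnitriangular.inQZq_sub {ξ : X.Xi} {f f' : X.Sq} (hf : IsUnitriangular ξ f)
    (hf' : IsUnitriangular ξ f') (η : X.Xi) : InQZq (stdCoord η f - stdCoord η f') := by
  classical
  obtain ⟨c, hc, rfl⟩ := hf
  obtain ⟨c', hc', rfl⟩ := hf'
  rw [stdCoord_unitriangular, stdCoord_unitriangular, add_sub_add_left_eq_sub,
    ← Finset.sum_sub_distrib]
  refine InQZq.sum _ _ fun y _ => ?_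
  split_ifs
  · exact (hc y).sub (hc' y)
  · simpa using InQZq.zero

theorem eq_canonical {ξ : X.Xi} {f : X.Sq} (hf : barS f = f) (h : IsUnitriangular ξ f) :
    f = canonical ξ :=
  eq_of_barS_eq hf (barS_canonical ξ) (h.inQZq_sub (isUnitriangular_canonical ξ))

/-- The unitriangular expansion of the canonical basis can be inverted, by induction on `ℓ(g)`. -/
theorem std_mem_span_canonical (ξ : X.Xi) :
    std ξ ∈ Submodule.span A (Set.range (canonical (X := X))) := by
  generalize hn : length b ξ.elt = n
  induction n using Nat.strong_induction_on generalizing ξ with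
  | _ n ih =>
    set S : X.Sq := ∑ y : ξ.Below, coord b (ξ.lower y).plus (klElement b ξ.plus) • std (ξ.lower y)
      with hS
    have h : std ξ = canonical ξ + (-1 : A) • S := by
      rw [canonical_eq, ← hS, add_assoc]
      conv_rhs => rw [← one_smul A S, smul_smul, ← add_smul]
      simp
    rw [h]
    exact add_mem (Submodule.subset_span ⟨ξ, rfl⟩) (Submodule.smul_mem _ _ (sum_mem fun y _ =>
      Submodule.smul_mem _ _ (ih _ (hn ▸ y.2.2.length_lt) (ξ.lower y) rfl)))

variable (X) in
/-- The canonical basis of the `q`-Schur algebra. -/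
def canonicalBasis : Module.Basis X.Xi A X.Sq :=
  (stdBasis X).map (LinearEquiv.ofBijective ((stdBasis X).constr A canonical) (by
    have hs : Function.Surjective ((stdBasis X).constr A (canonical (X := X))) := by
      rw [← LinearMap.range_eq_top, Module.Basis.constr_range, eq_top_iff, ← (stdBasis X).span_eq,
        Submodule.span_le]
      rintro _ ⟨ξ, rfl⟩
      rw [stdBasis_apply]
      exact std_mem_span_canonical ξ
    have : Module.Finite A X.Sq := Module.Finite.of_basis (stdBasis X)
    exact ⟨OrzechProperty.injective_of_surjective_endomorphism _ hs, hs⟩))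

theorem canonicalBasis_apply (ξ : X.Xi) : canonicalBasis X ξ = canonical ξ := by
  rw [canonicalBasis, Module.Basis.map_apply]
  exact ((stdBasis X).constr_basis A canonical ξ)

end WeightSet

end Schur

end QSchur

end

open QSchur QSchur.WeightSet in
theorem mainTheorem2 {L : Type*} [LieRing L] [LieAlgebra ℂ L] [FiniteDimensional ℂ L]
    [LieAlgebra.IsSimple ℂ L] (H : LieSubalgebra ℂ L) [H.IsCartanSubalgebra]
    (b : (LieAlgebra.IsKilling.rootSystem H).Base) (X : WeightSet b) :
    -- the ingredients are well defined
    (∃ r : (Hecke b)ᵐᵒᵖ →ₐ[A] Module.End A X.Tmod,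
      (∀ k, r (MulOpposite.op (gen b k)) = X.genOp k) ∧
      ∀ f : Module.End A X.Tmod, f ∈ X.Sq ↔ ∀ h, f * r h = r h * f) ∧
    (∀ i : X.Shifted, ∃! γ : X.Anti, ∃ w, X.act γ.1 w = i) ∧
    (∀ l : List b.support, length b (l.map (simpleRefl b)).prod = l.length →
      heckeH b (l.map (simpleRefl b)).prod = (l.map (gen b)).prod) ∧
    (∀ w, ∃! c, IsKLElement b w c) ∧
    (∃! p, IsKLFamily b p) ∧
    (∀ γ k t, X.omega γ (X.genOp k t) = X.omega γ t * gen b k) ∧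
    Function.Injective (fun (t : X.Tmod) (γ : X.Anti) => X.omega γ t) ∧
    (∀ γ : X.Anti, X.omega γ (X.antiVec γ) = X.xsym γ ∧
      (∀ γ' ≠ γ, X.omega γ' (X.antiVec γ) = 0) ∧
      X.xsym γ = klElement b (X.stabLongest γ)) ∧
    (∀ f : X.Sq, ∃! f', IsBarOf f f') ∧
    (∀ ξ : X.Xi, ∃! f, IsPhi ξ f) ∧
    -- the standard basis
    (∃ B₀ : Module.Basis X.Xi A X.Sq, ∀ ξ, B₀ ξ = std ξ) ∧
    -- the canonical basis
    ∃ B : Module.Basis X.Xi A X.Sq, ∀ ξ : X.Xi,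
      SendsTo (B ξ) ξ.left ξ.right (klElement b ξ.plus) ∧
      barS (B ξ) = B ξ ∧
      IsUnitriangular ξ (B ξ) ∧
      B ξ = std ξ + ∑ y : ξ.Below,
        (qpow ((length b ξ.plus : ℤ) - length b (ξ.lower y).plus) *
          Polynomial.aeval (qpow (-2)) (klPoly b (ξ.lower y).plus ξ.plus)) • std (ξ.lower y) ∧
      ∀ f : X.Sq, barS f = f → IsUnitriangular ξ f → f = B ξ := by
  refine ⟨⟨X.rep, X.rep_gen, fun f => X.mem_Sq_iff⟩, X.existsUnique_anti, heckeH_wordProd b,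
    fun w => ⟨_, isKLElement_klElement w, fun c hc => (klElement_eq hc).symm⟩,
    existsUnique_isKLFamily, X.omega_genOp,
    fun t t' h => X.tmod_ext (congrFun h),
    fun γ => ⟨X.omega_antiVec γ, fun γ' h => X.omega_antiVec_of_ne h, X.xsym_eq_klElement γ⟩,
    existsUnique_isBarOf, existsUnique_isPhi, ⟨stdBasis X, stdBasis_apply⟩,
    canonicalBasis X, fun ξ => ?_⟩
  rw [canonicalBasis_apply]
  refine ⟨(exists_canonical ξ).choose_spec, barS_canonical ξ, isUnitriangular_canonical ξ, ?_,
    fun f hf h => eq_canonical hf h⟩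
  simp only [← coord_klElement]
  exact canonical_eq ξ
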